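/- **Setting.** Let $d\ge 1$, let $\Omega\subset\mathbb R^d$ be a bounded open set, let $f\in L^2(\Omega)$ with $f\ge 0$, and let $\alpha>0$. For an open bounded set $A\subset\mathbb R^d$, $\beta>0$ and $n\ge 1$, put $r=\beta n^{-1/d}$ and let $\mathcal A(\beta,n)(A)$ be the class of sets $\Sigma=\overline A\cap\bigcup_{i=1}^n\overline{B(x_i,r)}$ with $x_1,\dots,x_n$ (not necessarily distinct) in the $r$-neighbourhood $\{x:\operatorname{dist}(x,A)<r\}$ of $A$. For such $\Sigma$ and $h\in L^2(A)$, $h\ge0$, let $u_{h,\Sigma,A}\in H^1_0(A\setminus\Sigma)$ (extended by $0$) be the weak solution of $-\Delta u=h$ in $A\setminus\Sigma$, $u=0$ on $\Sigma\cup\partial A$, i.e. $\int_A\nabla u\cdot\nabla\phi\,dx=\int_A h\phi\,dx$ for all $\phi\in H_0^1(A\setminus\Sigma)$, and let $F(\Sigma,h,A)=\int_A h\,u_{h,\Sigma,A}\,dx$ be the compliance. Let $p:\mathbb R^d\to\overline\Omega$ be a fixed projection onto $\overline\Omega$ (any map with $p(y)=y$ for all $y\in\overline\Omega$). For $\mu\in\mathcal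 P(\overline\Omega)$ set $$F_n(\mu)=\inf\Big\{n^{2/d}F(\Sigma,f,\Omega)\ :\ \Sigma=\overline\Omega\cap\bigcup_{i=1}^n\overline{B(x_i,\alpha n^{-1/d})}\in\mathcal A(\alpha,n)(\Omega),\ \mu=\frac1n\sum_{i=1}^n\delta_{p(x_i)}\Big\},$$ where the $x_i$ range over all admissible centres, i.e. over the $\alpha n^{-1/d}$-neighbourhood of $\Omega$, and $\inf\emptyset=+\infty$. With $I^d=(0,1)^d$, define for $\beta>0$ $$\theta(\beta)=\inf\Big\{\liminf_{n\to\infty}n^{2/d}F(\Sigma_n,1,I^d)\ :\ \Sigma_n\in\mathcal A(\beta,n)(I^d)\ \text{for all } n\Big\},$$ and, for $\beta\ge 0$, $\theta^-(\beta)=\sup\{\theta(\gamma):\gamma>\beta\}\in[0,+\infty]$ (the lower semicontinuous envelope of the nonincreasing function $\theta$). **Theorem 2.2.** As $n\to\infty$, the functionals $F_n$ $\Gamma$-converge, with respect to the weak* topology on $\mathcal P(\overline\Omega)$, to $$F(\mu)=\int_\Omega\frac{f^2}{\mu_a^{2/d}}\,\theta^-\big(\alpha\,\mu_a^{1/d}\big)\,dx,$$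 where $\mu_a$ is the density of the absolutely continuous part of $\mu$ with respect to Lebesgue measure; the integrand is read as $+\infty$ where $\mu_a=0$ and $f>0$, and as $0$ where $f=0$. That is: for every $\mu$ and every sequence $\mu_n\to\mu$ weakly* in $\mathcal P(\overline\Omega)$, $F(\mu)\le\liminf_n F_n(\mu_n)$; and for every $\mu\in\mathcal P(\overline\Omega)$ there is a sequence $\mu_n\to\mu$ weakly* with $\limsup_n F_n(\mu_n)\le F(\mu)$. -/

import Mathlib

open Set Filter Topology MeasureTheory
open scoped ENNReal ContDiff

namespace ComplianceLocation

noncomputable section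

/-- The Euclidean space of dimension `d`. -/
abbrev Space (d : ℕ) : Type := EuclideanSpace ℝ (Fin d)

/-- Test functions on `U`: smooth functions with compact support contained in `U`. -/
def IsTestFunction {d : ℕ} (U : Set (Space d)) (φ : Space d → ℝ) : Prop :=
  ContDiff ℝ ∞ φ ∧ HasCompactSupport φ ∧ tsupport φ ⊆ U

/-- `u` belongs to `H₀¹(U)` and has weak gradient `g`, both extended by zero outside `U`: the pair
`(u, g)` is a limit in `L² × L²` of pairs `(φ, ∇φ)` with `φ` a test function on `U`, that is, `u`
lies in the closure of the test functions for the `H¹` norm. -/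
def MemH10 {d : ℕ} (U : Set (Space d)) (u : Space d → ℝ) (g : Space d → Space d) : Prop :=
  MemLp u 2 volume ∧ MemLp g 2 volume ∧
    ∃ φ : ℕ → Space d → ℝ, (∀ k, IsTestFunction U (φ k)) ∧
      Tendsto (fun k => eLpNorm (fun x => φ k x - u x) 2 volume) atTop (𝓝 0) ∧
      Tendsto (fun k => eLpNorm (fun x => gradient (φ k) x - g x) 2 volume) atTop (𝓝 0)

/-- `u`, with weak gradient `g`, is the weak solution of `-Δu = f` in `Ω \ S`, `u = 0` on
`S ∪ ∂Ω`: it lies in `H₀¹(Ω \ S)` and satisfies the weak equation against all of `H₀¹(Ω \ S)`. -/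
def IsWeakSolution {d : ℕ} (S : Set (Space d)) (f : Space d → ℝ) (Ω : Set (Space d))
    (u : Space d → ℝ) (g : Space d → Space d) : Prop :=
  MemH10 (Ω \ S) u g ∧
    ∀ (φ : Space d → ℝ) (ψ : Space d → Space d), MemH10 (Ω \ S) φ ψ →
      ∫ x in Ω, inner ℝ (g x) (ψ x) = ∫ x in Ω, f x * φ x

open Classical in
/-- The weak solution `u_{f,S,Ω}`. It exists and is unique almost everywhere when `Ω` is bounded
and open, `S` is closed and `f ∈ L²(Ω)`; the value `0` is never used in that case. -/
def weakSolution {d : ℕ} (S : Set (Space d)) (f : Space d → ℝ) (Ω : Set (Space d)) :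
    Space d → ℝ :=
  if h : ∃ u : Space d → ℝ, ∃ g : Space d → Space d, IsWeakSolution S f Ω u g then h.choose else 0

/-- The compliance `F(S, f, Ω) = ∫_Ω f u_{f,S,Ω}`. -/
def compliance {d : ℕ} (S : Set (Space d)) (f : Space d → ℝ) (Ω : Set (Space d)) : ℝ :=
  ∫ x in Ω, f x * weakSolution S f Ω x

/-- The compliance does not depend on which weak solution is chosen. -/
theorem compliance_eq {d : ℕ} {S : Set (Space d)} {f : Space d → ℝ} {Ω : Set (Space d)}
    {u : Space d → ℝ} {g : Space d → Space d} (h : IsWeakSolution S f Ω u g) :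
    compliance S f Ω = ∫ x in Ω, f x * u x := by
  have hex : ∃ u : Space d → ℝ, ∃ g : Space d → Space d, IsWeakSolution S f Ω u g := ⟨u, g, h⟩
  unfold compliance weakSolution
  rw [dif_pos hex]
  obtain ⟨g', h'⟩ := hex.choose_spec
  rw [← h.2 _ _ h'.1, ← h'.2 _ _ h.1]
  simp only [real_inner_comm]

/-- The common radius `α n^{-1/d}` of the balls. -/
def radius (d : ℕ) (α : ℝ) (n : ℕ) : ℝ := α * (n : ℝ) ^ (-(1 : ℝ) / d)

/-- The part in the closure of `Ω` of the union of the `n` closed balls with centres `x i` and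
radius `α n^{-1/d}`. -/
def ballUnion {d : ℕ} (α : ℝ) {n : ℕ} (Ω : Set (Space d)) (x : Fin n → Space d) :
    Set (Space d) :=
  closure Ω ∩ ⋃ i, Metric.closedBall (x i) (radius d α n)

/-- The centres lie in the `r`-neighbourhood of `Ω`, where `r = α n^{-1/d}`. -/
def AdmissibleCentres {d : ℕ} (α : ℝ) {n : ℕ} (Ω : Set (Space d)) (x : Fin n → Space d) : Prop :=
  ∀ i, x i ∈ Metric.thickening (radius d α n) Ω

/-- The class `𝒜(α, n)(Ω)` of admissible Dirichlet regions. -/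
def admissible {d : ℕ} (α : ℝ) (n : ℕ) (Ω : Set (Space d)) : Set (Set (Space d)) :=
  {S | ∃ x : Fin n → Space d, AdmissibleCentres α Ω x ∧ S = ballUnion α Ω x}

/-- The rescaled compliance `n^{2/d} F(S, f, Ω)`, as an extended nonnegative number. -/
def scaledCompliance {d : ℕ} (n : ℕ) (S : Set (Space d)) (f : Space d → ℝ) (Ω : Set (Space d)) :
    ℝ≥0∞ :=
  ENNReal.ofReal ((n : ℝ) ^ ((2 : ℝ) / d) * compliance S f Ω)

/-- The uniform probability measure `n⁻¹ ∑ δ_{p(x i)}` on the projected centres. -/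
def empirical {d n : ℕ} {Ω : Set (Space d)} (p : Space d → closure Ω) (x : Fin n → Space d) :
    Measure (closure Ω) :=
  (n : ℝ≥0∞)⁻¹ • ∑ i, Measure.dirac (p (x i))

/-- The functional `F_n` on probability measures on the closure of `Ω`: the value at `μ` is
`n^{2/d} F(S, f, Ω)` if `μ` is the uniform measure on the (projected) centres of an admissible
configuration, and `+∞` if there is none. If distinct centres outside the closure of `Ω` are
projected to the same point, several configurations may have the same measure `μ`; the
infimum over them is taken. -/
def functionalSeq {d : ℕ} (Ω : Set (Space d)) (p : Space d → closure Ω) (f : Space d → ℝ)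
    (α : ℝ) (n : ℕ) (μ : ProbabilityMeasure (closure Ω)) : ℝ≥0∞ :=
  ⨅ (x : Fin n → Space d) (_ : AdmissibleCentres α Ω x)
    (_ : (μ : Measure (closure Ω)) = empirical p x), scaledCompliance n (ballUnion α Ω x) f Ω

/-- The open unit cube `(0, 1)^d`. -/
def unitCube (d : ℕ) : Set (Space d) := {x | ∀ i, x i ∈ Ioo (0 : ℝ) 1}

/-- The cell constant `θ(α)`. -/
def theta (d : ℕ) (α : ℝ) : ℝ≥0∞ :=
  ⨅ (S : ℕ → Set (Space d)) (_ : ∀ n, S n ∈ admissible α n (unitCube d)),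
    liminf (fun n => scaledCompliance n (S n) (fun _ => 1) (unitCube d)) atTop

/-- The lower semicontinuous envelope of the nonincreasing function `θ`. -/
def thetaMinus (d : ℕ) (α : ℝ) : ℝ≥0∞ := ⨆ (β : ℝ) (_ : α < β), theta d β

/-- The density `μ_a` of the absolutely continuous part of `μ` with respect to Lebesgue measure. -/
def acDensity {d : ℕ} {Ω : Set (Space d)} (μ : ProbabilityMeasure (closure Ω)) : Space d → ℝ≥0∞ :=
  ((μ : Measure (closure Ω)).map Subtype.val).rnDeriv volume

/-- The limit functional `∫_Ω f² μ_a^{-2/d} θ⁻(α μ_a^{1/d})`. With the conventions of extended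
nonnegative numbers, the integrand is `+∞` where `μ_a = 0 < f`, and `0` where `f = 0`. -/
def limitFunctional {d : ℕ} (Ω : Set (Space d)) (f : Space d → ℝ) (α : ℝ)
    (μ : ProbabilityMeasure (closure Ω)) : ℝ≥0∞ :=
  ∫⁻ x in Ω, ENNReal.ofReal (f x ^ 2) / acDensity μ x ^ ((2 : ℝ) / d) *
    thetaMinus d (α * (acDensity μ x).toReal ^ ((1 : ℝ) / d))

/-- Γ-convergence of `F n` to `G` (sequential form, which is equivalent to the topological one on
first countable spaces, such as the probability measures on a compact metric space). -/
def GammaConverges {X : Type*} [TopologicalSpace X] (F : ℕ → X → ℝ≥0∞) (G : X → ℝ≥0∞) : Prop :=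
  (∀ (x : X) (y : ℕ → X), Tendsto y atTop (𝓝 x) → G x ≤ liminf (fun n => F n (y n)) atTop) ∧
    ∀ x : X, ∃ y : ℕ → X, Tendsto y atTop (𝓝 x) ∧ limsup (fun n => F n (y n)) atTop ≤ G x

end

end ComplianceLocation

/-! The compliance is a supremum: completing the square in the weak equation gives ∫ f u = sup (2 ∫
f φ - ∫ |∇φ|²) over test functions φ on Ω \ Σ (`ofReal_compliance`). In this form, `dualEnergy`, a
few elementary properties replace the PDE: it grows with the open set, is additive over disjoint
open sets, is multiplied by l^(d+2) under a homothety of ratio l when the load is 1, and is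
quadratic in constant loads. Moreover `dualEnergy_le_add` allows the load to be changed at the price
of the energy of the difference.

These properties localise the problem. In a cube of side δ containing about ρ δ^d n balls, blowing
up to the unit cube turns the radius α n^(-1/d) into β m^(-1/d), where m = ρ δ^d n and β = α
ρ^(1/d). The rescaled energy is therefore about δ^d ρ^(-2/d) θ(α ρ^(1/d)), that is, δ^d times
`cellDensity`. Replacing f by a function g constant on small cubes and summing gives the integral.
The error of this replacement, amplified by n^(2/d), is controlled by walls: covering parallel
hyperplanes at distance K n^(-1/d) takes only a small fraction of n balls (`exists_walls`) and
forces a Poincaré inequality with constant of order K² n^(-2/d) (`dualEnergy_le_of_walls`), so the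
error is at most a multiple of K² ‖f - g‖² in L².

Lower bound: cutting along the faces of the cubes and adding wall balls only lower the energy. Weak*
convergence bounds from above the number of balls near a closed cube, and
`eventually_le_dualEnergy_cube` then bounds the energy from below. The mesh tends to zero by
differentiation of measures and Fatou's lemma; the small excess of density, sent to 0, turns θ into
θ⁻ (`limitDensity_le_liminf`).

Upper bound: one nearly optimal configuration of m balls, completed by few balls covering the
boundary of the unit cube, is repeated periodically (`exists_tile`, `exists_tiling`); the covered
faces decouple the tiles, so that additivity gives the energy. Room for the walls, and the strict
inequality between densities needed to bound θ by θ⁻, come from `exists_perturbation`: a little mass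
is removed from μ where this is cheap, half of it is spread uniformly over Ω and the other half is
reserved for walls. The centres approximate the measure in the Lévy–Prokhorov distance, and a
diagonal argument concludes. -/

namespace ComplianceLocation

noncomputable section

/-! ### Calculus of test functions. -/

section TestFunctions
variable {d : ℕ} {U V : Set (Space d)} {φ ψ : Space d → ℝ}

theorem IsTestFunction.mono (h : IsTestFunction U φ) (hUV : U ⊆ V) : IsTestFunction V φ :=
  ⟨h.1, h.2.1, h.2.2.trans hUV⟩

theorem isTestFunction_zero : IsTestFunction U (fun _ => 0) :=
  ⟨contDiff_const, HasCompactSupport.zero, by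
    have : tsupport (fun _ : Space d => (0 : ℝ)) = ∅ := tsupport_eq_empty_iff.2 rfl
    rw [this]; exact empty_subset _⟩

theorem IsTestFunction.continuous (h : IsTestFunction U φ) : Continuous φ := h.1.continuous

theorem IsTestFunction.differentiable (h : IsTestFunction U φ) : Differentiable ℝ φ :=
  h.1.differentiable (by simp)

theorem IsTestFunction.eq_zero (h : IsTestFunction U φ) {x : Space d} (hx : x ∉ U) : φ x = 0 :=
  image_eq_zero_of_notMem_tsupport fun h' => hx (h.2.2 h')

theorem gradient_eq_zero_of_notMem_tsupport {x : Space d} (hx : x ∉ tsupport φ) :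
    gradient φ x = 0 := by
  rw [gradient, fderiv_of_notMem_tsupport ℝ hx, map_zero]

theorem IsTestFunction.gradient_eq_zero (h : IsTestFunction U φ) {x : Space d} (hx : x ∉ U) :
    gradient φ x = 0 :=
  gradient_eq_zero_of_notMem_tsupport fun h' => hx (h.2.2 h')

theorem IsTestFunction.continuous_gradient (h : IsTestFunction U φ) : Continuous (gradient φ) :=
  (InnerProductSpace.toDual ℝ (Space d)).symm.continuous.comp (h.1.continuous_fderiv (by simp))

theorem IsTestFunction.hasCompactSupport_gradient (h : IsTestFunction U φ) :
    HasCompactSupport (gradient φ) :=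
  HasCompactSupport.intro h.2.1 fun _ hx => gradient_eq_zero_of_notMem_tsupport hx

theorem IsTestFunction.memLp (h : IsTestFunction U φ) : MemLp φ 2 volume :=
  h.continuous.memLp_of_hasCompactSupport h.2.1

theorem IsTestFunction.memLp_gradient (h : IsTestFunction U φ) : MemLp (gradient φ) 2 volume :=
  h.continuous_gradient.memLp_of_hasCompactSupport h.hasCompactSupport_gradient

theorem IsTestFunction.integrable_gradient_sq (h : IsTestFunction U φ) :
    Integrable (fun x => ‖gradient φ x‖ ^ 2) := h.memLp_gradient.integrable_norm_pow (by simp)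

theorem IsTestFunction.integrable_sq (h : IsTestFunction U φ) :
    Integrable (fun x => φ x ^ 2) := h.memLp.integrable_sq

theorem IsTestFunction.integrable_mul (h : IsTestFunction U φ) {w : Space d → ℝ}
    (hw : MemLp w 2 (volume.restrict U)) : Integrable (fun x => w x * φ x) := by
  have h1 : IntegrableOn (fun x => w x * φ x) U :=
    hw.integrable_mul (h.memLp.mono_measure Measure.restrict_le_self)
  refine (integrableOn_iff_integrable_of_support_subset ?_).1 h1
  intro x hx
  by_contra hxU
  exact hx (by simp [h.eq_zero hxU])

theorem gradient_add' {x : Space d} (hφ : DifferentiableAt ℝ φ x) (hψ : DifferentiableAt ℝ ψ x) :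
    gradient (fun x => φ x + ψ x) x = gradient φ x + gradient ψ x := by
  simp only [gradient]
  rw [fderiv_fun_add hφ hψ, map_add]

theorem gradient_const_mul' {x : Space d} (c : ℝ) :
    gradient (fun x => c * φ x) x = c • gradient φ x := by
  simp only [gradient]
  have : (fun x => c * φ x) = c • φ := rfl
  rw [this, fderiv_const_smul_field, Pi.smul_apply, map_smul]

theorem IsTestFunction.add (hφ : IsTestFunction U φ) (hψ : IsTestFunction U ψ) :
    IsTestFunction U (fun x => φ x + ψ x) :=
  ⟨hφ.1.add hψ.1, hφ.2.1.add hψ.2.1,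
    (tsupport_add φ ψ).trans (union_subset hφ.2.2 hψ.2.2)⟩

theorem IsTestFunction.const_mul (hφ : IsTestFunction U φ) (c : ℝ) :
    IsTestFunction U (fun x => c * φ x) :=
  ⟨contDiff_const.mul hφ.1, hφ.2.1.mul_left,
    (tsupport_mul_subset_right).trans hφ.2.2⟩

/-- A test function on a disjoint union of open sets restricts to a test function on each. -/
theorem IsTestFunction.indicator (hφ : IsTestFunction (U ∪ V) φ) (hU : IsOpen U) (hV : IsOpen V)
    (hUV : Disjoint U V) : IsTestFunction U (U.indicator φ) := by
  -- Cutting off creates no jump: a point of the support has a neighbourhood inside U or inside V,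
  -- and off the support φ is locally zero.
  have hloc : ∀ x, (U.indicator φ =ᶠ[𝓝 x] φ ∧ x ∈ U) ∨ (U.indicator φ =ᶠ[𝓝 x] fun _ => 0) := by
    intro x
    by_cases hx : x ∈ tsupport φ
    · rcases hφ.2.2 hx with hxU | hxV
      · left
        refine ⟨?_, hxU⟩
        filter_upwards [hU.mem_nhds hxU] with y hy using indicator_of_mem hy _
      · right
        filter_upwards [hV.mem_nhds hxV] with y hy
        exact indicator_of_notMem (fun h => (disjoint_left.1 hUV) h hy) _
    · right
      have := notMem_tsupport_iff_eventuallyEq.1 hx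
      filter_upwards [this] with y hy
      by_cases hyU : y ∈ U
      · rw [indicator_of_mem hyU, hy]; rfl
      · rw [indicator_of_notMem hyU]
  have hts : tsupport (U.indicator φ) ⊆ U := by
    intro x hx
    rcases hloc x with h | h
    · exact h.2
    · exact absurd hx (notMem_tsupport_iff_eventuallyEq.2 h)
  refine ⟨contDiff_iff_contDiffAt.2 fun x => ?_, ?_, hts⟩
  · rcases hloc x with h | h
    · exact hφ.1.contDiffAt.congr_of_eventuallyEq h.1
    · exact contDiffAt_const.congr_of_eventuallyEq h
  · refine hφ.2.1.of_isClosed_subset (isClosed_tsupport _) (closure_mono ?_)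
    intro x hx
    simp only [Function.mem_support, ne_eq, indicator_apply_eq_zero, not_forall] at hx ⊢
    exact hx.2

end TestFunctions

/-! ### The energy as a supremum: monotonicity, homogeneity, additivity. -/

section DualEnergy
variable {d : ℕ} {U V : Set (Space d)} {φ ψ h w : Space d → ℝ}

/-- The functional `2 ∫ h φ - ∫ |∇φ|²`, whose supremum is the compliance. -/
def energyGap (h φ : Space d → ℝ) : ℝ :=
  2 * (∫ x, h x * φ x) - ∫ x, ‖gradient φ x‖ ^ 2

/-- The supremum of `2 ∫ h φ - ∫ |∇φ|²` over the test functions on `U`. -/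
def dualEnergy (U : Set (Space d)) (h : Space d → ℝ) : ℝ≥0∞ :=
  ⨆ (φ : Space d → ℝ) (_ : IsTestFunction U φ), ENNReal.ofReal (energyGap h φ)

theorem le_dualEnergy (hφ : IsTestFunction U φ) :
    ENNReal.ofReal (energyGap h φ) ≤ dualEnergy U h :=
  le_iSup₂ (f := fun φ (_ : IsTestFunction U φ) => ENNReal.ofReal (energyGap h φ)) φ hφ

/-- Enlarging the Dirichlet region removes competitors. Hence walls and cube faces may be added
freely in lower bounds. -/
theorem dualEnergy_mono (hUV : U ⊆ V) : dualEnergy U h ≤ dualEnergy V h :=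
  iSup₂_le fun _ hφ => le_dualEnergy (hφ.mono hUV)

theorem energyGap_congr (hφ : IsTestFunction U φ) (hhw : ∀ᵐ x, x ∈ U → h x = w x) :
    energyGap h φ = energyGap w φ := by
  unfold energyGap
  congr 2
  refine integral_congr_ae (μ := volume) ?_
  filter_upwards [hhw] with x hx
  by_cases hxU : x ∈ U
  · rw [hx hxU]
  · simp [hφ.eq_zero hxU]

theorem dualEnergy_congr (hhw : ∀ᵐ x, x ∈ U → h x = w x) : dualEnergy U h = dualEnergy U w := by
  unfold dualEnergy
  refine iSup_congr fun φ => iSup_congr fun hφ => ?_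
  rw [energyGap_congr hφ hhw]

theorem energyGap_zero_right : energyGap h (fun _ => 0) = 0 := by
  simp [energyGap, gradient, fderiv_const_apply]

theorem dualEnergy_zero : dualEnergy U (fun _ => 0) = 0 := by
  refine le_antisymm (iSup₂_le fun φ hφ => ?_) zero_le
  refine le_of_eq (ENNReal.ofReal_eq_zero.2 ?_)
  simp only [energyGap, zero_mul, integral_zero, mul_zero, zero_sub, Left.neg_nonpos_iff]
  exact integral_nonneg fun x => by positivity

theorem energyGap_const_mul (c : ℝ) :
    energyGap (fun x => c * h x) (fun x => c * φ x) = c ^ 2 * energyGap h φ := by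
  unfold energyGap
  simp only [gradient_const_mul', norm_smul, mul_pow, Real.norm_eq_abs, sq_abs]
  have : ∀ x, c * h x * (c * φ x) = c ^ 2 * (h x * φ x) := fun x => by ring
  simp only [this, integral_const_mul]
  ring

/-- Multiplication by c ≠ 0 permutes the test functions; one inequality, used for c and for c⁻¹,
gives both. -/
theorem dualEnergy_const_mul (c : ℝ) :
    dualEnergy U (fun x => c * h x) = ENNReal.ofReal (c ^ 2) * dualEnergy U h := by
  rcases eq_or_ne c 0 with rfl | hc
  · simp [dualEnergy_zero]
  have key : ∀ (c : ℝ) (h : Space d → ℝ), c ≠ 0 →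
      ENNReal.ofReal (c ^ 2) * dualEnergy U h ≤ dualEnergy U (fun x => c * h x) := by
    intro c h hc
    unfold dualEnergy
    rw [ENNReal.mul_iSup]
    refine iSup_le fun φ => ?_
    rw [ENNReal.mul_iSup]
    refine iSup_le fun hφ => ?_
    rw [← ENNReal.ofReal_mul (by positivity), ← energyGap_const_mul]
    exact le_dualEnergy (hφ.const_mul c)
  refine le_antisymm ?_ (key c h hc)
  have h2 := key c⁻¹ (fun x => c * h x) (inv_ne_zero hc)
  have h3 : (fun x => c⁻¹ * (c * h x)) = h := by
    funext x; field_simp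
  rw [h3] at h2
  calc dualEnergy U (fun x => c * h x)
      = ENNReal.ofReal (c ^ 2) * (ENNReal.ofReal (c⁻¹ ^ 2) * dualEnergy U (fun x => c * h x)) := by
        rw [← mul_assoc, ← ENNReal.ofReal_mul (by positivity), ← mul_pow, mul_inv_cancel₀ hc]
        simp
    _ ≤ _ := by gcongr

/-- Weak subadditivity with respect to the right-hand side. -/
theorem dualEnergy_le_add {ε : ℝ} (hε : 0 < ε) (hε1 : ε < 1)
    (hh : MemLp h 2 (volume.restrict U)) (hw : MemLp w 2 (volume.restrict U)) :
    dualEnergy U h ≤ ENNReal.ofReal (1 - ε)⁻¹ * dualEnergy U w +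
      ENNReal.ofReal ε⁻¹ * dualEnergy U (fun x => h x - w x) := by
  have h1ε : 0 < 1 - ε := by linarith
  refine iSup₂_le fun φ hφ => ?_
  -- Write φ = (1 - ε)φ + εφ and test w with the first part, h - w with the second. The weights (1 -
  -- ε)⁻¹ and ε⁻¹ restore the linear terms exactly, and the coefficients of ∫ |∇φ|² add up to (1 -
  -- ε) + ε = 1.
  have e1 : energyGap h φ = (1 - ε)⁻¹ * energyGap w (fun x => (1 - ε) * φ x) +
      ε⁻¹ * energyGap (fun x => h x - w x) (fun x => ε * φ x) := by
    unfold energyGap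
    simp only [gradient_const_mul', norm_smul, mul_pow, Real.norm_eq_abs, sq_abs]
    have a1 : ∀ x, w x * ((1 - ε) * φ x) = (1 - ε) * (w x * φ x) := fun x => by ring
    have a2 : ∀ x, (h x - w x) * (ε * φ x) = ε * (h x * φ x - w x * φ x) := fun x => by ring
    simp only [a1, a2, integral_const_mul]
    rw [integral_sub (hφ.integrable_mul hh) (hφ.integrable_mul hw)]
    field_simp
    ring
  rw [e1]
  refine ENNReal.ofReal_add_le.trans ?_
  rw [ENNReal.ofReal_mul (by positivity), ENNReal.ofReal_mul (by positivity)]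
  gcongr
  · exact le_dualEnergy (hφ.const_mul _)
  · exact le_dualEnergy (hφ.const_mul _)

theorem energyGap_add_of_disjoint (hφ : IsTestFunction U φ) (hψ : IsTestFunction V ψ)
    (hUV : Disjoint U V) (hh : MemLp h 2 (volume.restrict (U ∪ V))) :
    energyGap h (fun x => φ x + ψ x) = energyGap h φ + energyGap h ψ := by
  unfold energyGap
  have hφi := hφ.integrable_mul (hh.mono_measure (Measure.restrict_mono_set _ subset_union_left))
  have hψi := hψ.integrable_mul (hh.mono_measure (Measure.restrict_mono_set _ subset_union_right))
  have e1 : ∀ x, h x * (φ x + ψ x) = h x * φ x + h x * ψ x := fun x => by ring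
  have e2 : ∀ x, ‖gradient (fun x => φ x + ψ x) x‖ ^ 2 =
      ‖gradient φ x‖ ^ 2 + ‖gradient ψ x‖ ^ 2 := by
    intro x
    rw [gradient_add' hφ.differentiable.differentiableAt hψ.differentiable.differentiableAt]
    by_cases hx : x ∈ U
    · rw [hψ.gradient_eq_zero (disjoint_left.1 hUV hx)]; simp
    · rw [hφ.gradient_eq_zero hx]; simp
  simp only [e1, e2]
  rw [integral_add hφi hψi, integral_add hφ.integrable_gradient_sq hψ.integrable_gradient_sq]
  ring

/-- Disjointness decouples the supremum: a competitor on the union is the sum of its two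
restrictions, and competitors on the pieces can be added without interaction. -/
theorem dualEnergy_union (hU : IsOpen U) (hV : IsOpen V) (hUV : Disjoint U V)
    (hh : MemLp h 2 (volume.restrict (U ∪ V))) :
    dualEnergy (U ∪ V) h = dualEnergy U h + dualEnergy V h := by
  apply le_antisymm
  · refine iSup₂_le fun φ hφ => ?_
    have h1 := hφ.indicator hU hV hUV
    have h2 := (union_comm U V ▸ hφ).indicator hV hU hUV.symm
    have e : φ = fun x => U.indicator φ x + V.indicator φ x := by
      funext x
      by_cases hx : x ∈ U
      · simp [hx, disjoint_left.1 hUV hx]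
      · by_cases hx' : x ∈ V
        · simp [hx, hx']
        · simp [hx, hx', hφ.eq_zero (show x ∉ U ∪ V by simp [hx, hx'])]
    rw [e, energyGap_add_of_disjoint h1 h2 hUV hh]
    exact ENNReal.ofReal_add_le.trans (add_le_add (le_dualEnergy h1) (le_dualEnergy h2))
  · unfold dualEnergy
    refine ENNReal.biSup_add_biSup_le' ⟨_, isTestFunction_zero⟩ ⟨_, isTestFunction_zero⟩ ?_
    intro φ hφ ψ hψ
    change _ ≤ dualEnergy (U ∪ V) h
    -- Truncation at 0 by `ENNReal.ofReal` is only subadditive, so a competitor with negative gap is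
    -- dropped instead of added.
    rcases le_total (energyGap h φ) 0 with h0 | h0
    · rw [ENNReal.ofReal_of_nonpos h0, zero_add]
      exact le_dualEnergy (hψ.mono subset_union_right)
    rcases le_total (energyGap h ψ) 0 with h0' | h0'
    · rw [ENNReal.ofReal_of_nonpos h0', add_zero]
      exact le_dualEnergy (hφ.mono subset_union_left)
    rw [← ENNReal.ofReal_add h0 h0', ← energyGap_add_of_disjoint hφ hψ hUV hh]
    exact le_dualEnergy ((hφ.mono subset_union_left).add (hψ.mono subset_union_right))

theorem dualEnergy_empty : dualEnergy (∅ : Set (Space d)) h = 0 := by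
  refine le_antisymm (iSup₂_le fun φ hφ => ?_) zero_le
  have : φ = fun _ => 0 := funext fun x => hφ.eq_zero (notMem_empty x)
  rw [this, energyGap_zero_right]; simp

theorem dualEnergy_biUnion {ι : Type*} (s : Finset ι) (A : ι → Set (Space d))
    (hA : ∀ i ∈ s, IsOpen (A i)) (hd : (s : Set ι).PairwiseDisjoint A)
    (hh : MemLp h 2 (volume.restrict (⋃ i ∈ s, A i))) :
    dualEnergy (⋃ i ∈ s, A i) h = ∑ i ∈ s, dualEnergy (A i) h := by
  classical
  induction s using Finset.induction_on with
  | empty => simp [dualEnergy_empty]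
  | insert a s ha ih =>
    rw [Finset.set_biUnion_insert] at hh ⊢
    have hop : IsOpen (⋃ i ∈ s, A i) :=
      isOpen_biUnion fun i hi => hA i (Finset.mem_insert_of_mem hi)
    rw [Finset.sum_insert ha, dualEnergy_union (hA a (Finset.mem_insert_self a s)) hop ?_ hh, ih]
    · exact fun i hi => hA i (Finset.mem_insert_of_mem hi)
    · exact hd.subset (by simp)
    · exact hh.mono_measure (Measure.restrict_mono_set _ subset_union_right)
    · refine disjoint_iUnion₂_right.2 fun i hi => ?_
      exact hd (by simp) (by simp [hi]) (fun h => ha (h ▸ hi))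

end DualEnergy

/-! ### Poincaré inequality through a bounded primitive of 1. -/

section Poincare
variable {d : ℕ} {U : Set (Space d)} {φ h : Space d → ℝ}

theorem fderiv_single_sq_le (x : Space d) (i : Fin d) :
    (fderiv ℝ φ x (EuclideanSpace.single i 1)) ^ 2 ≤ ‖gradient φ x‖ ^ 2 := by
  have h1 : fderiv ℝ φ x (EuclideanSpace.single i 1) =
      inner ℝ (gradient φ x) (EuclideanSpace.single i 1) := by
    rw [gradient, InnerProductSpace.toDual_symm_apply]
  have h2 := abs_real_inner_le_norm (gradient φ x) (EuclideanSpace.single i (1 : ℝ))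
  rw [h1]
  simp only [PiLp.norm_single, norm_one, mul_one] at h2
  exact sq_le_sq' (by linarith [neg_abs_le (inner ℝ (gradient φ x) (EuclideanSpace.single i (1:ℝ)))])
    ((le_abs_self _).trans h2)

/-- Poincaré inequality for functions supported where a bounded function `ψ` of one coordinate has
derivative `1`. -/
theorem integral_sq_le_of_hasDerivAt (hφ : IsTestFunction U φ) (i : Fin d) (ψ : ℝ → ℝ)
    {L : ℝ} (hL : ∀ x ∈ U, |ψ (x i)| ≤ L) (hψ : ∀ x ∈ U, HasDerivAt ψ 1 (x i)) :
    ∫ x, φ x ^ 2 ≤ 4 * L ^ 2 * ∫ x, ‖gradient φ x‖ ^ 2 := by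
  set e : Space d := EuclideanSpace.single i 1 with he
  have hproj : ∀ x : Space d, HasFDerivAt (fun y : Space d => y i)
      (EuclideanSpace.proj i : Space d →L[ℝ] ℝ) x :=
    fun x => (EuclideanSpace.proj i : Space d →L[ℝ] ℝ).hasFDerivAt
  have hψd : ∀ x ∈ U, HasFDerivAt (fun y : Space d => ψ (y i))
      (EuclideanSpace.proj i : Space d →L[ℝ] ℝ) x := fun x hx => by
    have := (hψ x hx).comp_hasFDerivAt x (hproj x)
    rw [one_smul] at this
    exact this
  have hgd : ∀ x ∈ tsupport φ, HasFDerivAt (fun y : Space d => ψ (y i) * φ y)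
      (ψ (x i) • fderiv ℝ φ x + φ x • (EuclideanSpace.proj i : Space d →L[ℝ] ℝ)) x :=
    fun x hx => (hψd x (hφ.2.2 hx)).mul hφ.differentiable.differentiableAt.hasFDerivAt
  have hcd : Continuous fun x => fderiv ℝ φ x e :=
    (hφ.1.continuous_fderiv (by simp)).clm_apply continuous_const
  have hsup0 : ∀ x, x ∉ tsupport φ → fderiv ℝ φ x e = 0 := fun x hx => by
    rw [fderiv_of_notMem_tsupport ℝ hx]; simp
  -- ψ is controlled only on U and may jump elsewhere; a factor vanishing off the support of φ makes
  -- the product continuous.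
  have hcont : ∀ w : Space d → ℝ, Continuous w → (∀ x, x ∉ tsupport φ → w x = 0) →
      Continuous fun x => ψ (x i) * w x := by
    intro w hw hw0
    refine continuous_iff_continuousAt.2 fun x => ?_
    by_cases hx : x ∈ tsupport φ
    · exact (hψd x (hφ.2.2 hx)).continuousAt.mul hw.continuousAt
    · have : (fun x => ψ (x i) * w x) =ᶠ[𝓝 x] fun _ => 0 := by
        filter_upwards [(isClosed_tsupport φ).isOpen_compl.mem_nhds hx] with y hy
        rw [hw0 y hy, mul_zero]
      exact continuousAt_const.congr this.symm
  have hint : ∀ w : Space d → ℝ, Continuous w → (∀ x, x ∉ tsupport φ → w x = 0) → Integrable w :=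
    fun w hw hw0 => hw.integrable_of_hasCompactSupport (HasCompactSupport.intro hφ.2.1 hw0)
  have hφ0 : ∀ x, x ∉ tsupport φ → φ x = 0 := fun x hx => image_eq_zero_of_notMem_tsupport hx
  have hi1 : Integrable fun x => fderiv ℝ φ x e * (ψ (x i) * φ x) :=
    hint _ (hcd.mul (hcont φ hφ.continuous hφ0)) fun x hx => by simp [hφ0 x hx]
  have hi2 : Integrable fun x => φ x * (φ x + ψ (x i) * fderiv ℝ φ x e) :=
    hint _ (hφ.continuous.mul (hφ.continuous.add (hcont _ hcd hsup0))) fun x hx => by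
      simp [hφ0 x hx]
  have hi3 : Integrable fun x => φ x * (ψ (x i) * φ x) :=
    hint _ (hφ.continuous.mul (hcont _ hφ.continuous hφ0)) fun x hx => by simp [hφ0 x hx]
  have hfe : ∀ x, φ x * fderiv ℝ (fun y : Space d => ψ (y i) * φ y) x e =
      φ x * (φ x + ψ (x i) * fderiv ℝ φ x e) := by
    intro x
    by_cases hx : x ∈ tsupport φ
    · rw [(hgd x hx).fderiv]
      simp [he]
      ring_nf
      simp
    · simp [hφ0 x hx]
  -- Integrating φ ∂ᵢ(ψφ) by parts, with ψ' = 1 on the support, gives ∫ φ² = -2 ∫ ψ φ ∂ᵢφ.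
  have ibp := integral_mul_fderiv_eq_neg_fderiv_mul_of_integrable (μ := volume) (f := φ)
    (g := fun y : Space d => ψ (y i) * φ y) (v := e) hi1 (by simpa only [hfe] using hi2) hi3
    (fun x _ => hφ.differentiable.differentiableAt) (fun x hx => (hgd x hx).differentiableAt)
  simp only [hfe] at ibp
  have hi4 : Integrable fun x => φ x ^ 2 := hφ.integrable_sq
  have hi5 := hφ.integrable_gradient_sq
  -- Young's inequality 2|ψ φ ∂ᵢφ| ≤ φ²/2 + 2ψ²|∂ᵢφ|². The first bracket integrates to zero by
  -- `ibp`; absorbing φ²/2 on the left yields the constant 4L².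
  have key : ∀ x, φ x ^ 2 ≤ (φ x * (φ x + ψ (x i) * fderiv ℝ φ x e) +
      fderiv ℝ φ x e * (ψ (x i) * φ x)) + (φ x ^ 2 / 2 + 2 * L ^ 2 * ‖gradient φ x‖ ^ 2) := by
    intro x
    by_cases hxU : x ∈ U
    swap
    · rw [hφ.eq_zero hxU]
      have : 0 ≤ 2 * L ^ 2 * ‖gradient φ x‖ ^ 2 := by positivity
      linarith
    have h1 := fderiv_single_sq_le (φ := φ) x i
    have h2 : ψ (x i) ^ 2 ≤ L ^ 2 := sq_le_sq' (by linarith [neg_abs_le (ψ (x i)), hL x hxU])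
      ((le_abs_self _).trans (hL x hxU))
    rw [← he] at h1
    have h3 : ψ (x i) ^ 2 * fderiv ℝ φ x e ^ 2 ≤ L ^ 2 * ‖gradient φ x‖ ^ 2 := by gcongr
    nlinarith [sq_nonneg (φ x + 2 * (ψ (x i) * fderiv ℝ φ x e))]
  have := integral_mono hi4 ((hi2.add hi1).add ((hi4.div_const 2).add (hi5.const_mul (2 * L ^ 2)))) key
  rw [integral_add' (hi2.add hi1) ((hi4.div_const 2).add (hi5.const_mul (2 * L ^ 2))),
    integral_add' hi2 hi1, integral_add' (hi4.div_const 2) (hi5.const_mul (2 * L ^ 2)), ibp,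
    integral_div, integral_const_mul] at this
  linarith

/-- Young's inequality 2hφ ≤ 4L²h² + φ²/(4L²), whose last term is absorbed by the Dirichlet integral
thanks to the Poincaré inequality. -/
theorem dualEnergy_le_of_hasDerivAt (i : Fin d) (ψ : ℝ → ℝ)
    {L : ℝ} (hL0 : 0 < L) (hL : ∀ x ∈ U, |ψ (x i)| ≤ L) (hψ : ∀ x ∈ U, HasDerivAt ψ 1 (x i))
    (hh : MemLp h 2 volume) :
    dualEnergy U h ≤ ENNReal.ofReal (4 * L ^ 2 * ∫ x, h x ^ 2) := by
  refine iSup₂_le fun φ hφ => ENNReal.ofReal_le_ofReal ?_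
  have h1 := integral_sq_le_of_hasDerivAt hφ i ψ hL hψ
  have h2 : Integrable fun x => h x * φ x :=
    hφ.integrable_mul (hh.mono_measure Measure.restrict_le_self)
  have h3 := integral_mono (h2.const_mul 2)
    ((hh.integrable_sq.const_mul (4 * L ^ 2)).add (hφ.integrable_sq.const_mul (4 * L ^ 2)⁻¹))
    (fun x => by
      change 2 * (h x * φ x) ≤ 4 * L ^ 2 * h x ^ 2 + (4 * L ^ 2)⁻¹ * φ x ^ 2
      have : 4 * L ^ 2 * h x ^ 2 + (4 * L ^ 2)⁻¹ * φ x ^ 2 - 2 * (h x * φ x) =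
        (2 * L * h x - (2 * L)⁻¹ * φ x) ^ 2 := by field_simp; ring
      nlinarith [sq_nonneg (2 * L * h x - (2 * L)⁻¹ * φ x)])
  rw [integral_add' (hh.integrable_sq.const_mul (4 * L ^ 2))
    (hφ.integrable_sq.const_mul (4 * L ^ 2)⁻¹), integral_const_mul, integral_const_mul,
    integral_const_mul] at h3
  have h4 : (4 * L ^ 2)⁻¹ * ∫ x, φ x ^ 2 ≤ ∫ x, ‖gradient φ x‖ ^ 2 := by
    rw [inv_mul_le_iff₀ (by positivity)]; exact h1
  unfold energyGap
  linarith

end Poincare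
-- Behaviour of the energy under homotheties.
section Scaling
variable {d : ℕ} {U : Set (Space d)} {φ : Space d → ℝ}

theorem integral_comp_homothety (F : Space d → ℝ) (x₀ : Space d) {l : ℝ} (hl : 0 < l) :
    ∫ y, F (l⁻¹ • (y - x₀)) = l ^ d * ∫ x, F x := by
  rw [integral_sub_right_eq_self (fun y => F (l⁻¹ • y)) x₀,
    Measure.integral_comp_inv_smul_of_nonneg _ F hl.le]
  simp

theorem gradient_comp_homothety (x₀ y : Space d) (l : ℝ)
    (hφ : DifferentiableAt ℝ φ (l⁻¹ • (y - x₀))) :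
    gradient (fun y => φ (l⁻¹ • (y - x₀))) y = l⁻¹ • gradient φ (l⁻¹ • (y - x₀)) := by
  have h1 : HasFDerivAt (fun y : Space d => l⁻¹ • (y - x₀))
      (l⁻¹ • ContinuousLinearMap.id ℝ (Space d)) y :=
    ((hasFDerivAt_id y).sub_const x₀).const_smul l⁻¹
  have h2 := (hφ.hasFDerivAt.comp y h1).fderiv
  simp only [gradient]
  change (InnerProductSpace.toDual ℝ (Space d)).symm (fderiv ℝ (φ ∘ fun y => l⁻¹ • (y - x₀)) y) = _
  rw [h2, ContinuousLinearMap.comp_smul, ContinuousLinearMap.comp_id, map_smul]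

theorem IsTestFunction.comp_homothety (hφ : IsTestFunction U φ) (x₀ : Space d) {l : ℝ}
    (hl : 0 < l) :
    IsTestFunction ((fun x => x₀ + l • x) '' U) (fun y => φ (l⁻¹ • (y - x₀))) := by
  have hK : IsCompact ((fun x : Space d => x₀ + l • x) '' tsupport φ) :=
    hφ.2.1.isCompact.image (by fun_prop)
  have h0 : ∀ y, y ∉ (fun x : Space d => x₀ + l • x) '' tsupport φ →
      φ (l⁻¹ • (y - x₀)) = 0 := by
    intro y hy
    refine image_eq_zero_of_notMem_tsupport fun h => hy ⟨_, h, ?_⟩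
    simp [smul_smul, hl.ne']
  refine ⟨hφ.1.comp (by fun_prop), HasCompactSupport.intro hK h0, ?_⟩
  refine (closure_minimal ?_ hK.isClosed).trans (image_mono hφ.2.2)
  intro y hy
  by_contra h
  exact hy (h0 y h)

/-- The rescaled competitor is l² φ((y - x₀)/l). Its amplitude gives l² in the linear term, its
gradient l in norm and so l² after squaring, and the change of variables l^d in both. -/
theorem dualEnergy_homothety_le (U : Set (Space d)) (x₀ : Space d) {l : ℝ} (hl : 0 < l) :
    ENNReal.ofReal (l ^ (d + 2)) * dualEnergy U (fun _ => 1) ≤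
      dualEnergy ((fun x => x₀ + l • x) '' U) (fun _ => 1) := by
  unfold dualEnergy
  rw [ENNReal.mul_iSup]
  refine iSup_le fun φ => ?_
  rw [ENNReal.mul_iSup]
  refine iSup_le fun hφ => ?_
  rw [← ENNReal.ofReal_mul (by positivity)]
  have h1 := (hφ.comp_homothety x₀ hl).const_mul (l ^ 2)
  have h2 : l ^ (d + 2) * energyGap (fun _ => 1) φ =
      energyGap (fun _ => 1) (fun y => l ^ 2 * φ (l⁻¹ • (y - x₀))) := by
    unfold energyGap
    have e : ∀ y, ‖gradient (fun y => l ^ 2 * φ (l⁻¹ • (y - x₀))) y‖ ^ 2 =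
        l ^ 2 * ‖gradient φ (l⁻¹ • (y - x₀))‖ ^ 2 := by
      intro y
      rw [gradient_const_mul', gradient_comp_homothety x₀ y l hφ.differentiable.differentiableAt,
        smul_smul, norm_smul, mul_pow, Real.norm_eq_abs, sq_abs]
      congr 1
      field_simp
    simp only [e, one_mul, integral_const_mul]
    rw [integral_comp_homothety φ x₀ hl, integral_comp_homothety (fun x => ‖gradient φ x‖ ^ 2) x₀ hl]
    ring
  rw [h2]
  exact le_dualEnergy h1

theorem dualEnergy_homothety (U : Set (Space d)) (x₀ : Space d) {l : ℝ} (hl : 0 < l) :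
    dualEnergy ((fun x => x₀ + l • x) '' U) (fun _ => 1) =
      ENNReal.ofReal (l ^ (d + 2)) * dualEnergy U (fun _ => 1) := by
  refine le_antisymm ?_ (dualEnergy_homothety_le U x₀ hl)
  have h1 := dualEnergy_homothety_le ((fun x => x₀ + l • x) '' U) (-(l⁻¹ • x₀)) (inv_pos.2 hl)
  have h2 : (fun x => -(l⁻¹ • x₀) + l⁻¹ • x) '' ((fun x => x₀ + l • x) '' U) = U := by
    rw [image_image]
    have : ∀ x : Space d, -(l⁻¹ • x₀) + l⁻¹ • (x₀ + l • x) = x := fun x => by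
      simp [smul_smul, hl.ne']
    simp only [this, image_id']
  rw [h2] at h1
  calc dualEnergy ((fun x => x₀ + l • x) '' U) (fun _ => 1)
      = ENNReal.ofReal (l ^ (d + 2)) * (ENNReal.ofReal (l⁻¹ ^ (d + 2)) *
          dualEnergy ((fun x => x₀ + l • x) '' U) (fun _ => 1)) := by
        rw [← mul_assoc, ← ENNReal.ofReal_mul (by positivity), ← mul_pow,
          mul_inv_cancel₀ hl.ne']
        simp
    _ ≤ _ := by gcongr

end Scaling

/-! ### Existence of the weak solution and the dual formula for the compliance. -/

section WeakSolution
variable {d : ℕ} {U : Set (Space d)}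

theorem integral_norm_sq_eq_toReal_eLpNorm {X E : Type*} [MeasurableSpace X]
    [NormedAddCommGroup E] {μ : Measure X} {F : X → E} (hF : AEStronglyMeasurable F μ) :
    ∫ x, ‖F x‖ ^ 2 ∂μ = (eLpNorm F 2 μ ^ 2).toReal := by
  have hm : AEStronglyMeasurable (fun x => ‖F x‖ ^ 2) μ := hF.norm.pow 2
  rw [integral_eq_lintegral_of_nonneg_ae (ae_of_all _ fun x => by positivity) hm]
  congr 1
  have := eLpNorm_nnreal_pow_eq_lintegral (f := F) (μ := μ) (p := 2) (by norm_num)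
  simp only [NNReal.coe_ofNat, ENNReal.coe_ofNat, ENNReal.rpow_ofNat] at this
  rw [this]
  refine lintegral_congr fun x => ?_
  rw [ENNReal.ofReal_pow (norm_nonneg _), ofReal_norm]

/-- Pairs of square integrable functions and vector fields. -/
abbrev PairSpace (d : ℕ) : Type :=
  WithLp 2 (Lp ℝ 2 (volume : Measure (Space d)) × Lp (Space d) 2 (volume : Measure (Space d)))

/-- The element of `PairSpace d` given by a function and a vector field. -/
def toPair {u : Space d → ℝ} {g : Space d → Space d} (hu : MemLp u 2 volume)
    (hg : MemLp g 2 volume) : PairSpace d :=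
  WithLp.toLp 2 (hu.toLp u, hg.toLp g)

theorem toLp_eq_zero_of_forall {X E : Type*} [MeasurableSpace X] [NormedAddCommGroup E]
    {μ : Measure X} {p : ℝ≥0∞} {F : X → E} (hF : MemLp F p μ) (h : ∀ x, F x = 0) :
    hF.toLp F = 0 := by
  obtain rfl : F = 0 := funext h
  exact MemLp.toLp_zero hF

/-- Test functions paired with their gradients. -/
def testPairs (U : Set (Space d)) : Submodule ℝ (PairSpace d) where
  carrier := {v | ∃ (φ : Space d → ℝ) (hφ : IsTestFunction U φ),
    v = toPair hφ.memLp hφ.memLp_gradient}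
  add_mem' := by
    rintro _ _ ⟨φ, hφ, rfl⟩ ⟨ψ, hψ, rfl⟩
    refine ⟨_, hφ.add hψ, ?_⟩
    unfold toPair
    rw [← WithLp.toLp_add, Prod.mk_add_mk, ← MemLp.toLp_add, ← MemLp.toLp_add]
    congr 2
    refine MemLp.toLp_congr _ _ (ae_of_all _ fun x => ?_)
    exact (gradient_add' hφ.differentiable.differentiableAt
      hψ.differentiable.differentiableAt).symm
  zero_mem' := by
    refine ⟨_, isTestFunction_zero, ?_⟩
    unfold toPair
    rw [toLp_eq_zero_of_forall _ fun _ => rfl, toLp_eq_zero_of_forall _ fun x => ?_]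
    · rfl
    · simp [gradient]
  smul_mem' := by
    rintro c _ ⟨φ, hφ, rfl⟩
    refine ⟨_, hφ.const_mul c, ?_⟩
    unfold toPair
    rw [← WithLp.toLp_smul, Prod.smul_mk, ← MemLp.toLp_const_smul, ← MemLp.toLp_const_smul]
    congr 2
    exact MemLp.toLp_congr _ _ (ae_of_all _ fun x => (gradient_const_mul' c).symm)

/-- The space `H₀¹(U)`. -/
abbrev H10 (U : Set (Space d)) : Submodule ℝ (PairSpace d) := (testPairs U).topologicalClosure

theorem tendsto_toPair_iff {φ : ℕ → Space d → ℝ} (hφ : ∀ k, IsTestFunction U (φ k))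
    {u : Space d → ℝ} {g : Space d → Space d} (hu : MemLp u 2 volume) (hg : MemLp g 2 volume) :
    Tendsto (fun k => toPair (hφ k).memLp (hφ k).memLp_gradient) atTop (𝓝 (toPair hu hg)) ↔
      Tendsto (fun k => eLpNorm (fun x => φ k x - u x) 2 volume) atTop (𝓝 0) ∧
      Tendsto (fun k => eLpNorm (fun x => gradient (φ k) x - g x) 2 volume) atTop (𝓝 0) := by
  have h1 := Lp.tendsto_Lp_iff_tendsto_eLpNorm'' (p := 2) φ (fun k => (hφ k).memLp) u hu
    (fi := atTop)
  have h2 := Lp.tendsto_Lp_iff_tendsto_eLpNorm'' (p := 2) (fun k => gradient (φ k))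
    (fun k => (hφ k).memLp_gradient) g hg (fi := atTop)
  change _ ↔ (Tendsto (fun k => eLpNorm (φ k - u) 2 volume) atTop (𝓝 0)) ∧
    Tendsto (fun k => eLpNorm (gradient (φ k) - g) 2 volume) atTop (𝓝 0)
  rw [← h1, ← h2]
  refine Iff.trans ?_ (Prod.tendsto_iff
    (fun k => ((hφ k).memLp.toLp (φ k), (hφ k).memLp_gradient.toLp (gradient (φ k))))
    (hu.toLp u, hg.toLp g))
  exact (WithLp.homeomorphProd 2 _ _).symm.isInducing.tendsto_nhds_iff.symm

theorem memH10_iff {u : Space d → ℝ} {g : Space d → Space d} :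
    MemH10 U u g ↔ ∃ (hu : MemLp u 2 volume) (hg : MemLp g 2 volume), toPair hu hg ∈ H10 U := by
  constructor
  · rintro ⟨hu, hg, φ, hφ, h1, h2⟩
    exact ⟨hu, hg, mem_closure_of_tendsto ((tendsto_toPair_iff hφ hu hg).2 ⟨h1, h2⟩)
      (Eventually.of_forall fun k => ⟨φ k, hφ k, rfl⟩)⟩
  · rintro ⟨hu, hg, h⟩
    obtain ⟨s, hs, hlim⟩ := mem_closure_iff_seq_limit.1 h
    choose φ hφ hsφ using hs
    have : s = fun k => toPair (hφ k).memLp (hφ k).memLp_gradient := funext hsφ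
    rw [this] at hlim
    exact ⟨hu, hg, φ, hφ, (tendsto_toPair_iff hφ hu hg).1 hlim⟩

theorem IsTestFunction.memH10 {φ : Space d → ℝ} (hφ : IsTestFunction U φ) :
    MemH10 U φ (gradient φ) :=
  ⟨hφ.memLp, hφ.memLp_gradient, fun _ => φ, fun _ => hφ, by simp, by simp⟩

theorem norm_toPair_fst_sq {u : Space d → ℝ} {g : Space d → Space d} (hu : MemLp u 2 volume)
    (hg : MemLp g 2 volume) : ‖(toPair hu hg).fst‖ ^ 2 = ∫ x, u x ^ 2 := by
  have := integral_norm_sq_eq_toReal_eLpNorm hu.1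
  simp only [Real.norm_eq_abs, sq_abs] at this
  rw [this, toPair, WithLp.toLp_fst, Lp.norm_toLp, ENNReal.toReal_pow]

theorem norm_toPair_snd_sq {u : Space d → ℝ} {g : Space d → Space d} (hu : MemLp u 2 volume)
    (hg : MemLp g 2 volume) : ‖(toPair hu hg).snd‖ ^ 2 = ∫ x, ‖g x‖ ^ 2 := by
  rw [integral_norm_sq_eq_toReal_eLpNorm hg.1, toPair, WithLp.toLp_snd, Lp.norm_toLp,
    ENNReal.toReal_pow]

/-- The Dirichlet form on `H₀¹(U)`. -/
def dirichletForm (U : Set (Space d)) : H10 U →L[ℝ] H10 U →L[ℝ] ℝ :=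
  (isBoundedBilinearMap_inner (𝕜 := ℝ)
    (E := Lp (Space d) 2 (volume : Measure (Space d)))).toContinuousLinearMap.bilinearComp
    ((WithLp.sndL 2 ℝ _ _).comp (H10 U).subtypeL) ((WithLp.sndL 2 ℝ _ _).comp (H10 U).subtypeL)

theorem dirichletForm_apply (v w : H10 U) :
    dirichletForm U v w = inner ℝ (v : PairSpace d).snd (w : PairSpace d).snd := rfl

/-- The form sees only the gradient component, so coercivity for the full norm is the Poincaré
inequality with ψ = `id`, L bounding the coordinates on U. It is a closed condition and passes from
test functions to `H10 U`. -/
theorem isCoercive_dirichletForm (hd : 0 < d) (hU : Bornology.IsBounded U) :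
    IsCoercive (dirichletForm U) := by
  obtain ⟨R, hR⟩ := hU.subset_ball 0
  obtain ⟨L, hL0, hL⟩ : ∃ L : ℝ, 0 < L ∧ ∀ x ∈ U, ∀ i, |x i| ≤ L := by
    refine ⟨max R 1, by positivity, fun x hx i => ?_⟩
    have h1 : ‖x‖ < R := by simpa using hR hx
    exact ((PiLp.norm_apply_le x i).trans h1.le).trans (le_max_left _ _)
  have key : ∀ v ∈ H10 U, ‖v.fst‖ ^ 2 ≤ 4 * L ^ 2 * ‖v.snd‖ ^ 2 := by
    intro v hv
    refine closure_minimal (s := (testPairs U : Set (PairSpace d)))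
      (t := {v : PairSpace d | ‖v.fst‖ ^ 2 ≤ 4 * L ^ 2 * ‖v.snd‖ ^ 2}) ?_ ?_ hv
    · rintro _ ⟨φ, hφ, rfl⟩
      change ‖(toPair _ _).fst‖ ^ 2 ≤ 4 * L ^ 2 * ‖(toPair _ _).snd‖ ^ 2
      rw [norm_toPair_fst_sq, norm_toPair_snd_sq]
      exact integral_sq_le_of_hasDerivAt hφ ⟨0, hd⟩ id (fun x hx => hL x hx _)
        (fun x _ => hasDerivAt_id _)
    · have h1 : Continuous fun v : PairSpace d => v.fst := (WithLp.fstL 2 ℝ _ _).continuous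
      have h2 : Continuous fun v : PairSpace d => v.snd := (WithLp.sndL 2 ℝ _ _).continuous
      exact isClosed_le (by fun_prop) (by fun_prop)
  refine ⟨(4 * L ^ 2 + 1)⁻¹, by positivity, fun v => ?_⟩
  rw [dirichletForm_apply, real_inner_self_eq_norm_sq, mul_assoc, inv_mul_le_iff₀ (by positivity),
    ← sq]
  have h1 := key v v.2
  have h2 : ‖v‖ ^ 2 = ‖(v : PairSpace d).fst‖ ^ 2 + ‖(v : PairSpace d).snd‖ ^ 2 :=
    WithLp.prod_norm_sq_eq_of_L2 (v : PairSpace d)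
  linarith

/-- Used to exchange integrals over Ω and over the whole space. -/
theorem ae_eq_zero_of_memH10 {u : Space d → ℝ} {g : Space d → Space d} (h : MemH10 U u g)
    (hU : MeasurableSet U) : ∀ᵐ x, x ∉ U → g x = 0 := by
  obtain ⟨hu, hg, φ, hφ, h1, h2⟩ := h
  have h3 : ∀ k, eLpNorm g 2 (volume.restrict Uᶜ) ≤
      eLpNorm (fun x => gradient (φ k) x - g x) 2 volume := by
    intro k
    refine le_trans (le_of_eq ?_) (eLpNorm_mono_measure _ (Measure.restrict_le_self (s := Uᶜ)))
    rw [← eLpNorm_neg g]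
    refine eLpNorm_congr_ae ?_
    filter_upwards [ae_restrict_mem hU.compl] with x hx
    simp [(hφ k).gradient_eq_zero hx]
  have h4 : eLpNorm g 2 (volume.restrict Uᶜ) = 0 :=
    le_antisymm (ge_of_tendsto' h2 h3) zero_le
  rw [eLpNorm_eq_zero_iff (hg.1.restrict) (by norm_num)] at h4
  exact (ae_restrict_iff' hU.compl).1 h4

/-- Lax–Milgram on `H10`: the load (f 1_Ω, 0) is projected orthogonally onto the closed subspace and
then sent through the inverse of the operator of the Dirichlet form. -/
theorem exists_isWeakSolution (hd : 0 < d) {Ω S : Set (Space d)} (hΩb : Bornology.IsBounded Ω)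
    (hΩ : MeasurableSet Ω) (hS : MeasurableSet S) {f : Space d → ℝ}
    (hf : MemLp f 2 (volume.restrict Ω)) :
    ∃ u g, IsWeakSolution S f Ω u g := by
  have hU : Bornology.IsBounded (Ω \ S) := hΩb.subset sdiff_subset
  have hco := isCoercive_dirichletForm hd hU
  have hF : MemLp (Ω.indicator f) 2 volume := (memLp_indicator_iff_restrict hΩ).2 hf
  set F : PairSpace d := WithLp.toLp 2 (hF.toLp _, 0) with hFdef
  set v : H10 (Ω \ S) := hco.continuousLinearEquivOfBilin.symm
    ((H10 (Ω \ S)).orthogonalProjectionOnto F) with hv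
  have hvw : ∀ w : H10 (Ω \ S), inner ℝ (v : PairSpace d).snd (w : PairSpace d).snd =
      inner ℝ (hF.toLp _) (w : PairSpace d).fst := by
    intro w
    rw [← dirichletForm_apply, ← hco.continuousLinearEquivOfBilin_apply v w, hv,
      ContinuousLinearEquiv.apply_symm_apply, Submodule.inner_orthogonalProjectionOnto_eq_of_mem_right,
      WithLp.prod_inner_apply]
    simp [hFdef]
  have hmu := Lp.memLp (v : PairSpace d).fst
  have hmg := Lp.memLp (v : PairSpace d).snd
  have hv' : toPair hmu hmg = (v : PairSpace d) := by
    unfold toPair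
    rw [Lp.toLp_coeFn, Lp.toLp_coeFn]
    rfl
  refine ⟨(v : PairSpace d).fst, (v : PairSpace d).snd,
    memH10_iff.2 ⟨hmu, hmg, by rw [hv']; exact v.2⟩, ?_⟩
  intro φ ψ h
  obtain ⟨hφ, hψ, hw⟩ := memH10_iff.1 h
  have := hvw ⟨_, hw⟩
  rw [L2.inner_def, L2.inner_def] at this
  simp only [toPair] at this
  have e1 : ∫ x, inner ℝ ((v : PairSpace d).snd x) ((hψ.toLp ψ) x) =
      ∫ x in Ω, inner ℝ ((v : PairSpace d).snd x) (ψ x) := by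
    rw [← integral_indicator hΩ]
    refine integral_congr_ae ?_
    filter_upwards [hψ.coeFn_toLp, ae_eq_zero_of_memH10 h (hΩ.diff hS)] with x h1 h2
    rw [h1]
    by_cases hx : x ∈ Ω
    · rw [indicator_of_mem hx]
    · rw [indicator_of_notMem hx, h2 (fun h => hx h.1), inner_zero_right]
  have e2 : ∫ x, inner ℝ ((hF.toLp _) x) ((hφ.toLp φ) x) = ∫ x in Ω, f x * φ x := by
    rw [← integral_indicator hΩ]
    refine integral_congr_ae ?_
    filter_upwards [hφ.coeFn_toLp, hF.coeFn_toLp] with x h1 h2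
    rw [h1, h2]
    by_cases hx : x ∈ Ω
    · simp [hx, mul_comm]
    · simp [hx]
  rw [← e1, ← e2]
  exact this

/-- The compliance is the supremum of `2 ∫ f φ - ∫ |∇φ|²` over test functions. -/
theorem ofReal_compliance (hd : 0 < d) {Ω S : Set (Space d)} (hΩb : Bornology.IsBounded Ω)
    (hΩ : MeasurableSet Ω) (hS : MeasurableSet S) {f : Space d → ℝ}
    (hf : MemLp f 2 (volume.restrict Ω)) :
    ENNReal.ofReal (compliance S f Ω) = dualEnergy (Ω \ S) f := by
  obtain ⟨u, g, hug⟩ := exists_isWeakSolution hd hΩb hΩ hS hf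
  have hgm := hug.1.2.1
  have hg0 := ae_eq_zero_of_memH10 hug.1 (hΩ.diff hS)
  have hint : ∀ {ψ : Space d → Space d}, MemLp ψ 2 volume →
      Integrable fun x => inner ℝ (g x) (ψ x) := fun {ψ} hψ => by
    refine (L2.integrable_inner (𝕜 := ℝ) (hgm.toLp g) (hψ.toLp ψ)).congr ?_
    filter_upwards [hgm.coeFn_toLp, hψ.coeFn_toLp] with x h1 h2
    rw [h1, h2]
  have hset : ∀ ψ : Space d → Space d, ∫ x in Ω, inner ℝ (g x) (ψ x) =
      ∫ x, inner ℝ (g x) (ψ x) := by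
    intro ψ
    rw [← integral_indicator hΩ]
    refine integral_congr_ae ?_
    filter_upwards [hg0] with x hx
    by_cases hxΩ : x ∈ Ω
    · rw [indicator_of_mem hxΩ]
    · rw [indicator_of_notMem hxΩ, hx (fun h => hxΩ h.1), inner_zero_left]
  -- The weak equation replaces ∫ f φ by ∫ g · ∇φ, and completing the square leaves a distance to g.
  -- The supremum is thus ∫ |g|², approached along the test functions that converge to u.
  have hgap : ∀ φ : Space d → ℝ, IsTestFunction (Ω \ S) φ →
      energyGap f φ = (∫ x, ‖g x‖ ^ 2) - ∫ x, ‖gradient φ x - g x‖ ^ 2 := by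
    intro φ hφ
    have h1 := hug.2 _ _ hφ.memH10
    have h2 : ∫ x, f x * φ x = ∫ x in Ω, f x * φ x := by
      rw [← integral_indicator hΩ]
      congr 1; funext x
      by_cases hxΩ : x ∈ Ω
      · rw [indicator_of_mem hxΩ]
      · rw [indicator_of_notMem hxΩ, hφ.eq_zero (fun h => hxΩ h.1), mul_zero]
    have i1 := hφ.integrable_gradient_sq
    have i2 := hint hφ.memLp_gradient
    have i3 : Integrable fun x => ‖g x‖ ^ 2 := hgm.integrable_norm_pow (by simp)
    have h3 : ∫ x, ‖gradient φ x - g x‖ ^ 2 =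
        (∫ x, ‖gradient φ x‖ ^ 2) - 2 * (∫ x, inner ℝ (g x) (gradient φ x)) + ∫ x, ‖g x‖ ^ 2 := by
      rw [← integral_const_mul, ← integral_sub i1 (i2.const_mul 2),
        ← integral_add (f := fun x => _ - _) (i1.sub (i2.const_mul 2)) i3]
      congr 1; funext x
      rw [norm_sub_sq_real, real_inner_comm]
    unfold energyGap
    rw [h2, ← h1, hset, h3]
    ring
  rw [compliance_eq hug, ← hug.2 _ _ hug.1, hset]
  simp only [real_inner_self_eq_norm_sq]
  apply le_antisymm
  · obtain ⟨-, -, φ, hφ, -, h2⟩ := hug.1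
    have h3 : Tendsto (fun k => ∫ x, ‖gradient (φ k) x - g x‖ ^ 2) atTop (𝓝 0) := by
      have : ∀ k, ∫ x, ‖gradient (φ k) x - g x‖ ^ 2 =
          (eLpNorm (fun x => gradient (φ k) x - g x) 2 volume ^ 2).toReal := fun k =>
        integral_norm_sq_eq_toReal_eLpNorm ((hφ k).memLp_gradient.1.sub hgm.1)
      refine Tendsto.congr (fun k => (this k).symm) ?_
      have h4 := (ENNReal.Tendsto.pow (n := 2) h2)
      have h5 := (ENNReal.tendsto_toReal (by simp)).comp h4
      simpa [Function.comp_def] using h5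
    have h4 : Tendsto (fun k => ENNReal.ofReal (energyGap f (φ k))) atTop
        (𝓝 (ENNReal.ofReal (∫ x, ‖g x‖ ^ 2))) := by
      refine ENNReal.tendsto_ofReal ?_
      simp only [hgap _ (hφ _)]
      simpa using h3.const_sub (∫ x, ‖g x‖ ^ 2)
    exact le_of_tendsto' h4 fun k => le_dualEnergy (hφ k)
  · refine iSup₂_le fun φ hφ => ENNReal.ofReal_le_ofReal ?_
    rw [hgap φ hφ]
    have : 0 ≤ ∫ x, ‖gradient φ x - g x‖ ^ 2 := integral_nonneg fun x => by positivity
    linarith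

end WeakSolution

/-! ### Covering walls by few balls, and the Poincaré bound they produce. -/

section Covering
variable {d : ℕ}

/-- The union of the closed balls of radius `r` centred in `T`. -/
def closedBalls (T : Set (Space d)) (r : ℝ) : Set (Space d) := ⋃ y ∈ T, Metric.closedBall y r

theorem mem_closedBalls {T : Set (Space d)} {r : ℝ} {x : Space d} :
    x ∈ closedBalls T r ↔ ∃ y ∈ T, dist x y ≤ r := by
  simp [closedBalls]

theorem closedBalls_mono {T T' : Set (Space d)} {r r' : ℝ} (hT : T ⊆ T') (hr : r ≤ r') :
    closedBalls T r ⊆ closedBalls T' r' := fun x hx => by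
  obtain ⟨y, hy, h⟩ := mem_closedBalls.1 hx
  exact mem_closedBalls.2 ⟨y, hT hy, h.trans hr⟩

theorem isClosed_closedBalls (T : Finset (Space d)) (r : ℝ) :
    IsClosed (closedBalls (T : Set (Space d)) r) :=
  T.finite_toSet.isClosed_biUnion fun _ _ => Metric.isClosed_closedBall

theorem dist_le_of_forall_abs_sub_le {x y : Space d} {r : ℝ} (hr : 0 ≤ r)
    (h : ∀ j, |x j - y j| ≤ r / d) : dist x y ≤ r := by
  rw [EuclideanSpace.dist_eq]
  refine Real.sqrt_le_iff.2 ⟨hr, ?_⟩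
  calc ∑ j, dist (x j) (y j) ^ 2 ≤ ∑ _j : Fin d, (r / d) ^ 2 := by
        gcongr with j _; exact h j
    _ = d * (r / d) ^ 2 := by simp
    _ ≤ r ^ 2 := by
        rcases Nat.eq_zero_or_pos d with rfl | hd
        · simp; positivity
        · have h1 : (1 : ℝ) ≤ d := by exact_mod_cast hd
          have : (d : ℝ) * (r / d) ^ 2 = r ^ 2 / d := by field_simp
          rw [this]
          exact div_le_self (by positivity) h1

theorem natCard_floor_Icc_le {a δ s : ℝ} (hδ : 0 ≤ δ) (hs : 0 < s) :
    ((Finset.Icc ⌊a / s⌋ ⌊(a + δ) / s⌋).card : ℝ) ≤ δ / s + 2 := by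
  rw [Int.card_Icc]
  have h1 : ⌊a / s⌋ ≤ ⌊(a + δ) / s⌋ := Int.floor_le_floor (by gcongr; linarith)
  have h2 : ((⌊(a + δ) / s⌋ + 1 - ⌊a / s⌋).toNat : ℝ) =
      ((⌊(a + δ) / s⌋ + 1 - ⌊a / s⌋ : ℤ) : ℝ) := by
    rw [← Int.cast_natCast, Int.toNat_of_nonneg (by omega)]
  rw [h2]
  push_cast
  have h3 := Int.floor_le ((a + δ) / s)
  have h4 := Int.lt_floor_add_one (a / s)
  have h5 : (a + δ) / s = a / s + δ / s := by ring
  linarith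

/-- Covering the part of `E` lying on equidistant parallel hyperplanes by few balls. -/
theorem exists_finset_cover_hyperplanes (i : Fin d) (a : Space d) {δ l r : ℝ} (hδ : 0 ≤ δ)
    (hl : 0 < l) (hr : 0 < r) {E : Set (Space d)} (hE : ∀ x ∈ E, ∀ j, x j ∈ Icc (a j) (a j + δ)) :
    ∃ T : Finset (Space d), (T : Set (Space d)) ⊆ E ∧
      (T.card : ℝ) ≤ (δ / l + 2) * (δ * d / r + 2) ^ (d - 1) ∧
      ∀ x ∈ E, (∃ k : ℤ, x i = k * l) → x ∈ closedBalls (T : Set (Space d)) r := by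
  classical
  have hd : 0 < d := i.pos
  -- Mesh l in direction i, so that the index identifies the hyperplane, and r/d in the others, so
  -- that two points on one hyperplane with equal indices are at distance at most r. One
  -- representative in E is kept for each occupied index.
  set s : Fin d → ℝ := fun j => if j = i then l else r / d with hs
  have hs0 : ∀ j, 0 < s j := fun j => by
    simp only [hs]; split_ifs
    · exact hl
    · positivity
  set κ : Space d → Fin d → ℤ := fun x j => ⌊x j / s j⌋ with hκ
  set J : Finset (Fin d → ℤ) :=
    Fintype.piFinset fun j => Finset.Icc ⌊a j / s j⌋ ⌊(a j + δ) / s j⌋ with hJ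
  have hκJ : ∀ x ∈ E, κ x ∈ J := by
    intro x hx
    rw [hJ, Fintype.mem_piFinset]
    intro j
    have h := hE x hx j
    have := (hs0 j).le
    rw [Finset.mem_Icc]
    exact ⟨Int.floor_le_floor (by gcongr; exact h.1), Int.floor_le_floor (by gcongr; exact h.2)⟩
  set P : (Fin d → ℤ) → Prop := fun k => ∃ x ∈ E, (∃ m : ℤ, x i = m * l) ∧ κ x = k with hP
  set c : (Fin d → ℤ) → Space d := fun k => if h : P k then h.choose else 0 with hc
  have hcP : ∀ k, P k → c k ∈ E ∧ (∃ m : ℤ, c k i = m * l) ∧ κ (c k) = k := by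
    intro k hk
    simp only [hc, dif_pos hk]
    exact hk.choose_spec
  refine ⟨(J.filter P).image c, ?_, ?_, ?_⟩
  · intro x hx
    obtain ⟨k, hk, rfl⟩ := Finset.mem_image.1 (Finset.mem_coe.1 hx)
    exact (hcP k (Finset.mem_filter.1 hk).2).1
  · have h1 : ((((J.filter P).image c).card : ℕ) : ℝ) ≤ (J.card : ℝ) := by
      exact_mod_cast Finset.card_image_le.trans (Finset.card_filter_le _ _)
    refine h1.trans ?_
    rw [hJ, Fintype.card_piFinset, Nat.cast_prod]
    calc ∏ j, ((Finset.Icc ⌊a j / s j⌋ ⌊(a j + δ) / s j⌋).card : ℝ)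
        ≤ ∏ j, (δ / s j + 2) :=
          Finset.prod_le_prod (fun j _ => by positivity)
            fun j _ => natCard_floor_Icc_le hδ (hs0 j)
      _ = (δ / l + 2) * (δ * d / r + 2) ^ (d - 1) := by
          rw [← Finset.mul_prod_erase Finset.univ _ (Finset.mem_univ i)]
          congr 1
          · simp [hs]
          · rw [Finset.prod_congr rfl (g := fun _ => δ * d / r + 2)]
            · simp
            · intro j hj
              have : j ≠ i := Finset.ne_of_mem_erase hj
              simp only [hs, if_neg this]
              field_simp
  · intro x hx hxl
    have hPx : P (κ x) := ⟨x, hx, hxl, rfl⟩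
    obtain ⟨-, ⟨m, hm⟩, hκx⟩ := hcP _ hPx
    refine mem_closedBalls.2 ⟨c (κ x), ?_, dist_le_of_forall_abs_sub_le hr.le fun j => ?_⟩
    · exact Finset.mem_coe.2 (Finset.mem_image_of_mem _ (Finset.mem_filter.2 ⟨hκJ x hx, hPx⟩))
    · have hj := congrFun hκx j
      by_cases hji : j = i
      · subst hji
        obtain ⟨k, hk⟩ := hxl
        have hsj : s j = l := by simp [hs]
        change c (κ x) j = m * l at hm
        change ⌊c (κ x) j / s j⌋ = ⌊x j / s j⌋ at hj
        rw [hsj, hm, hk, mul_div_assoc, mul_div_assoc, div_self hl.ne', mul_one, mul_one,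
          Int.floor_intCast, Int.floor_intCast] at hj
        rw [hk, hm, hj, sub_self]
        simp only [abs_zero]; positivity
      · change ⌊c (κ x) j / s j⌋ = ⌊x j / s j⌋ at hj
        have h1 := Int.abs_sub_lt_one_of_floor_eq_floor hj.symm
        rw [← sub_div, abs_div, abs_of_pos (hs0 j), div_lt_one (hs0 j)] at h1
        simp only [hs, if_neg hji] at h1
        exact h1.le

theorem radius_eq_div (α : ℝ) (n : ℕ) : radius d α n = α / (n : ℝ) ^ ((1 : ℝ) / d) := by
  rw [radius, neg_div, Real.rpow_neg (by positivity), ← div_eq_mul_inv]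

theorem rpow_one_div_pow (hd : 0 < d) (n : ℕ) : ((n : ℝ) ^ ((1 : ℝ) / d)) ^ d = n := by
  rw [one_div, Real.rpow_inv_natCast_pow (by positivity) hd.ne']

theorem rpow_one_div_sq (n : ℕ) : ((n : ℝ) ^ ((1 : ℝ) / d)) ^ 2 = (n : ℝ) ^ ((2 : ℝ) / d) := by
  rw [← Real.rpow_natCast, ← Real.rpow_mul (by positivity)]
  congr 1; push_cast; ring

theorem tendsto_rpow_one_div (hd : 0 < d) :
    Tendsto (fun n : ℕ => (n : ℝ) ^ ((1 : ℝ) / d)) atTop atTop :=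
  (tendsto_rpow_atTop (by positivity)).comp tendsto_natCast_atTop_atTop

theorem tendsto_radius (hd : 0 < d) (α : ℝ) :
    Tendsto (fun n : ℕ => radius d α n) atTop (𝓝 0) := by
  simp only [radius_eq_div]
  exact (tendsto_rpow_one_div hd).const_div_atTop α

theorem radius_pos {α : ℝ} (hα : 0 < α) {n : ℕ} (hn : 0 < n) : 0 < radius d α n := by
  rw [radius_eq_div]; positivity

/-- Parallel walls at distance `K n^{-1/d}` are covered by `ε δ^d n` balls of radius
`α n^{-1/d}`, where `K` does not depend on the size `δ`. -/
theorem exists_walls (i : Fin d) {α ε : ℝ} (hα : 0 < α) (hε : 0 < ε) :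
    ∃ K : ℝ, 0 < K ∧ ∀ δ : ℝ, 0 < δ → ∀ᶠ n : ℕ in atTop, ∀ (a : Space d) (E : Set (Space d)),
      (∀ x ∈ E, ∀ j, x j ∈ Icc (a j) (a j + δ)) →
      ∃ T : Finset (Space d), (T : Set (Space d)) ⊆ E ∧ (T.card : ℝ) ≤ ε * δ ^ d * n ∧
        ∀ x ∈ E, (∃ k : ℤ, x i = k * radius d K n) →
          x ∈ closedBalls (T : Set (Space d)) (radius d α n) := by
  have hd : 0 < d := i.pos
  have hd' : (0 : ℝ) < d := by exact_mod_cast hd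
  -- With l = K n^(-1/d) and r = α n^(-1/d), the count (δ/l)(δd/r)^(d-1) equals (d/α)^(d-1) δ^d n /
  -- K. The factor 2^d absorbs the additive 2 in each direction for large n, and K is chosen to
  -- leave ε δ^d n.
  refine ⟨2 ^ d * (d / α) ^ (d - 1) / ε, by positivity, fun δ hδ => ?_⟩
  set K : ℝ := 2 ^ d * (d / α) ^ (d - 1) / ε with hK
  have hK0 : 0 < K := by positivity
  have ht := tendsto_rpow_one_div hd
  filter_upwards [ht.eventually_ge_atTop (2 * K / δ), ht.eventually_ge_atTop (2 * α / (δ * d)),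
    eventually_gt_atTop 0] with n h1 h2 hn a E hE
  set ν : ℝ := (n : ℝ) ^ ((1 : ℝ) / d) with hν
  have hν0 : 0 < ν := by positivity
  obtain ⟨T, hTE, hcard, hcov⟩ := exists_finset_cover_hyperplanes i a hδ.le
    (radius_pos (d := d) hK0 hn) (radius_pos (d := d) hα hn) hE
  refine ⟨T, hTE, hcard.trans ?_, hcov⟩
  rw [radius_eq_div, radius_eq_div, ← hν]
  have e1 : δ / (K / ν) + 2 ≤ 2 * (δ * ν / K) := by
    have : 2 ≤ δ * ν / K := by
      rw [le_div_iff₀ hK0]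
      rw [div_le_iff₀ hδ] at h1
      linarith
    have : δ / (K / ν) = δ * ν / K := by field_simp
    linarith
  have e2 : δ * d / (α / ν) + 2 ≤ 2 * (δ * ν * (d / α)) := by
    have : 2 ≤ δ * ν * (d / α) := by
      rw [div_le_iff₀ (by positivity)] at h2
      rw [mul_div_assoc', le_div_iff₀ hα]
      linarith
    have : δ * d / (α / ν) = δ * ν * (d / α) := by field_simp
    linarith
  calc (δ / (K / ν) + 2) * (δ * d / (α / ν) + 2) ^ (d - 1)
      ≤ (2 * (δ * ν / K)) * (2 * (δ * ν * (d / α))) ^ (d - 1) := by gcongr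
    _ = (2 * 2 ^ (d - 1)) * ((δ * ν) * (δ * ν) ^ (d - 1)) * (d / α) ^ (d - 1) / K := by
        rw [mul_pow, mul_pow (δ * ν)]; ring
    _ = 2 ^ d * (δ * ν) ^ d * (d / α) ^ (d - 1) / K := by
        rw [mul_pow_sub_one hd.ne', mul_pow_sub_one hd.ne']
    _ = ε * δ ^ d * n := by
        rw [mul_pow, hν, rpow_one_div_pow hd, hK]
        field_simp

/-- The sawtooth of period l is a primitive of 1 bounded by l. Its jumps sit on the walls, where
test functions vanish. -/
theorem hasDerivAt_mul_fract {l t : ℝ} (hl : 0 < l) (ht : ∀ k : ℤ, t ≠ k * l) :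
    HasDerivAt (fun t => l * Int.fract (t / l)) 1 t := by
  have h1 : t / l ∈ Ioo (⌊t / l⌋ : ℝ) (⌊t / l⌋ + 1) := by
    refine ⟨lt_of_le_of_ne (Int.floor_le _) fun h => ht ⌊t / l⌋ ?_, Int.lt_floor_add_one _⟩
    rw [h]; field_simp
  have h2 : (fun t => l * Int.fract (t / l)) =ᶠ[𝓝 t] fun s => s - l * ⌊t / l⌋ := by
    have : ∀ᶠ s in 𝓝 t, s / l ∈ Ioo (⌊t / l⌋ : ℝ) (⌊t / l⌋ + 1) :=
      (continuous_id.div_const l).continuousAt.eventually (isOpen_Ioo.mem_nhds h1)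
    filter_upwards [this] with s hs
    have : ⌊s / l⌋ = ⌊t / l⌋ := Int.floor_eq_iff.2 ⟨hs.1.le, hs.2⟩
    rw [Int.fract, this]
    field_simp
  exact ((hasDerivAt_id t).sub_const _).congr_of_eventuallyEq h2

/-- Poincaré bound in an open set crossed by walls at distance `l`. -/
theorem dualEnergy_le_of_walls (i : Fin d) {U : Set (Space d)} {l : ℝ} (hl : 0 < l)
    (hU : ∀ x ∈ U, ∀ k : ℤ, x i ≠ k * l) {h : Space d → ℝ} (hh : MemLp h 2 volume) :
    dualEnergy U h ≤ ENNReal.ofReal (4 * l ^ 2 * ∫ x, h x ^ 2) := by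
  refine dualEnergy_le_of_hasDerivAt i (fun t => l * Int.fract (t / l)) hl (fun x _ => ?_)
    (fun x hx => hasDerivAt_mul_fract hl (hU x hx)) hh
  rw [abs_of_nonneg (mul_nonneg hl.le (Int.fract_nonneg _))]
  exact mul_le_of_le_one_right hl.le (Int.fract_lt_one _).le

end Covering

/-! ### The cell constant in terms of finite sets of centres. -/

section Theta
variable {d : ℕ}

/-- Centres may coincide, so a set of at most n points is enumerated by n indices with a repeated
filler. This lets configurations be handled as finite sets of bounded cardinality. -/
theorem exists_fin_of_finset {X : Type*} {T : Finset X} {A : Set X} (hTA : (T : Set X) ⊆ A)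
    (hA : A.Nonempty) {n : ℕ} (hT : T.card ≤ n) :
    ∃ y : Fin n → X, (∀ i, y i ∈ A) ∧ (T : Set X) ⊆ range y := by
  classical
  obtain ⟨a, ha⟩ := hA
  refine ⟨fun i => if h : (i : ℕ) < T.card then (T.equivFin.symm ⟨i, h⟩ : X) else a,
    fun i => ?_, fun x hx => ?_⟩
  · dsimp only
    split_ifs with h
    · exact hTA (T.equivFin.symm ⟨i, h⟩).2
    · exact ha
  · refine ⟨⟨T.equivFin ⟨x, hx⟩, (T.equivFin ⟨x, hx⟩).2.trans_le hT⟩, ?_⟩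
    simp

theorem isOpen_unitCube : IsOpen (unitCube d) := by
  have : unitCube d = ⋂ i, (fun x : Space d => x i) ⁻¹' Ioo 0 1 := by
    ext x; simp [unitCube]
  rw [this]
  exact isOpen_iInter_of_finite fun i => isOpen_Ioo.preimage (by fun_prop)

theorem isBounded_unitCube : Bornology.IsBounded (unitCube d) := by
  refine (Metric.isBounded_closedBall (x := (0 : Space d)) (r := d)).subset fun x hx => ?_
  rw [Metric.mem_closedBall]
  refine dist_le_of_forall_abs_sub_le (by positivity) fun j => ?_
  have := hx j
  have hd : (d : ℝ) ≠ 0 := by exact_mod_cast j.pos.ne'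
  rw [div_self hd, abs_le]
  simp only [PiLp.zero_apply, sub_zero]
  exact ⟨by linarith [this.1], this.2.le⟩

theorem unitCube_nonempty : (unitCube d).Nonempty :=
  ⟨WithLp.toLp 2 fun _ => 1 / 2, fun i => by norm_num⟩

theorem volume_unitCube : volume (unitCube d) = 1 := by
  have h := (EuclideanSpace.volume_preserving_symm_measurableEquiv_toLp (Fin d))
  have h1 : unitCube d = (MeasurableEquiv.toLp 2 (Fin d → ℝ)).symm ⁻¹'
      (Set.pi univ fun _ => Ioo (0 : ℝ) 1) := by
    ext x; simp [unitCube]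
  rw [h1, h.measure_preimage_equiv]
  simp [Real.volume_pi_Ioo]

theorem diff_ballUnion (α : ℝ) {n : ℕ} (Ω : Set (Space d)) (x : Fin n → Space d) :
    Ω \ ballUnion α Ω x = Ω \ closedBalls (range x) (radius d α n) := by
  ext y
  simp only [ballUnion, Set.mem_sdiff, mem_inter_iff, closedBalls, biUnion_range]
  constructor
  · rintro ⟨h1, h2⟩
    exact ⟨h1, fun h => h2 ⟨subset_closure h1, h⟩⟩
  · rintro ⟨h1, h2⟩
    exact ⟨h1, fun h => h2 h.2⟩

theorem isClosed_ballUnion (α : ℝ) {n : ℕ} (Ω : Set (Space d)) (x : Fin n → Space d) :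
    IsClosed (ballUnion α Ω x) :=
  isClosed_closure.inter (isClosed_iUnion_of_finite fun _ => Metric.isClosed_closedBall)

theorem scaledCompliance_eq (hd : 0 < d) {Ω : Set (Space d)} (hΩb : Bornology.IsBounded Ω)
    (hΩ : IsOpen Ω) {f : Space d → ℝ} (hf : MemLp f 2 (volume.restrict Ω)) (α : ℝ) {n : ℕ}
    (x : Fin n → Space d) :
    scaledCompliance n (ballUnion α Ω x) f Ω = ENNReal.ofReal ((n : ℝ) ^ ((2 : ℝ) / d)) *
      dualEnergy (Ω \ closedBalls (range x) (radius d α n)) f := by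
  rw [scaledCompliance, ENNReal.ofReal_mul (by positivity),
    ofReal_compliance hd hΩb hΩ.measurableSet (isClosed_ballUnion α Ω x).measurableSet hf,
    diff_ballUnion]

theorem memLp_one_unitCube : MemLp (fun _ : Space d => (1 : ℝ)) 2 (volume.restrict (unitCube d)) := by
  have : IsFiniteMeasure (volume.restrict (unitCube d)) :=
    ⟨by rw [Measure.restrict_apply_univ, volume_unitCube]; exact ENNReal.one_lt_top⟩
  exact memLp_const 1

/-- The rescaled compliance of the unit cube with closed balls of radius `β n^{-1/d}`. -/
def cellEnergy (d : ℕ) (β : ℝ) (n : ℕ) (T : Set (Space d)) : ℝ≥0∞ :=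
  ENNReal.ofReal ((n : ℝ) ^ ((2 : ℝ) / d)) *
    dualEnergy (unitCube d \ closedBalls T (radius d β n)) (fun _ => 1)

theorem cellEnergy_anti {β γ : ℝ} {n : ℕ} {T T' : Set (Space d)}
    (h : unitCube d ∩ closedBalls T (radius d β n) ⊆ closedBalls T' (radius d γ n)) :
    cellEnergy d γ n T' ≤ cellEnergy d β n T := by
  unfold cellEnergy
  gcongr
  refine dualEnergy_mono fun x hx => ⟨hx.1, fun h' => hx.2 (h ⟨hx.1, h'⟩)⟩

theorem radius_mono {β γ : ℝ} (h : β ≤ γ) (n : ℕ) : radius d β n ≤ radius d γ n := by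
  unfold radius; gcongr

/-- The balls are closed but the thickening is open. At distance exactly r, moving x slightly
towards y stays in the open set Ω and makes the distance strict. -/
theorem mem_thickening_of_closedBall_inter {Ω : Set (Space d)} (hΩ : IsOpen Ω) {x y : Space d}
    {r : ℝ} (hr : 0 < r) (hx : x ∈ Ω) (hxy : dist x y ≤ r) : y ∈ Metric.thickening r Ω := by
  rcases hxy.lt_or_eq with h | h
  · exact Metric.mem_thickening_iff.2 ⟨x, hx, by rwa [dist_comm]⟩
  · have hcont : Tendsto (fun t : ℝ => x + t • (y - x)) (𝓝[>] 0) (𝓝 x) := by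
      have : Continuous fun t : ℝ => x + t • (y - x) := by fun_prop
      have h2 := this.tendsto 0
      simp only [zero_smul, add_zero] at h2
      exact h2.mono_left nhdsWithin_le_nhds
    obtain ⟨t, htΩ, ht⟩ := ((hcont.eventually (hΩ.mem_nhds hx)).and
      (Ioo_mem_nhdsGT (zero_lt_one' ℝ))).exists
    refine Metric.mem_thickening_iff.2 ⟨_, htΩ, ?_⟩
    have : y - (x + t • (y - x)) = (1 - t) • (y - x) := by module
    rw [dist_eq_norm, this, norm_smul, Real.norm_eq_abs, abs_of_pos (by linarith [ht.2]),
      ← dist_eq_norm, dist_comm, h]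
    nlinarith [ht.1]

/-- Balls with centre outside the thickening do not meet the cube and are discarded. -/
theorem exists_admissible_of_finset {β : ℝ} (hβ : 0 < β) {n : ℕ} (hn : 0 < n)
    {T : Finset (Space d)} (hT : T.card ≤ n) :
    ∃ y : Fin n → Space d, AdmissibleCentres β (unitCube d) y ∧
      unitCube d ∩ closedBalls (T : Set (Space d)) (radius d β n) ⊆
        closedBalls (range y) (radius d β n) := by
  classical
  have hr := radius_pos (d := d) hβ hn
  set A := Metric.thickening (radius d β n) (unitCube d)
  obtain ⟨y, hyA, hy⟩ := exists_fin_of_finset (T := T.filter (· ∈ A)) (A := A)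
    (fun z hz => (Finset.mem_filter.1 (Finset.mem_coe.1 hz)).2)
    (unitCube_nonempty.mono (Metric.self_subset_thickening hr _))
    ((Finset.card_filter_le _ _).trans hT)
  refine ⟨y, hyA, ?_⟩
  rintro x ⟨hx, hxT⟩
  obtain ⟨z, hz, hxz⟩ := mem_closedBalls.1 hxT
  refine mem_closedBalls.2 ⟨z, hy ?_, hxz⟩
  exact Finset.mem_coe.2 (Finset.mem_filter.2 ⟨hz, mem_thickening_of_closedBall_inter
    isOpen_unitCube hr hx hxz⟩)

theorem theta_eq (hd : 0 < d) (β : ℝ) :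
    theta d β = ⨅ (y : (n : ℕ) → Fin n → Space d)
      (_ : ∀ n, AdmissibleCentres β (unitCube d) (y n)),
      liminf (fun n => cellEnergy d β n (range (y n))) atTop := by
  have key : ∀ n (x : Fin n → Space d),
      scaledCompliance n (ballUnion β (unitCube d) x) (fun _ => 1) (unitCube d) =
        cellEnergy d β n (range x) := fun n x =>
    scaledCompliance_eq hd isBounded_unitCube isOpen_unitCube memLp_one_unitCube β x
  apply le_antisymm
  · refine le_iInf₂ fun y hy => ?_
    refine (iInf₂_le (fun n => ballUnion β (unitCube d) (y n))
      (fun n => ⟨y n, hy n, rfl⟩)).trans (le_of_eq ?_)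
    simp only [key]
  · refine le_iInf₂ fun S hS => ?_
    choose y hy hSy using hS
    refine (iInf₂_le y hy).trans (le_of_eq ?_)
    simp only [hSy, key]

/-- A lower bound uniform over configurations: if configurations of energy at most b existed for
infinitely many n, they would form, completed arbitrarily at the other n, an admissible sequence
with lower limit at most b. -/
theorem eventually_lt_cellEnergy (hd : 0 < d) {β : ℝ} (hβ : 0 < β) {b : ℝ≥0∞}
    (hb : b < theta d β) :
    ∀ᶠ n : ℕ in atTop, ∀ T : Finset (Space d), T.card ≤ n → b < cellEnergy d β n T := by
  classical
  by_contra hcon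
  rw [not_eventually] at hcon
  have hfreq : ∃ᶠ n : ℕ in atTop, ∃ y : Fin n → Space d,
      AdmissibleCentres β (unitCube d) y ∧ cellEnergy d β n (range y) ≤ b := by
    refine (hcon.and_eventually (eventually_gt_atTop 0)).mono ?_
    rintro n ⟨h, hn⟩
    push Not at h
    obtain ⟨T, hT, hTb⟩ := h
    obtain ⟨y, hy, hy'⟩ := exists_admissible_of_finset hβ hn hT
    exact ⟨y, hy, (cellEnergy_anti hy').trans hTb⟩
  have hdef : ∀ n : ℕ, ∃ y : Fin n → Space d, AdmissibleCentres β (unitCube d) y := by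
    intro n
    rcases Nat.eq_zero_or_pos n with rfl | hn
    · exact ⟨fun i => i.elim0, fun i => i.elim0⟩
    · obtain ⟨y, hy, -⟩ := exists_admissible_of_finset (T := ∅) hβ hn (by simp)
      exact ⟨y, hy⟩
  set y : (n : ℕ) → Fin n → Space d := fun n =>
    if h : ∃ y : Fin n → Space d, AdmissibleCentres β (unitCube d) y ∧
      cellEnergy d β n (range y) ≤ b then h.choose else (hdef n).choose with hy
  have hyadm : ∀ n, AdmissibleCentres β (unitCube d) (y n) := by
    intro n
    simp only [hy]
    split_ifs with h
    · exact h.choose_spec.1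
    · exact (hdef n).choose_spec
  have h1 : theta d β ≤ liminf (fun n => cellEnergy d β n (range (y n))) atTop := by
    rw [theta_eq hd]
    exact iInf₂_le y hyadm
  have h2 : liminf (fun n => cellEnergy d β n (range (y n))) atTop ≤ b := by
    refine liminf_le_of_frequently_le' (hfreq.mono fun n h => ?_)
    simp only [hy, dif_pos h]
    exact h.choose_spec.2
  exact absurd (hb.trans_le (h1.trans h2)) (lt_irrefl _)

/-- The lower limit in θ provides good configurations only for infinitely many n. A single large one
is enough, since it will be repeated periodically. -/
theorem frequently_cellEnergy_lt (hd : 0 < d) {β : ℝ} {t : ℝ≥0∞} (ht : theta d β < t) :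
    ∃ᶠ n : ℕ in atTop, ∃ T : Finset (Space d), T.card ≤ n ∧
      (T : Set (Space d)) ⊆ Metric.thickening (radius d β n) (unitCube d) ∧
      cellEnergy d β n T < t := by
  classical
  rw [theta_eq hd, iInf_lt_iff] at ht
  obtain ⟨y, hy⟩ := ht
  obtain ⟨hyadm, hlt⟩ := iInf_lt_iff.1 hy
  refine (frequently_lt_of_liminf_lt (by isBoundedDefault) hlt).mono fun n hn => ?_
  refine ⟨Finset.univ.image (y n), Finset.card_image_le.trans (by simp), ?_, ?_⟩
  · intro x hx
    obtain ⟨i, -, rfl⟩ := Finset.mem_image.1 (Finset.mem_coe.1 hx)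
    exact hyadm n i
  · rwa [Finset.coe_image, Finset.coe_univ, image_univ]

theorem theta_antitone (hd : 0 < d) {β γ : ℝ} (hβ : 0 < β) (h : β ≤ γ) :
    theta d γ ≤ theta d β := by
  classical
  refine le_of_forall_lt fun b hb => lt_of_not_ge fun hle => ?_
  obtain ⟨b', hb1, hb2⟩ := exists_between hb
  obtain ⟨n, ⟨T, hT, -, hTlt⟩, hn⟩ := ((frequently_cellEnergy_lt hd (hle.trans_lt hb1)).and_eventually
    (eventually_lt_cellEnergy hd (hβ.trans_le h) hb2)).exists
  have h1 : cellEnergy d γ n T ≤ cellEnergy d β n T :=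
    cellEnergy_anti (inter_subset_right.trans (closedBalls_mono Subset.rfl (radius_mono h n)))
  exact absurd ((hn T hT).trans_le h1) (not_lt.2 hTlt.le)

/-- Walls at distance K n^(-1/d) fit within n balls (δ = ε = 1 in `exists_walls`), and the Poincaré
bound makes the rescaled energy at most a constant multiple of K². -/
theorem theta_lt_top (hd : 0 < d) {β : ℝ} (hβ : 0 < β) : theta d β < ⊤ := by
  obtain ⟨K, hK, hw⟩ := exists_walls (⟨0, hd⟩ : Fin d) hβ one_pos
  have hw1 := hw 1 one_pos
  have hone : MemLp ((unitCube d).indicator fun _ : Space d => (1 : ℝ)) 2 volume :=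
    (memLp_indicator_iff_restrict isOpen_unitCube.measurableSet).2 memLp_one_unitCube
  set C : ℝ := 4 * K ^ 2 * ∫ x, (unitCube d).indicator (fun _ : Space d => (1 : ℝ)) x ^ 2
  by_contra htop
  rw [not_lt, top_le_iff] at htop
  have hlt := eventually_lt_cellEnergy hd hβ (b := ENNReal.ofReal C)
    (by rw [htop]; exact ENNReal.ofReal_lt_top)
  obtain ⟨n, hn1, hn2, hn⟩ := (hw1.and (hlt.and (eventually_gt_atTop 0))).exists
  obtain ⟨T, -, hcard, hT⟩ := hn1 0 (unitCube d) fun x hx j => by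
    simpa using Ioo_subset_Icc_self (hx j)
  have hcard' : T.card ≤ n := by
    simp only [one_pow, mul_one, one_mul] at hcard
    exact_mod_cast hcard
  refine absurd (hn2 T hcard') (not_lt.2 ?_)
  unfold cellEnergy
  rw [dualEnergy_congr (w := (unitCube d).indicator fun _ : Space d => (1 : ℝ))
    (ae_of_all _ fun x hx => by rw [indicator_of_mem hx.1])]
  have h1 := dualEnergy_le_of_walls (⟨0, hd⟩ : Fin d)
    (U := unitCube d \ closedBalls (T : Set (Space d)) (radius d β n))
    (radius_pos (d := d) hK hn) (fun x hx k hk => hx.2 (hT x hx.1 ⟨k, hk⟩)) hone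
  refine (mul_le_mul_right h1 _).trans (le_of_eq ?_)
  rw [← ENNReal.ofReal_mul (by positivity)]
  congr 1
  rw [← rpow_one_div_sq, radius_eq_div]
  have : (0 : ℝ) < (n : ℝ) ^ ((1 : ℝ) / d) := by positivity
  simp only [C]
  field_simp

end Theta

/-! ### Energy of a cube with a prescribed density of balls. -/

section Cubes
variable {d : ℕ}

/-- The open cube with lower corner `a` and side `δ`. -/
def cube (a : Space d) (δ : ℝ) : Set (Space d) := {x | ∀ i, x i ∈ Ioo (a i) (a i + δ)}

/-- The closed cube with lower corner `a` and side `δ`. -/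
def closedCube (a : Space d) (δ : ℝ) : Set (Space d) := {x | ∀ i, x i ∈ Icc (a i) (a i + δ)}

theorem cube_subset_closedCube (a : Space d) (δ : ℝ) : cube a δ ⊆ closedCube a δ :=
  fun _ hx i => Ioo_subset_Icc_self (hx i)

theorem homothety_image (a : Space d) {δ : ℝ} (hδ : 0 < δ) (A : Set (Space d)) :
    (fun x => a + δ • x) '' A = {x | δ⁻¹ • (x - a) ∈ A} := by
  ext x
  constructor
  · rintro ⟨y, hy, rfl⟩
    simpa [smul_smul, hδ.ne'] using hy
  · intro hx
    exact ⟨_, hx, by simp [smul_smul, hδ.ne']⟩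

theorem cube_eq_image (a : Space d) {δ : ℝ} (hδ : 0 < δ) :
    cube a δ = (fun x => a + δ • x) '' unitCube d := by
  rw [homothety_image a hδ]
  ext x
  refine forall_congr' fun i => ?_
  simp only [PiLp.smul_apply, PiLp.sub_apply, smul_eq_mul, mem_Ioo]
  rw [inv_mul_eq_div, lt_div_iff₀ hδ, div_lt_one hδ, zero_mul]
  constructor <;> rintro ⟨h1, h2⟩ <;> constructor <;> linarith

theorem isOpen_cube (a : Space d) (δ : ℝ) : IsOpen (cube a δ) := by
  have : cube a δ = ⋂ i, (fun x : Space d => x i) ⁻¹' Ioo (a i) (a i + δ) := by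
    ext x; simp [cube]
  rw [this]
  exact isOpen_iInter_of_finite fun i => isOpen_Ioo.preimage (by fun_prop)

theorem isClosed_closedCube (a : Space d) (δ : ℝ) : IsClosed (closedCube a δ) := by
  have : closedCube a δ = ⋂ i, (fun x : Space d => x i) ⁻¹' Icc (a i) (a i + δ) := by
    ext x; simp [closedCube]
  rw [this]
  exact isClosed_iInter fun i => isClosed_Icc.preimage (by fun_prop)

theorem dist_le_of_mem_closedCube {a x y : Space d} {δ : ℝ} (hδ : 0 ≤ δ)
    (hx : x ∈ closedCube a δ) (hy : y ∈ closedCube a δ) : dist x y ≤ δ * d := by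
  refine dist_le_of_forall_abs_sub_le (by positivity) fun j => ?_
  have hd : (d : ℝ) ≠ 0 := by exact_mod_cast j.pos.ne'
  have h1 := hx j
  have h2 := hy j
  rw [mul_div_cancel_right₀ _ hd, abs_le]
  exact ⟨by linarith [h1.1, h2.2], by linarith [h1.2, h2.1]⟩

theorem isBounded_closedCube (a : Space d) (δ : ℝ) : Bornology.IsBounded (closedCube a δ) := by
  rcases le_or_gt 0 δ with hδ | hδ
  · exact Metric.isBounded_iff.2 ⟨δ * d, fun x hx y hy => dist_le_of_mem_closedCube hδ hx hy⟩
  · rcases Nat.eq_zero_or_pos d with rfl | hd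
    · exact (Set.toFinite _).isBounded
    · have : closedCube a δ = ∅ := by
        refine eq_empty_of_forall_notMem fun x hx => ?_
        have := hx ⟨0, hd⟩
        linarith [this.1, this.2]
      rw [this]; exact Bornology.isBounded_empty

open scoped Pointwise in
theorem volume_cube (a : Space d) {δ : ℝ} (hδ : 0 < δ) :
    volume (cube a δ) = ENNReal.ofReal (δ ^ d) := by
  have : (fun x : Space d => a + δ • x) '' unitCube d =
      (fun x => a + x) '' (δ • unitCube d) := by
    rw [← image_smul, image_image]
  rw [cube_eq_image a hδ, this, image_add_left, measure_preimage_add, Measure.addHaar_smul,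
    volume_unitCube, mul_one, abs_of_pos (by positivity), finrank_euclideanSpace_fin]

theorem volume_cube_lt_top (a : Space d) (δ : ℝ) : volume (cube a δ) < ⊤ :=
  ((isBounded_closedCube a δ).subset (cube_subset_closedCube a δ)).measure_lt_top

theorem memLp_const_of_isBounded {A : Set (Space d)} (hA : Bornology.IsBounded A) (c : ℝ) :
    MemLp (fun _ : Space d => c) 2 (volume.restrict A) := by
  have : IsFiniteMeasure (volume.restrict A) :=
    ⟨by rw [Measure.restrict_apply_univ]; exact hA.measure_lt_top⟩
  exact memLp_const c

theorem homothety_image_closedBalls (a : Space d) {δ : ℝ} (hδ : 0 < δ) (T : Set (Space d)) (s : ℝ) :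
    (fun x => a + δ • x) '' (unitCube d \ closedBalls T s) =
      cube a δ \ closedBalls ((fun x => a + δ • x) '' T) (δ * s) := by
  rw [image_sdiff, ← cube_eq_image a hδ]
  · congr 1
    ext x
    simp only [mem_image, mem_closedBalls, exists_exists_and_eq_and]
    constructor
    · rintro ⟨x, ⟨y, hy, hxy⟩, rfl⟩
      refine ⟨y, hy, ?_⟩
      rw [dist_add_left, dist_smul₀, Real.norm_eq_abs, abs_of_pos hδ]
      gcongr
    · rintro ⟨y, hy, hxy⟩
      refine ⟨δ⁻¹ • (x - a), ⟨y, hy, ?_⟩, by simp [smul_smul, hδ.ne']⟩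
      have h1 : x = a + δ • (δ⁻¹ • (x - a)) := by simp [smul_smul, hδ.ne']
      rw [h1, dist_add_left, dist_smul₀, Real.norm_eq_abs, abs_of_pos hδ] at hxy
      exact le_of_mul_le_mul_left hxy hδ
  · intro x y hxy
    simpa [hδ.ne'] using hxy

theorem dualEnergy_cube_diff (a : Space d) {δ : ℝ} (hδ : 0 < δ) (T : Set (Space d)) (s : ℝ) :
    dualEnergy (cube a δ \ closedBalls ((fun x => a + δ • x) '' T) (δ * s)) (fun _ => 1) =
      ENNReal.ofReal (δ ^ (d + 2)) * dualEnergy (unitCube d \ closedBalls T s) (fun _ => 1) := by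
  rw [← homothety_image_closedBalls a hδ, dualEnergy_homothety _ _ hδ]

/-- The limit density `ρ^{-2/d} θ(α ρ^{1/d})` of the rescaled compliance. -/
def cellDensity (d : ℕ) (α ρ : ℝ) : ℝ≥0∞ :=
  ENNReal.ofReal ((ρ ^ ((1 : ℝ) / d)) ^ 2)⁻¹ * theta d (α * ρ ^ ((1 : ℝ) / d))

theorem cellDensity_lt_top (hd : 0 < d) {α ρ : ℝ} (hα : 0 < α) (hρ : 0 < ρ) :
    cellDensity d α ρ < ⊤ :=
  ENNReal.mul_lt_top ENNReal.ofReal_lt_top (theta_lt_top hd (by positivity))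

theorem cellDensity_antitone (hd : 0 < d) {α ρ ρ' : ℝ} (hα : 0 < α) (hρ : 0 < ρ) (h : ρ ≤ ρ') :
    cellDensity d α ρ' ≤ cellDensity d α ρ := by
  unfold cellDensity
  have h1 : ρ ^ ((1 : ℝ) / d) ≤ ρ' ^ ((1 : ℝ) / d) := by gcongr
  have h2 : 0 < ρ ^ ((1 : ℝ) / d) := by positivity
  refine mul_le_mul' (by gcongr) (theta_antitone hd (by positivity) (by gcongr))

theorem real_rpow_one_div_pow (hd : 0 < d) {ρ : ℝ} (hρ : 0 ≤ ρ) : (ρ ^ ((1 : ℝ) / d)) ^ d = ρ := by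
  rw [one_div, Real.rpow_inv_natCast_pow hρ hd.ne']

/-- Lower bound for the compliance of a cube in terms of the number of balls. -/
theorem eventually_le_dualEnergy_cube (hd : 0 < d) {α δ ρ : ℝ} (hα : 0 < α) (hδ : 0 < δ)
    (hρ : 0 < ρ) {b : ℝ≥0∞} (hb : b < ENNReal.ofReal (δ ^ d) * cellDensity d α ρ) :
    ∀ᶠ n : ℕ in atTop, ∀ (a : Space d) (T : Finset (Space d)), (T.card : ℝ) ≤ ρ * δ ^ d * n →
      b ≤ ENNReal.ofReal ((n : ℝ) ^ ((2 : ℝ) / d)) *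
        dualEnergy (cube a δ \ closedBalls (T : Set (Space d)) (radius d α n)) (fun _ => 1) := by
  classical
  set σ : ℝ := ρ ^ ((1 : ℝ) / d) with hσ
  have hσ0 : 0 < σ := by positivity
  have hσd : σ ^ d = ρ := real_rpow_one_div_pow hd hρ.le
  set C : ℝ := δ ^ d * (σ ^ 2)⁻¹ with hC
  have hC0 : 0 < C := by positivity
  have hb' : b / ENNReal.ofReal C < theta d (α * σ) := by
    refine ENNReal.div_lt_of_lt_mul' ?_
    rwa [hC, ENNReal.ofReal_mul (by positivity), mul_assoc]
  have hm : Tendsto (fun n : ℕ => ⌊ρ * δ ^ d * n⌋₊) atTop atTop :=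
    tendsto_nat_floor_atTop.comp (tendsto_natCast_atTop_atTop.const_mul_atTop (by positivity))
  filter_upwards [hm.eventually (eventually_lt_cellEnergy hd (by positivity) hb'),
    hm.eventually (eventually_gt_atTop 0), eventually_gt_atTop 0] with n hn hm0 hn0 a T hT
  set m : ℕ := ⌊ρ * δ ^ d * n⌋₊ with hmdef
  have hTm : T.card ≤ m := Nat.le_floor hT
  set ν : ℝ := (n : ℝ) ^ ((1 : ℝ) / d) with hν
  set μ : ℝ := (m : ℝ) ^ ((1 : ℝ) / d) with hμ
  have hν0 : 0 < ν := by positivity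
  have hμ0 : 0 < μ := by positivity
  have hμle : μ ≤ σ * δ * ν := by
    refine le_of_pow_le_pow_left₀ hd.ne' (by positivity) ?_
    rw [hμ, rpow_one_div_pow hd, mul_pow, mul_pow, hσd, hν, rpow_one_div_pow hd]
    exact Nat.floor_le (by positivity)
  set T' : Finset (Space d) := T.image fun y => δ⁻¹ • (y - a) with hT'
  have himg : (fun x => a + δ • x) '' (T' : Set (Space d)) = T := by
    rw [hT', Finset.coe_image, image_image]
    simp [smul_smul, hδ.ne']
  have h1 := hn T' (Finset.card_image_le.trans hTm)
  have h2 := dualEnergy_cube_diff a hδ (T' : Set (Space d)) (radius d (α * σ) m)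
  rw [himg] at h2
  -- Rounding m down makes m^(1/d) ≤ σ δ n^(1/d), so the balls obtained from the unit cube are at
  -- least as large as the given ones; enlarging balls lowers the energy.
  have h3 : radius d α n ≤ δ * radius d (α * σ) m := by
    rw [radius_eq_div, radius_eq_div, ← hν, ← hμ, div_le_iff₀ hν0]
    have : δ * (α * σ / μ) * ν = α * (σ * δ * ν) / μ := by ring
    rw [this, le_div_iff₀ hμ0]
    gcongr
  have h4 : dualEnergy (cube a δ \ closedBalls (T : Set (Space d)) (δ * radius d (α * σ) m))
      (fun _ => 1) ≤
      dualEnergy (cube a δ \ closedBalls (T : Set (Space d)) (radius d α n)) (fun _ => 1) :=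
    dualEnergy_mono (sdiff_subset_sdiff_right (closedBalls_mono Subset.rfl h3))
  have h5 : b ≤ ENNReal.ofReal C * cellEnergy d (α * σ) m T' := by
    have h6 := (ENNReal.div_le_iff (by simpa using hC0) ENNReal.ofReal_ne_top).1 h1.le
    rwa [mul_comm]
  refine h5.trans (le_trans ?_ (mul_le_mul_right h4 _))
  rw [h2, cellEnergy, ← mul_assoc, ← mul_assoc, ← ENNReal.ofReal_mul (by positivity),
    ← ENNReal.ofReal_mul (by positivity), ← rpow_one_div_sq, ← rpow_one_div_sq, ← hν, ← hμ]
  refine mul_le_mul_left (ENNReal.ofReal_le_ofReal ?_) _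
  calc C * μ ^ 2 ≤ C * (σ * δ * ν) ^ 2 := by gcongr
    _ = ν ^ 2 * δ ^ (d + 2) := by rw [hC]; field_simp; ring

/-- A configuration in the unit cube which is almost optimal and covers the boundary. -/
theorem exists_tile (hd : 0 < d) {β η : ℝ} (hβ : 0 < β) (hη : 0 < η) {t : ℝ≥0∞}
    (ht : theta d β < t) :
    ∃ m : ℕ, 0 < m ∧ ∃ T : Finset (Space d), (T.card : ℝ) ≤ (1 + η) * m ∧
      closedCube 0 1 \ unitCube d ⊆ closedBalls (T : Set (Space d)) (radius d β m) ∧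
      cellEnergy d β m T ≤ t := by
  classical
  -- The faces are covered as hyperplanes at distance l = 1: d directions, the factor 1/1 + 2 = 3
  -- and (2d n^(1/d)/β)^(d-1) balls for each. The total is of order n^((d-1)/d), negligible compared
  -- with n.
  set C : ℝ := 3 * d * (2 * d / β) ^ (d - 1) with hC
  have htend := tendsto_rpow_one_div hd
  obtain ⟨n, ⟨T, hTn, -, hTt⟩, hn1, hn2, hn0⟩ := ((frequently_cellEnergy_lt hd ht).and_eventually
    ((htend.eventually_ge_atTop (C / η)).and ((htend.eventually_ge_atTop (2 * β / d)).and
      (eventually_gt_atTop 0)))).exists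
  set ν : ℝ := (n : ℝ) ^ ((1 : ℝ) / d) with hν
  have hν0 : 0 < ν := by positivity
  have hr : radius d β n = β / ν := radius_eq_div β n
  have hd' : (0 : ℝ) < d := by exact_mod_cast hd
  have hcov := fun i : Fin d => exists_finset_cover_hyperplanes i (0 : Space d) (δ := 1) (l := 1)
    (r := β / ν) zero_le_one one_pos (by positivity) (E := closedCube 0 1) (fun x hx => hx)
  choose W hWE hWcard hW using hcov
  refine ⟨n, hn0, T ∪ Finset.univ.biUnion W, ?_, ?_, ?_⟩
  · have h1 : ((T ∪ Finset.univ.biUnion W).card : ℝ) ≤ n + ∑ i, ((W i).card : ℝ) := by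
      exact_mod_cast (Finset.card_union_le _ _).trans (add_le_add hTn Finset.card_biUnion_le)
    have h2 : ∑ i, ((W i).card : ℝ) ≤ C * ν ^ (d - 1) := by
      calc ∑ i, ((W i).card : ℝ) ≤ ∑ _i : Fin d, 3 * (2 * (d / (β / ν))) ^ (d - 1) := by
            refine Finset.sum_le_sum fun i _ => (hWcard i).trans ?_
            have h3 : 2 ≤ d / (β / ν) := by
              rw [le_div_iff₀ (by positivity), mul_div_assoc', div_le_iff₀ hν0]
              rw [div_le_iff₀ hd'] at hn2
              linarith
            have : 1 * (d : ℝ) / (β / ν) + 2 ≤ 2 * (d / (β / ν)) := by rw [one_mul]; linarith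
            have h4 : (1 : ℝ) / 1 + 2 = 3 := by norm_num
            rw [h4]
            gcongr
        _ = C * ν ^ (d - 1) := by
            rw [Finset.sum_const, Finset.card_univ, Fintype.card_fin, nsmul_eq_mul, hC]
            have : 2 * ((d : ℝ) / (β / ν)) = 2 * d / β * ν := by field_simp
            rw [this, mul_pow]; ring
    have h5 : C * ν ^ (d - 1) ≤ η * n := by
      rw [← rpow_one_div_pow hd n, ← hν, ← mul_pow_sub_one hd.ne' ν, ← mul_assoc]
      gcongr
      rw [div_le_iff₀ hη] at hn1
      linarith
    linarith
  · rintro x ⟨hx, hx'⟩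
    have h1 : ∃ i, x i ∉ Ioo (0 : ℝ) 1 := by
      by_contra h; push Not at h; exact hx' h
    obtain ⟨i, hi⟩ := h1
    have hxi := hx i
    simp only [PiLp.zero_apply, zero_add, mem_Icc, mem_Ioo, not_and, not_lt] at hxi hi
    have hint : ∃ k : ℤ, x i = k * (1 : ℝ) := by
      rcases hxi.1.eq_or_lt with h | h
      · exact ⟨0, by rw [← h]; simp⟩
      · exact ⟨1, by simp; exact le_antisymm hxi.2 (hi h)⟩
    have := hW i x hx hint
    rw [hr]
    exact closedBalls_mono (by
      intro y hy
      simp only [Finset.coe_union, mem_union, Finset.coe_biUnion]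
      exact Or.inr (mem_biUnion (Finset.mem_coe.2 (Finset.mem_univ i)) hy)) le_rfl this
  · exact (cellEnergy_anti (inter_subset_right.trans
      (closedBalls_mono (by simp) le_rfl))).trans hTt.le

/-- The right endpoint s = k goes to the last interval, so the closed tiles cover the closed cube.
-/
theorem exists_nat_sub_mem_Icc {s : ℝ} {k : ℕ} (hk : 0 < k) (hs : s ∈ Icc (0 : ℝ) k) :
    ∃ z : Fin k, s - (z : ℕ) ∈ Icc (0 : ℝ) 1 := by
  rcases hs.2.eq_or_lt with h | h
  · refine ⟨⟨k - 1, by omega⟩, ?_⟩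
    have h1 : ((k - 1 : ℕ) : ℝ) = k - 1 := by rw [Nat.cast_sub hk]; simp
    simp only [h1, h]
    constructor <;> linarith
  · have h1 : ⌊s⌋₊ < k := (Nat.floor_lt hs.1).2 h
    refine ⟨⟨_, h1⟩, ?_⟩
    have h2 := Nat.floor_le hs.1
    have h3 := Nat.lt_floor_add_one s
    constructor
    · dsimp only; linarith
    · dsimp only; linarith

/-- Subdivision of a cube into `k ^ d` tiles carrying homothetic copies of one configuration. -/
theorem exists_tiling (a : Space d) {δ : ℝ} (hδ : 0 < δ) {k : ℕ} (hk : 0 < k)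
    (T₀ : Finset (Space d)) {s R : ℝ}
    (hcov : closedCube 0 1 \ unitCube d ⊆ closedBalls (T₀ : Set (Space d)) s)
    (hR : ∀ y ∈ T₀, ∀ c ∈ unitCube d, dist y c ≤ R) :
    ∃ T : Finset (Space d), T.card ≤ k ^ d * T₀.card ∧
      (∀ y ∈ T, ∃ c ∈ cube a δ, dist y c ≤ δ / k * R) ∧
      closedCube a δ \ cube a δ ⊆ closedBalls (T : Set (Space d)) (δ / k * s) ∧
      dualEnergy (cube a δ \ closedBalls (T : Set (Space d)) (δ / k * s)) (fun _ => 1) ≤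
        ENNReal.ofReal (k ^ d * (δ / k) ^ (d + 2)) *
          dualEnergy (unitCube d \ closedBalls (T₀ : Set (Space d)) s) (fun _ => 1) := by
  classical
  have hk' : (0 : ℝ) < k := by exact_mod_cast hk
  set e : ℝ := δ / k with he
  have he0 : 0 < e := by positivity
  have hke : k * e = δ := by rw [he]; field_simp
  set corner : (Fin d → Fin k) → Space d := fun z => a + e • WithLp.toLp 2 fun i => ((z i : ℕ) : ℝ)
    with hcorner
  have hci : ∀ z i, corner z i = a i + e * (z i : ℕ) := fun z i => by
    simp [hcorner]
  set Tz : (Fin d → Fin k) → Finset (Space d) := fun z => T₀.image fun y => corner z + e • y with hTz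
  set T : Finset (Space d) := Finset.univ.biUnion Tz with hT
  have hTzT : ∀ z, (Tz z : Set (Space d)) ⊆ T := fun z y hy =>
    Finset.mem_coe.2 (Finset.mem_biUnion.2 ⟨z, Finset.mem_univ _, hy⟩)
  have hTzc : ∀ z, (Tz z : Set (Space d)) = (fun x => corner z + e • x) '' (T₀ : Set (Space d)) :=
    fun z => by rw [hTz, Finset.coe_image]
  have hsub : ∀ z, cube (corner z) e ⊆ cube a δ := by
    intro z x hx i
    have h1 := hx i
    rw [hci] at h1
    have h2 : ((z i : ℕ) : ℝ) + 1 ≤ k := by exact_mod_cast (z i).2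
    have h3 : e * (((z i : ℕ) : ℝ) + 1) ≤ e * k := by gcongr
    have h4 : 0 ≤ e * ((z i : ℕ) : ℝ) := by positivity
    exact ⟨by linarith [h1.1], by linarith [h1.2]⟩
  -- A point in no open tile lies on the boundary of a closed one, which the copy of T₀ covers.
  -- Outside the balls the tiles are therefore disjoint open pieces.
  have hcover : closedCube a δ ⊆ closedBalls (T : Set (Space d)) (e * s) ∪
      ⋃ z ∈ (Finset.univ : Finset (Fin d → Fin k)), cube (corner z) e := by
    intro x hx
    have h1 : ∀ i, (x i - a i) / e ∈ Icc (0 : ℝ) k := fun i => by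
      have := hx i
      refine ⟨div_nonneg (by linarith [this.1]) he0.le, ?_⟩
      rw [div_le_iff₀ he0, hke]; linarith [this.2]
    choose z hz using fun i => exists_nat_sub_mem_Icc hk (h1 i)
    set w : Space d := e⁻¹ • (x - corner z) with hw
    have hwi : ∀ i, w i = (x i - a i) / e - (z i : ℕ) := fun i => by
      simp only [hw, PiLp.smul_apply, PiLp.sub_apply, smul_eq_mul, hci]
      field_simp; ring
    have hxw : x = corner z + e • w := by simp [hw, smul_smul, he0.ne']
    by_cases hwc : w ∈ unitCube d
    · right
      refine mem_biUnion (Finset.mem_coe.2 (Finset.mem_univ z)) ?_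
      rw [cube_eq_image _ he0, hxw]
      exact mem_image_of_mem _ hwc
    · left
      have hw1 : w ∈ closedCube (0 : Space d) 1 := fun i => by
        rw [hwi]; simpa using hz i
      obtain ⟨y, hy, hwy⟩ := mem_closedBalls.1 (hcov ⟨hw1, hwc⟩)
      refine mem_closedBalls.2 ⟨corner z + e • y, hTzT z ?_, ?_⟩
      · rw [hTzc]; exact mem_image_of_mem _ hy
      · rw [hxw, dist_add_left, dist_smul₀, Real.norm_eq_abs, abs_of_pos he0]
        gcongr
  refine ⟨T, ?_, ?_, ?_, ?_⟩
  · refine Finset.card_biUnion_le.trans ?_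
    refine (Finset.sum_le_card_nsmul _ _ T₀.card fun z _ => Finset.card_image_le).trans ?_
    simp
  · intro y hy
    obtain ⟨z, -, hyz⟩ := Finset.mem_biUnion.1 hy
    obtain ⟨y₀, hy₀, rfl⟩ := Finset.mem_image.1 hyz
    obtain ⟨c, hc⟩ := unitCube_nonempty (d := d)
    refine ⟨corner z + e • c, hsub z ?_, ?_⟩
    · rw [cube_eq_image _ he0]; exact mem_image_of_mem _ hc
    · rw [dist_add_left, dist_smul₀, Real.norm_eq_abs, abs_of_pos he0]
      exact mul_le_mul_of_nonneg_left (hR y₀ hy₀ c hc) he0.le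
  · rintro x ⟨hx, hx'⟩
    rcases hcover hx with h | h
    · exact h
    · obtain ⟨z, -, hz⟩ := mem_iUnion₂.1 h
      exact absurd (hsub z hz) hx'
  · have h1 : cube a δ \ closedBalls (T : Set (Space d)) (e * s) ⊆
        ⋃ z ∈ (Finset.univ : Finset (Fin d → Fin k)),
          (cube (corner z) e \ closedBalls (Tz z : Set (Space d)) (e * s)) := by
      rintro x ⟨hx, hxT⟩
      rcases hcover (cube_subset_closedCube _ _ hx) with h | h
      · exact absurd h hxT
      · obtain ⟨z, hz, hxz⟩ := mem_iUnion₂.1 h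
        exact mem_biUnion hz ⟨hxz, fun h' => hxT (closedBalls_mono (hTzT z) le_rfl h')⟩
    refine (dualEnergy_mono h1).trans ?_
    rw [dualEnergy_biUnion]
    · have h2 : ∀ z, dualEnergy (cube (corner z) e \ closedBalls (Tz z : Set (Space d)) (e * s))
          (fun _ => 1) = ENNReal.ofReal (e ^ (d + 2)) *
            dualEnergy (unitCube d \ closedBalls (T₀ : Set (Space d)) s) (fun _ => 1) := by
        intro z
        rw [hTzc, dualEnergy_cube_diff _ he0]
      simp only [h2, Finset.sum_const, Finset.card_univ, Fintype.card_fun, Fintype.card_fin,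
        nsmul_eq_mul]
      rw [← mul_assoc, ENNReal.ofReal_mul (by positivity), ENNReal.ofReal_pow (by positivity)
        (n := d), ENNReal.ofReal_natCast, Nat.cast_pow]
    · exact fun z _ => (isOpen_cube _ _).sdiff (isClosed_closedBalls _ _)
    · intro z _ z' _ hzz
      refine disjoint_left.2 ?_
      rintro x ⟨hx, -⟩ ⟨hx', -⟩
      refine hzz (funext fun i => Fin.ext ?_)
      have h1 := hx i
      have h2 := hx' i
      rw [hci] at h1 h2
      have h3 : e * ((z i : ℕ) : ℝ) < e * (((z' i : ℕ) : ℝ) + 1) := by linarith [h1.1, h2.2]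
      have h4 : e * ((z' i : ℕ) : ℝ) < e * (((z i : ℕ) : ℝ) + 1) := by linarith [h2.1, h1.2]
      have h5 := lt_of_mul_lt_mul_left h3 he0.le
      have h6 := lt_of_mul_lt_mul_left h4 he0.le
      have h7 : (z i : ℕ) < (z' i : ℕ) + 1 := by exact_mod_cast h5
      have h8 : (z' i : ℕ) < (z i : ℕ) + 1 := by exact_mod_cast h6
      omega
    · refine memLp_const_of_isBounded ((isBounded_closedCube a δ).subset ?_) 1
      exact iUnion₂_subset fun z _ =>
        sdiff_subset.trans ((hsub z).trans (cube_subset_closedCube _ _))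

/-- Almost optimal configurations in a cube, with prescribed number density. -/
theorem eventually_exists_dualEnergy_cube_le (hd : 0 < d) {α δ ρ₀ ρ₁ e : ℝ} (hα : 0 < α)
    (hδ : 0 < δ) (hρ₀ : 0 < ρ₀) (hρ : ρ₀ < ρ₁) (he : 0 < e) {t : ℝ≥0∞}
    (ht : theta d (α * ρ₀ ^ ((1 : ℝ) / d)) < t) :
    ∀ᶠ n : ℕ in atTop, ∀ a : Space d, ∃ T : Finset (Space d), (T.card : ℝ) ≤ ρ₁ * δ ^ d * n ∧
      (∀ y ∈ T, ∃ c ∈ cube a δ, dist y c ≤ e) ∧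
      closedCube a δ \ cube a δ ⊆ closedBalls (T : Set (Space d)) (radius d α n) ∧
      ENNReal.ofReal ((n : ℝ) ^ ((2 : ℝ) / d)) *
        dualEnergy (cube a δ \ closedBalls (T : Set (Space d)) (radius d α n)) (fun _ => 1) ≤
        ENNReal.ofReal (δ ^ d * ((ρ₀ ^ ((1 : ℝ) / d)) ^ 2)⁻¹) * t := by
  set σ : ℝ := ρ₀ ^ ((1 : ℝ) / d) with hσ
  have hσ0 : 0 < σ := by positivity
  have hσd : σ ^ d = ρ₀ := real_rpow_one_div_pow hd hρ₀.le
  -- Makes ρ₀(1 + η) the midpoint of ρ₀ and ρ₁: part of the gap pays for the face balls, the rest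
  -- for rounding up the number of tiles.
  set η : ℝ := (ρ₁ - ρ₀) / (2 * ρ₀) with hη
  have hη0 : 0 < η := div_pos (by linarith) (by positivity)
  have hηρ : ρ₀ * (1 + η) < ρ₁ := by
    have : ρ₀ * (1 + η) = (ρ₀ + ρ₁) / 2 := by rw [hη]; field_simp; ring
    linarith
  obtain ⟨m, hm, T₀, hT₀card, hT₀cov, hT₀⟩ := exists_tile hd (β := α * σ) (by positivity) hη0 ht
  set μ : ℝ := (m : ℝ) ^ ((1 : ℝ) / d) with hμ
  have hμ0 : 0 < μ := by positivity
  have hμd : μ ^ d = m := rpow_one_div_pow hd m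
  obtain ⟨R, hR0, hR⟩ : ∃ R : ℝ, 0 < R ∧ ∀ y ∈ T₀, ∀ c ∈ unitCube d, dist y c ≤ R := by
    obtain ⟨C, hC⟩ := Metric.isBounded_iff.1
      ((T₀.finite_toSet.isBounded).union (isBounded_unitCube (d := d)))
    exact ⟨max C 1, by positivity, fun y hy c hc =>
      (hC (Or.inl hy) (Or.inr hc)).trans (le_max_left _ _)⟩
  have htend := tendsto_rpow_one_div hd
  have hlim : Tendsto (fun n : ℕ => (δ * σ / μ + ((n : ℝ) ^ ((1 : ℝ) / d))⁻¹) ^ d * ((1 + η) * m))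
      atTop (𝓝 ((δ * σ / μ + 0) ^ d * ((1 + η) * m))) :=
    ((tendsto_const_nhds.add htend.inv_tendsto_atTop).pow d).mul_const _
  have hlt : (δ * σ / μ + 0) ^ d * ((1 + η) * m) < ρ₁ * δ ^ d := by
    rw [add_zero, div_pow, mul_pow, hσd, hμd]
    have hm' : (m : ℝ) ≠ 0 := by positivity
    have : δ ^ d * ρ₀ / m * ((1 + η) * m) = ρ₀ * (1 + η) * δ ^ d := by field_simp
    rw [this]
    gcongr
  filter_upwards [hlim.eventually (eventually_lt_nhds hlt), eventually_gt_atTop 0,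
    htend.eventually_ge_atTop (R * μ / (σ * e))] with n hn hn0 hnR a
  set ν : ℝ := (n : ℝ) ^ ((1 : ℝ) / d) with hν
  have hν0 : 0 < ν := by positivity
  have hνd : ν ^ d = n := rpow_one_div_pow hd n
  -- Rounding up makes the tile balls no larger than α n^(-1/d). The tile size δ/k tends to 0 as n
  -- grows, so the centres stay within e of the cube, and k^d (1 + η) m / n tends to ρ₀(1 + η)δ^d.
  set k : ℕ := ⌈δ * σ * ν / μ⌉₊ with hk
  have hk1 : δ * σ * ν / μ ≤ k := Nat.le_ceil _
  have hk2 : (k : ℝ) ≤ δ * σ * ν / μ + 1 := (Nat.ceil_lt_add_one (by positivity)).le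
  have hk0 : 0 < k := Nat.ceil_pos.2 (by positivity)
  have hk0' : (0 : ℝ) < k := by exact_mod_cast hk0
  rw [div_le_iff₀ hμ0] at hk1
  obtain ⟨T, hTcard, hTe, hTcov, hTE⟩ := exists_tiling a hδ hk0 T₀ hT₀cov hR
  have hrad : δ / k * radius d (α * σ) m ≤ radius d α n := by
    rw [radius_eq_div, radius_eq_div, ← hν, ← hμ, le_div_iff₀ hν0]
    have : δ / k * (α * σ / μ) * ν = α * (δ * σ * ν) / (k * μ) := by field_simp
    rw [this, div_le_iff₀ (by positivity)]
    gcongr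
  refine ⟨T, ?_, fun y hy => ?_, hTcov.trans (closedBalls_mono Subset.rfl hrad), ?_⟩
  · calc (T.card : ℝ) ≤ k ^ d * T₀.card := by exact_mod_cast hTcard
      _ ≤ (δ * σ * ν / μ + 1) ^ d * ((1 + η) * m) := by gcongr
      _ = (δ * σ / μ + ν⁻¹) ^ d * ((1 + η) * m) * n := by
          rw [← hνd]
          have : δ * σ * ν / μ + 1 = (δ * σ / μ + ν⁻¹) * ν := by field_simp
          rw [this, mul_pow]; ring
      _ ≤ ρ₁ * δ ^ d * n := by gcongr
  · obtain ⟨c, hc, hyc⟩ := hTe y hy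
    refine ⟨c, hc, hyc.trans ?_⟩
    rw [div_mul_eq_mul_div, div_le_iff₀ hk0']
    rw [div_le_iff₀ (by positivity)] at hnR
    have h1 : δ * (R * μ) ≤ δ * (ν * (σ * e)) := by gcongr
    have h2 : e * (δ * σ * ν) ≤ e * (k * μ) := by gcongr
    have h3 : (δ * R) * μ ≤ (e * k) * μ := by linarith
    exact le_of_mul_le_mul_right h3 hμ0
  · calc ENNReal.ofReal ((n : ℝ) ^ ((2 : ℝ) / d)) *
        dualEnergy (cube a δ \ closedBalls (T : Set (Space d)) (radius d α n)) (fun _ => 1)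
        ≤ ENNReal.ofReal ((n : ℝ) ^ ((2 : ℝ) / d)) *
          (ENNReal.ofReal (k ^ d * (δ / k) ^ (d + 2)) *
          dualEnergy (unitCube d \ closedBalls (T₀ : Set (Space d)) (radius d (α * σ) m))
            (fun _ => 1)) := by
          gcongr
          exact (dualEnergy_mono (sdiff_subset_sdiff_right
            (closedBalls_mono Subset.rfl hrad))).trans hTE
      _ ≤ ENNReal.ofReal (δ ^ d * (σ ^ 2)⁻¹) * cellEnergy d (α * σ) m T₀ := by
          rw [cellEnergy, ← mul_assoc, ← mul_assoc, ← ENNReal.ofReal_mul (by positivity),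
            ← ENNReal.ofReal_mul (by positivity), ← rpow_one_div_sq, ← rpow_one_div_sq, ← hν, ← hμ]
          refine mul_le_mul_left (ENNReal.ofReal_le_ofReal ?_) _
          have e1 : ν ^ 2 * (k ^ d * (δ / k) ^ (d + 2)) = δ ^ d * (δ * ν) ^ 2 / k ^ 2 := by
            rw [div_pow]; field_simp; ring
          rw [e1, div_le_iff₀ (by positivity)]
          have e2 : δ ^ d * (σ ^ 2)⁻¹ * μ ^ 2 * k ^ 2 = δ ^ d * ((σ ^ 2)⁻¹ * (k * μ) ^ 2) := by ring
          rw [e2, mul_le_mul_iff_right₀ (by positivity), inv_mul_eq_div, le_div_iff₀ (by positivity)]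
          calc (δ * ν) ^ 2 * σ ^ 2 = (δ * σ * ν) ^ 2 := by ring
            _ ≤ _ := by gcongr
      _ ≤ _ := by gcongr

end Cubes

/-! ### Grids, differentiation of measures along cells, step functions. -/

section Grid
variable {d : ℕ}

/-- The index of the cell of the grid of step `δ` which contains `x`. -/
def cellIndex (δ : ℝ) (x : Space d) : Fin d → ℤ := fun i => ⌊x i / δ⌋

/-- The lower corner of the cell of index `z`. -/
def gridCorner (δ : ℝ) (z : Fin d → ℤ) : Space d := WithLp.toLp 2 fun i => δ * z i

/-- The half-open cell of index `z`. -/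
def gridCell (δ : ℝ) (z : Fin d → ℤ) : Set (Space d) := cellIndex δ ⁻¹' {z}

theorem mem_gridCell {δ : ℝ} {z : Fin d → ℤ} {x : Space d} :
    x ∈ gridCell δ z ↔ cellIndex δ x = z := Iff.rfl

theorem measurable_cellIndex (δ : ℝ) : Measurable (cellIndex (d := d) δ) := by
  refine measurable_pi_lambda _ fun i => Int.measurable_floor.comp ?_
  exact (by fun_prop : Continuous fun x : Space d => x i / δ).measurable

theorem measurableSet_gridCell (δ : ℝ) (z : Fin d → ℤ) : MeasurableSet (gridCell (d := d) δ z) :=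
  measurable_cellIndex δ (measurableSet_singleton z)

theorem gridCorner_apply (δ : ℝ) (z : Fin d → ℤ) (i : Fin d) : gridCorner δ z i = δ * z i := rfl

theorem mem_gridCell_iff {δ : ℝ} (hδ : 0 < δ) {z : Fin d → ℤ} {x : Space d} :
    x ∈ gridCell δ z ↔ ∀ i, x i ∈ Ico (gridCorner δ z i) (gridCorner δ z i + δ) := by
  rw [mem_gridCell, funext_iff]
  refine forall_congr' fun i => ?_
  rw [cellIndex, Int.floor_eq_iff, gridCorner_apply, le_div_iff₀ hδ, div_lt_iff₀ hδ, mem_Ico]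
  constructor <;> rintro ⟨h1, h2⟩ <;> constructor <;> linarith

theorem cube_subset_gridCell {δ : ℝ} (hδ : 0 < δ) (z : Fin d → ℤ) :
    cube (gridCorner δ z) δ ⊆ gridCell δ z :=
  fun _ hx => (mem_gridCell_iff hδ).2 fun i => Ioo_subset_Ico_self (hx i)

theorem gridCell_subset_closedCube {δ : ℝ} (hδ : 0 < δ) (z : Fin d → ℤ) :
    gridCell δ z ⊆ closedCube (gridCorner δ z) δ :=
  fun _ hx i => Ico_subset_Icc_self ((mem_gridCell_iff hδ).1 hx i)

theorem mem_closedCube_cellIndex {δ : ℝ} (hδ : 0 < δ) (x : Space d) :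
    x ∈ closedCube (gridCorner δ (cellIndex δ x)) δ :=
  gridCell_subset_closedCube hδ _ rfl

theorem gridCorner_mem_gridCell {δ : ℝ} (hδ : 0 < δ) (z : Fin d → ℤ) :
    gridCorner δ z ∈ gridCell δ z :=
  (mem_gridCell_iff hδ).2 fun _ => ⟨le_rfl, by linarith⟩

theorem gridCorner_mem_closedCube {δ : ℝ} (hδ : 0 < δ) (z : Fin d → ℤ) :
    gridCorner δ z ∈ closedCube (gridCorner δ z) δ :=
  gridCell_subset_closedCube hδ z (gridCorner_mem_gridCell hδ z)

theorem volume_closedCube (a : Space d) {δ : ℝ} :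
    volume (closedCube a δ) = ENNReal.ofReal δ ^ d := by
  have h := EuclideanSpace.volume_preserving_symm_measurableEquiv_toLp (Fin d)
  have h1 : closedCube a δ = (MeasurableEquiv.toLp 2 (Fin d → ℝ)).symm ⁻¹'
      (Set.pi univ fun i => Icc (a i) (a i + δ)) := by
    ext x; simp [closedCube, -pi_univ_Icc]
  rw [h1, h.measure_preimage_equiv, volume_pi_pi]
  simp

theorem volume_closedCube_diff_cube (a : Space d) {δ : ℝ} (hδ : 0 < δ) :
    volume (closedCube a δ \ cube a δ) = 0 := by
  rw [measure_sdiff (cube_subset_closedCube a δ) (isOpen_cube a δ).measurableSet.nullMeasurableSet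
    (volume_cube_lt_top a δ).ne, volume_closedCube, volume_cube a hδ, ENNReal.ofReal_pow hδ.le,
    tsub_self]

theorem volume_gridCell {δ : ℝ} (hδ : 0 < δ) (z : Fin d → ℤ) :
    volume (gridCell (d := d) δ z) = ENNReal.ofReal (δ ^ d) := by
  apply le_antisymm
  · rw [ENNReal.ofReal_pow hδ.le, ← volume_closedCube (gridCorner δ z)]
    exact measure_mono (gridCell_subset_closedCube hδ z)
  · rw [← volume_cube (gridCorner δ z) hδ]
    exact measure_mono (cube_subset_gridCell hδ z)

theorem finite_setOf_gridCell_inter {δ : ℝ} (hδ : 0 < δ) {A : Set (Space d)}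
    (hA : Bornology.IsBounded A) : {z | (gridCell δ z ∩ A).Nonempty}.Finite := by
  obtain ⟨R, hR⟩ := hA.subset_closedBall 0
  refine (Set.finite_Icc (fun _ : Fin d => ⌊-R / δ⌋) (fun _ => ⌊R / δ⌋)).subset ?_
  rintro z ⟨x, hxz, hxA⟩
  have h1 : ‖x‖ ≤ R := by simpa using hR hxA
  have h2 : ∀ i, |x i| ≤ R := fun i => (PiLp.norm_apply_le x i).trans h1
  rw [mem_gridCell] at hxz
  subst hxz
  refine ⟨fun i => Int.floor_le_floor ?_, fun i => Int.floor_le_floor ?_⟩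
  · gcongr; exact (abs_le.1 (h2 i)).1
  · gcongr; exact (abs_le.1 (h2 i)).2

/-- The indices of the cells whose closure is contained in `Ω`. -/
def innerIndices (δ : ℝ) (Ω : Set (Space d)) : Set (Fin d → ℤ) :=
  {z | closedCube (gridCorner δ z) δ ⊆ Ω}

theorem finite_innerIndices {δ : ℝ} (hδ : 0 < δ) {Ω : Set (Space d)}
    (hΩ : Bornology.IsBounded Ω) : (innerIndices δ Ω).Finite :=
  (finite_setOf_gridCell_inter hδ hΩ).subset fun z hz =>
    ⟨gridCorner δ z, gridCorner_mem_gridCell hδ z, hz (gridCorner_mem_closedCube hδ z)⟩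

/-- The union of the cells whose closure is contained in `Ω`. -/
def innerSet (δ : ℝ) (Ω : Set (Space d)) : Set (Space d) := cellIndex δ ⁻¹' innerIndices δ Ω

theorem mem_innerSet {δ : ℝ} {Ω : Set (Space d)} {x : Space d} :
    x ∈ innerSet δ Ω ↔ cellIndex δ x ∈ innerIndices δ Ω := Iff.rfl

theorem measurableSet_innerSet (δ : ℝ) (Ω : Set (Space d)) : MeasurableSet (innerSet δ Ω) :=
  measurable_cellIndex δ (Set.to_countable _).measurableSet

theorem innerSet_subset {δ : ℝ} (hδ : 0 < δ) (Ω : Set (Space d)) : innerSet δ Ω ⊆ Ω :=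
  fun x hx => hx (mem_closedCube_cellIndex hδ x)

/-- The function which is constant on the inner cells of the grid. -/
def stepFun (δ : ℝ) (Ω : Set (Space d)) (c : (Fin d → ℤ) → ℝ) : Space d → ℝ :=
  (innerSet δ Ω).indicator fun x => c (cellIndex δ x)

theorem measurable_stepFun (δ : ℝ) (Ω : Set (Space d)) (c : (Fin d → ℤ) → ℝ) :
    Measurable (stepFun δ Ω c) :=
  ((measurable_of_countable c).comp (measurable_cellIndex δ)).indicator
    (measurableSet_innerSet δ Ω)

theorem stepFun_of_mem_cube {δ : ℝ} (hδ : 0 < δ) {Ω : Set (Space d)} {c : (Fin d → ℤ) → ℝ}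
    {z : Fin d → ℤ} (hz : z ∈ innerIndices δ Ω) {x : Space d} (hx : x ∈ cube (gridCorner δ z) δ) :
    stepFun δ Ω c x = c z := by
  have h1 : cellIndex δ x = z := cube_subset_gridCell hδ z hx
  rw [stepFun, indicator_of_mem (mem_innerSet.2 (h1 ▸ hz)), h1]

theorem lintegral_innerSet_indicator {δ : ℝ} (hδ : 0 < δ) {Ω : Set (Space d)}
    (hΩ : Bornology.IsBounded Ω) (H : (Fin d → ℤ) → ℝ≥0∞) :
    ∫⁻ x, (innerSet δ Ω).indicator (fun x => H (cellIndex δ x)) x =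
      ∑ z ∈ (finite_innerIndices hδ hΩ).toFinset, ENNReal.ofReal (δ ^ d) * H z := by
  have h1 : ∀ x : Space d, (innerSet δ Ω).indicator (fun x => H (cellIndex δ x)) x =
      ∑ z ∈ (finite_innerIndices hδ hΩ).toFinset, (gridCell δ z).indicator (fun _ => H z) x := by
    intro x
    by_cases hx : x ∈ innerSet δ Ω
    · rw [indicator_of_mem hx, Finset.sum_eq_single (cellIndex δ x)]
      · rw [indicator_of_mem (mem_gridCell.2 rfl)]
      · intro z _ hz
        exact indicator_of_notMem (fun h => hz (mem_gridCell.1 h).symm) _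
      · intro h
        exact absurd ((Set.Finite.mem_toFinset (finite_innerIndices hδ hΩ)).2 hx) h
    · rw [indicator_of_notMem hx]
      symm
      refine Finset.sum_eq_zero fun z hz => indicator_of_notMem (fun h => hx ?_) _
      rw [mem_innerSet, mem_gridCell.1 h]
      exact (Set.Finite.mem_toFinset _).1 hz
  simp only [h1]
  rw [lintegral_finsetSum _ fun z _ => measurable_const.indicator (measurableSet_gridCell δ z)]
  refine Finset.sum_congr rfl fun z _ => ?_
  rw [lintegral_indicator_const (measurableSet_gridCell δ z), volume_gridCell hδ, mul_comm]

/-- A cell has diameter at most δ d, eventually smaller than the radius of a ball around x inside Ω.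
-/
theorem exists_closedCube_subset {Ω : Set (Space d)} (hΩ : IsOpen Ω) {x : Space d} (hx : x ∈ Ω) :
    ∀ᶠ δ in 𝓝[>] (0 : ℝ), x ∈ innerSet δ Ω := by
  obtain ⟨r, hr, hrΩ⟩ := Metric.isOpen_iff.1 hΩ x hx
  have h1 : Tendsto (fun δ : ℝ => δ * d) (𝓝[>] 0) (𝓝 0) := by
    have : Tendsto (fun δ : ℝ => δ * d) (𝓝 0) (𝓝 (0 * d)) :=
      (by fun_prop : Continuous fun δ : ℝ => δ * d).tendsto 0
    rw [zero_mul] at this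
    exact this.mono_left nhdsWithin_le_nhds
  filter_upwards [h1.eventually (gt_mem_nhds hr), self_mem_nhdsWithin] with δ h2 hδ
  intro y hy
  exact hrΩ (Metric.mem_ball.2 ((dist_le_of_mem_closedCube (le_of_lt hδ) hy
    (mem_closedCube_cellIndex hδ x)).trans_lt h2))

/-- Differentiation of measures along the cells of the grids. -/
theorem ae_tendsto_measure_closedCube (ρ : Measure (Space d)) [IsLocallyFiniteMeasure ρ]
    {δ : ℕ → ℝ} (hδ : ∀ k, 0 < δ k) (hδ0 : Tendsto δ atTop (𝓝 0)) :
    ∀ᵐ x, Tendsto (fun k => ρ (closedCube (gridCorner (δ k) (cellIndex (δ k) x)) (δ k)) /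
      ENNReal.ofReal (δ k ^ d)) atTop (𝓝 (ρ.rnDeriv volume x)) := by
  set v : ℝ≥0∞ := volume (Metric.closedBall (0 : Space d) 1) with hv
  have hvt : v ≠ ⊤ := measure_closedBall_lt_top.ne
  -- The term 3^d gives the doubling of balls. The other compares the cube, contained in the ball of
  -- radius δ d about x, with the ball of radius 3 δ d, as membership in the Vitali family requires.
  set C : NNReal := 3 ^ d + (ENNReal.ofReal ((3 * d) ^ d) * v).toNNReal with hC
  have hCt : (C : ℝ≥0∞) = 3 ^ d + ENNReal.ofReal ((3 * d) ^ d) * v := by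
    rw [hC]
    push_cast
    rw [ENNReal.coe_toNNReal (ENNReal.mul_ne_top ENNReal.ofReal_ne_top hvt)]
  have hball : ∀ (x : Space d) {r : ℝ}, 0 ≤ r →
      volume (Metric.closedBall x r) = ENNReal.ofReal (r ^ d) * v := by
    intro x r hr
    rw [Measure.addHaar_closedBall' _ _ hr, finrank_euclideanSpace_fin]
  have hdoub : ∀ x : Space d, ∃ᶠ r in 𝓝[>] (0 : ℝ),
      volume (Metric.closedBall x (3 * r)) ≤ C * volume (Metric.closedBall x r) := by
    intro x
    refine Eventually.frequently ?_
    filter_upwards [self_mem_nhdsWithin] with r hr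
    have hr' : 0 < r := hr
    rw [hball x (by positivity), hball x hr'.le, mul_pow, ENNReal.ofReal_mul (by positivity), ← mul_assoc]
    gcongr
    rw [hCt, ENNReal.ofReal_pow (by norm_num)]
    simp
  set V := Vitali.vitaliFamily (volume : Measure (Space d)) C hdoub with hV
  filter_upwards [V.ae_tendsto_rnDeriv ρ] with x hx
  have h1 : Tendsto (fun k => closedCube (gridCorner (δ k) (cellIndex (δ k) x)) (δ k)) atTop
      (V.filterAt x) := by
    rw [V.tendsto_filterAt_iff]
    have hsub : ∀ k, closedCube (gridCorner (δ k) (cellIndex (δ k) x)) (δ k) ⊆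
        Metric.closedBall x (δ k * d) := fun k y hy =>
      Metric.mem_closedBall.2 (dist_le_of_mem_closedCube (hδ k).le hy
        (mem_closedCube_cellIndex (hδ k) x))
    constructor
    · refine Eventually.of_forall fun k => ⟨isClosed_closedCube _ _, ?_, δ k * d, hsub k, ?_⟩
      · obtain ⟨y, hy⟩ := unitCube_nonempty (d := d)
        refine ⟨gridCorner (δ k) (cellIndex (δ k) x) + δ k • y, ?_⟩
        refine interior_maximal (cube_subset_closedCube _ _) (isOpen_cube _ _) ?_
        rw [cube_eq_image _ (hδ k)]
        exact mem_image_of_mem _ hy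
      · have := hδ k
        rw [hball x (by positivity), volume_closedCube, ← ENNReal.ofReal_pow (hδ k).le, hCt]
        have e : (3 * (δ k * d)) ^ d = (3 * d) ^ d * δ k ^ d := by
          rw [← mul_pow]; ring
        rw [e, ENNReal.ofReal_mul (by positivity), mul_right_comm]
        gcongr
        exact le_add_self
    · intro ε hε
      have h2 : Tendsto (fun k => δ k * d) atTop (𝓝 0) := by
        simpa using hδ0.mul_const (d : ℝ)
      filter_upwards [h2.eventually (gt_mem_nhds hε)] with k hk
      exact (hsub k).trans (Metric.closedBall_subset_closedBall hk.le)
  have h2 := hx.comp h1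
  refine h2.congr fun k => ?_
  simp only [Function.comp_apply]
  rw [volume_closedCube, ENNReal.ofReal_pow (hδ k).le]

/-- Step functions on the inner cells of fine grids are dense in `L²(Ω)`. -/
theorem eventually_exists_stepFun {Ω : Set (Space d)} (hΩ : IsOpen Ω)
    (hΩb : Bornology.IsBounded Ω) {f : Space d → ℝ} (hf : MemLp f 2 volume)
    (hf0 : ∀ x, x ∉ Ω → f x = 0) {ε : ℝ≥0∞} (hε : ε ≠ 0)
    {δ : ℕ → ℝ} (hδ : ∀ k, 0 < δ k) (hδ0 : Tendsto δ atTop (𝓝 0)) :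
    ∀ᶠ k in atTop, ∃ c : (Fin d → ℤ) → ℝ,
      eLpNorm (fun x => f x - stepFun (δ k) Ω c x) 2 volume ≤ ε := by
  have hε3 : ε / 3 ≠ 0 := ENNReal.div_ne_zero.2 ⟨hε, by simp⟩
  obtain ⟨φ, hφc, hφf, hφcont, hφm⟩ :=
    hf.exists_hasCompactSupport_eLpNorm_sub_le (by simp) hε3
  have hδ0' : Tendsto δ atTop (𝓝[>] 0) :=
    tendsto_nhdsWithin_iff.2 ⟨hδ0, Eventually.of_forall hδ⟩
  have hG : ∀ k, MeasurableSet (innerSet (δ k) Ω) := fun k => measurableSet_innerSet _ _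
  have hmeas2 : ∀ {F : Space d → ℝ}, eLpNorm F 2 volume ^ 2 = ∫⁻ x, ‖F x‖ₑ ^ 2 := by
    intro F
    have := eLpNorm_nnreal_pow_eq_lintegral (f := F) (μ := volume) (p := 2) (by norm_num)
    simpa using this
  have h2 : ∀ᶠ k in atTop, eLpNorm ((innerSet (δ k) Ω)ᶜ.indicator f) 2 volume ≤ ε / 3 := by
    have hlim : Tendsto (fun k => ∫⁻ x, ‖(innerSet (δ k) Ω)ᶜ.indicator f x‖ₑ ^ 2) atTop
        (𝓝 (∫⁻ _ : Space d, 0)) := by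
      refine tendsto_lintegral_of_dominated_convergence' (fun x => ‖f x‖ₑ ^ 2) ?_ ?_ ?_ ?_
      · intro k
        exact ((hf.1.indicator (hG k).compl).enorm).pow_const 2
      · intro k
        refine ae_of_all _ fun x => ?_
        exact pow_le_pow_left' (enorm_indicator_le_enorm_self _ _) 2
      · rw [← hmeas2]
        exact (ENNReal.pow_lt_top hf.2).ne
      · refine ae_of_all _ fun x => ?_
        by_cases hx : x ∈ Ω
        · refine tendsto_const_nhds.congr' ?_
          filter_upwards [hδ0'.eventually (exists_closedCube_subset hΩ hx)] with k hk
          rw [indicator_of_notMem (by simpa using hk)]; simp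
        · refine tendsto_const_nhds.congr fun k => ?_
          by_cases hxk : x ∈ (innerSet (δ k) Ω)ᶜ
          · rw [indicator_of_mem hxk, hf0 x hx]; simp
          · rw [indicator_of_notMem hxk]; simp
    rw [lintegral_zero] at hlim
    have hpos : 0 < (ε / 3) ^ 2 := ENNReal.pow_pos (pos_iff_ne_zero.2 hε3) 2
    filter_upwards [hlim.eventually (gt_mem_nhds hpos)] with k hk
    rw [← hmeas2] at hk
    exact le_of_not_gt fun h => absurd hk (not_lt.2 (pow_le_pow_left' h.le 2))
  obtain ⟨η, hη, hηε⟩ : ∃ η : ℝ, 0 < η ∧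
      volume Ω ^ (2 : ℝ≥0∞).toReal⁻¹ * ENNReal.ofReal η ≤ ε / 3 := by
    have hA : volume Ω ^ (2 : ℝ≥0∞).toReal⁻¹ ≠ ⊤ :=
      ENNReal.rpow_ne_top_of_nonneg (by positivity) hΩb.measure_lt_top.ne
    have h0 : Tendsto (fun η : ℝ => volume Ω ^ (2 : ℝ≥0∞).toReal⁻¹ * ENNReal.ofReal η)
        (𝓝[>] 0) (𝓝 0) := by
      have : Tendsto (fun η : ℝ => volume Ω ^ (2 : ℝ≥0∞).toReal⁻¹ * ENNReal.ofReal η)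
          (𝓝 0) (𝓝 (volume Ω ^ (2 : ℝ≥0∞).toReal⁻¹ * ENNReal.ofReal 0)) :=
        ENNReal.Tendsto.const_mul (ENNReal.continuous_ofReal.tendsto 0) (Or.inr hA)
      rw [ENNReal.ofReal_zero, mul_zero] at this
      exact this.mono_left nhdsWithin_le_nhds
    obtain ⟨η, h1, h2⟩ := ((h0.eventually (gt_mem_nhds (pos_iff_ne_zero.2 hε3))).and
      self_mem_nhdsWithin).exists
    exact ⟨η, h2, h1.le⟩
  obtain ⟨r, hr, hφu⟩ := Metric.uniformContinuous_iff.1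
    (hφc.uniformContinuous_of_continuous hφcont) η hη
  have h3 : ∀ᶠ k in atTop, δ k * d < r := by
    have : Tendsto (fun k => δ k * d) atTop (𝓝 0) := by simpa using hδ0.mul_const (d : ℝ)
    exact this.eventually (gt_mem_nhds hr)
  filter_upwards [h2, h3] with k hk2 hk3
  set c : (Fin d → ℤ) → ℝ := fun z => φ (gridCorner (δ k) z) with hc
  set G := innerSet (δ k) Ω with hGdef
  refine ⟨c, ?_⟩
  -- Three errors of size ε/3: f against the continuous φ on the inner cells, f itself near the
  -- boundary, and φ against its values at the cell corners.
  have hsplit : (fun x => f x - stepFun (δ k) Ω c x) =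
      (G.indicator (f - φ) + Gᶜ.indicator f) + G.indicator (φ - stepFun (δ k) Ω c) := by
    funext x
    simp only [Pi.add_apply]
    by_cases hx : x ∈ G
    · rw [indicator_of_mem hx, indicator_of_mem hx, indicator_of_notMem (by simpa using hx)]
      simp
    · rw [indicator_of_notMem hx, indicator_of_notMem hx, indicator_of_mem (by simpa using hx),
        stepFun, indicator_of_notMem hx]
      simp
  have hstepm : AEStronglyMeasurable (stepFun (δ k) Ω c) volume :=
    (measurable_stepFun _ _ _).aestronglyMeasurable
  have m1 : AEStronglyMeasurable (G.indicator (f - φ)) volume := (hf.1.sub hφm.1).indicator (hG k)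
  have m2 : AEStronglyMeasurable (Gᶜ.indicator f) volume := hf.1.indicator (hG k).compl
  have m3 : AEStronglyMeasurable (G.indicator (φ - stepFun (δ k) Ω c)) volume :=
    (hφm.1.sub hstepm).indicator (hG k)
  have b1 : eLpNorm (G.indicator (f - φ)) 2 volume ≤ ε / 3 :=
    (eLpNorm_indicator_le _).trans hφf
  have b3 : eLpNorm (G.indicator (φ - stepFun (δ k) Ω c)) 2 volume ≤ ε / 3 := by
    rw [eLpNorm_indicator_eq_eLpNorm_restrict (hG k)]
    have hb : ∀ᵐ x ∂(volume.restrict G), ‖(φ - stepFun (δ k) Ω c) x‖ ≤ η := by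
      filter_upwards [ae_restrict_mem (hG k)] with x hx
      rw [Pi.sub_apply, stepFun, indicator_of_mem hx, ← dist_eq_norm]
      refine (hφu ?_).le
      exact (dist_le_of_mem_closedCube (hδ k).le (mem_closedCube_cellIndex (hδ k) x)
        (gridCorner_mem_closedCube (hδ k) _)).trans_lt hk3
    refine (eLpNorm_le_of_ae_bound hb).trans (le_trans ?_ hηε)
    rw [Measure.restrict_apply_univ]
    gcongr
    exact innerSet_subset (hδ k) Ω
  rw [hsplit]
  calc _ ≤ eLpNorm (G.indicator (f - φ) + Gᶜ.indicator f) 2 volume +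
        eLpNorm (G.indicator (φ - stepFun (δ k) Ω c)) 2 volume :=
        eLpNorm_add_le (m1.add m2) m3 (by norm_num)
    _ ≤ (ε / 3 + ε / 3) + ε / 3 := by
        gcongr
        exact (eLpNorm_add_le m1 m2 (by norm_num)).trans (add_le_add b1 hk2)
    _ = ε := ENNReal.add_thirds ε

end Grid

/-! ### Lower bound at a fixed mesh. -/

section LowerBound
variable {d : ℕ}

theorem ofReal_integral_sq {h : Space d → ℝ} (hh : MemLp h 2 volume) :
    ENNReal.ofReal (∫ x, h x ^ 2) = eLpNorm h 2 volume ^ 2 := by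
  have := integral_norm_sq_eq_toReal_eLpNorm hh.1
  simp only [Real.norm_eq_abs, sq_abs] at this
  rw [this, ENNReal.ofReal_toReal (ENNReal.pow_ne_top hh.2.ne)]

theorem lintegral_ofReal_sq (h : Space d → ℝ) :
    ∫⁻ x, ENNReal.ofReal (h x ^ 2) = eLpNorm h 2 volume ^ 2 := by
  have := eLpNorm_nnreal_pow_eq_lintegral (f := h) (μ := volume) (p := 2) (by norm_num)
  simp only [NNReal.coe_ofNat, ENNReal.coe_ofNat, ENNReal.rpow_ofNat] at this
  rw [this]
  refine lintegral_congr fun x => ?_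
  rw [← sq_abs, ENNReal.ofReal_pow (abs_nonneg _), ← Real.norm_eq_abs, ofReal_norm]

/-- Poincaré bound for the rescaled energy with walls at distance `K n^{-1/d}`. -/
theorem scaled_dualEnergy_le_of_walls (i : Fin d) {U : Set (Space d)} {K : ℝ} (hK : 0 < K) {n : ℕ}
    (hn : 0 < n) (hU : ∀ x ∈ U, ∀ k : ℤ, x i ≠ k * radius d K n) {h : Space d → ℝ}
    (hh : MemLp h 2 volume) :
    ENNReal.ofReal ((n : ℝ) ^ ((2 : ℝ) / d)) * dualEnergy U h ≤
      ENNReal.ofReal (4 * K ^ 2) * eLpNorm h 2 volume ^ 2 := by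
  refine (mul_le_mul_right (dualEnergy_le_of_walls i (radius_pos hK hn) hU hh) _).trans
    (le_of_eq ?_)
  rw [ENNReal.ofReal_mul (by positivity), ofReal_integral_sq hh, ← mul_assoc,
    ← ENNReal.ofReal_mul (by positivity), ← rpow_one_div_sq, radius_eq_div]
  congr 2
  have : (0 : ℝ) < (n : ℝ) ^ ((1 : ℝ) / d) := by positivity
  field_simp

open Classical in
-- Only an inequality holds: centres outside `closure Ω` may be projected into C, whereas those
-- lying in C are fixed by p.
theorem card_filter_le_mul_empirical {Ω : Set (Space d)} (p : Space d → closure Ω)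
    (hp : ∀ y : closure Ω, p y = y) {n : ℕ} (x : Fin n → Space d) {C : Set (Space d)}
    (hC : MeasurableSet C) (hCΩ : C ⊆ closure Ω) :
    (((Finset.univ.filter fun i => x i ∈ C).card : ℕ) : ℝ≥0∞) ≤
      n * empirical p x (Subtype.val ⁻¹' C) := by
  have hB : MeasurableSet (Subtype.val ⁻¹' C : Set (closure Ω)) := measurable_subtype_coe hC
  rcases Nat.eq_zero_or_pos n with rfl | hn
  · simp
  have hn' : (n : ℝ≥0∞) ≠ 0 := by exact_mod_cast hn.ne'
  rw [empirical, Measure.smul_apply, smul_eq_mul, ← mul_assoc,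
    ENNReal.mul_inv_cancel hn' (by simp), one_mul, Measure.finsetSum_apply, Finset.card_filter]
  push_cast
  refine Finset.sum_le_sum fun i _ => ?_
  split_ifs with h
  · rw [Measure.dirac_apply' _ hB, indicator_of_mem]
    · simp
    · rw [mem_preimage, hp ⟨x i, hCΩ h⟩]
      exact h
  · exact zero_le

/-- The rescaled compliance of step functions bounds the step energy from above. -/
theorem lintegral_stepFun_le_liminf (hd : 0 < d) {Ω : Set (Space d)} (hΩ : IsOpen Ω)
    (hΩb : Bornology.IsBounded Ω) (p : Space d → closure Ω) (hp : ∀ y : closure Ω, p y = y)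
    {f : Space d → ℝ} (hf : MemLp f 2 volume) {α : ℝ} (hα : 0 < α)
    {μ : ProbabilityMeasure (closure Ω)} {y : ℕ → ProbabilityMeasure (closure Ω)}
    (hy : Tendsto y atTop (𝓝 μ)) {ε : ℝ} (hε : 0 < ε) (hε1 : ε < 1) {K : ℝ} (hK : 0 < K)
    {δ : ℝ} (hδ : 0 < δ)
    (hwall : ∀ᶠ n : ℕ in atTop, ∀ (a : Space d) (E : Set (Space d)),
      (∀ x ∈ E, ∀ j, x j ∈ Icc (a j) (a j + δ)) →
      ∃ T : Finset (Space d), (T : Set (Space d)) ⊆ E ∧ (T.card : ℝ) ≤ ε * δ ^ d * n ∧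
        ∀ x ∈ E, (∃ k : ℤ, x ⟨0, hd⟩ = k * radius d K n) →
          x ∈ closedBalls (T : Set (Space d)) (radius d α n))
    (c : (Fin d → ℤ) → ℝ) (hc : MemLp (stepFun δ Ω c) 2 volume) :
    ∫⁻ x, ENNReal.ofReal (stepFun δ Ω c x ^ 2) * (innerSet δ Ω).indicator (fun x =>
        cellDensity d α ((((μ : Measure (closure Ω)).map Subtype.val)
          (closedCube (gridCorner δ (cellIndex δ x)) δ)).toReal / δ ^ d + 2 * ε)) x ≤
      ENNReal.ofReal (1 - ε)⁻¹ * liminf (fun n => functionalSeq Ω p f α n (y n)) atTop +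
        ENNReal.ofReal (ε⁻¹ * (4 * K ^ 2)) *
          eLpNorm (fun x => f x - stepFun δ Ω c x) 2 volume ^ 2 := by
  classical
  set ν : Measure (Space d) := (μ : Measure (closure Ω)).map Subtype.val with hν
  have : IsFiniteMeasure ν := Measure.isFiniteMeasure_map _ _
  set Q : (Fin d → ℤ) → Set (Space d) := fun z => closedCube (gridCorner δ z) δ with hQ
  set ρ : (Fin d → ℤ) → ℝ := fun z => (ν (Q z)).toReal / δ ^ d with hρ
  have hρ0 : ∀ z, 0 ≤ ρ z := fun z => by positivity
  set J := (finite_innerIndices hδ hΩb).toFinset with hJ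
  have hJmem : ∀ z ∈ J, Q z ⊆ Ω := fun z hz => (Set.Finite.mem_toFinset _).1 hz
  set g := stepFun δ Ω c with hg
  set S : ℝ≥0∞ := ∑ z ∈ J, ENNReal.ofReal (c z ^ 2) *
    (ENNReal.ofReal (δ ^ d) * cellDensity d α (ρ z + 2 * ε)) with hS
  set A : ℝ≥0∞ := ENNReal.ofReal (1 - ε)⁻¹ with hA
  set B : ℝ≥0∞ := ENNReal.ofReal (ε⁻¹ * (4 * K ^ 2)) * eLpNorm (fun x => f x - g x) 2 volume ^ 2
    with hB
  have hint : ∫⁻ x, ENNReal.ofReal (g x ^ 2) * (innerSet δ Ω).indicator (fun x =>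
      cellDensity d α (ρ (cellIndex δ x) + 2 * ε)) x = S := by
    rw [hS]
    have e1 : ∀ x, ENNReal.ofReal (g x ^ 2) * (innerSet δ Ω).indicator (fun x =>
        cellDensity d α (ρ (cellIndex δ x) + 2 * ε)) x = (innerSet δ Ω).indicator (fun x =>
        ENNReal.ofReal (c (cellIndex δ x) ^ 2) *
          cellDensity d α (ρ (cellIndex δ x) + 2 * ε)) x := by
      intro x
      by_cases hx : x ∈ innerSet δ Ω
      · rw [indicator_of_mem hx, indicator_of_mem hx, hg, stepFun, indicator_of_mem hx]
      · rw [indicator_of_notMem hx, indicator_of_notMem hx, mul_zero]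
    simp only [e1]
    rw [lintegral_innerSet_indicator hδ hΩb fun z => ENNReal.ofReal (c z ^ 2) *
      cellDensity d α (ρ z + 2 * ε)]
    refine Finset.sum_congr rfl fun z _ => ?_
    ring
  change ∫⁻ x, ENNReal.ofReal (g x ^ 2) * (innerSet δ Ω).indicator (fun x =>
      cellDensity d α (ρ (cellIndex δ x) + 2 * ε)) x ≤ _
  rw [hint]
  -- C is a small closed thickening of the cell inside Ω. It eventually contains every centre whose
  -- ball meets the open cube, and weak* convergence bounds its limiting mass from above because it
  -- is closed.
  have hcount : ∀ z ∈ J, ∃ C : Set (Space d), IsClosed C ∧ C ⊆ Ω ∧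
      (∀ᶠ n : ℕ in atTop, ∀ a, (∃ b ∈ cube (gridCorner δ z) δ, dist b a ≤ radius d α n) → a ∈ C) ∧
      ∀ᶠ n in atTop, (y n : Measure (closure Ω)) (Subtype.val ⁻¹' C) ≤
        ENNReal.ofReal ((ρ z + ε) * δ ^ d) := by
    intro z hz
    have hQc : IsCompact (Q z) := Metric.isCompact_of_isClosed_isBounded
      (isClosed_closedCube _ _) (isBounded_closedCube _ _)
    obtain ⟨η₀, hη₀, hη₀Ω⟩ := hQc.exists_cthickening_subset_open hΩ (hJmem z hz)
    have hlt : ν (Q z) < ENNReal.ofReal ((ρ z + ε) * δ ^ d) := by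
      rw [← ENNReal.ofReal_toReal (measure_ne_top ν (Q z))]
      refine (ENNReal.ofReal_lt_ofReal_iff (by have := hρ0 z; positivity)).2 ?_
      have : (ν (Q z)).toReal = ρ z * δ ^ d := by
        simp only [hρ]; field_simp
      rw [this]
      gcongr
      linarith
    have htend := tendsto_measure_cthickening_of_isCompact (μ := ν) hQc
    have h1 : ∀ᶠ η in 𝓝[>] (0 : ℝ), ν (Metric.cthickening η (Q z)) <
        ENNReal.ofReal ((ρ z + ε) * δ ^ d) :=
      (htend.eventually (gt_mem_nhds hlt)).filter_mono nhdsWithin_le_nhds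
    obtain ⟨η, hη1, hη0, hηη⟩ := (h1.and (Ioo_mem_nhdsGT hη₀)).exists
    refine ⟨Metric.cthickening η (Q z), Metric.isClosed_cthickening,
      (Metric.cthickening_mono hηη.le _).trans hη₀Ω, ?_, ?_⟩
    · filter_upwards [(tendsto_radius hd α).eventually (gt_mem_nhds hη0)] with n hn a
      rintro ⟨b, hb, hba⟩
      refine Metric.mem_cthickening_of_dist_le a b η _ (cube_subset_closedCube _ _ hb) ?_
      rw [dist_comm]; exact hba.trans hn.le
    · have hcl : IsClosed (Subtype.val ⁻¹' Metric.cthickening η (Q z) : Set (closure Ω)) :=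
        Metric.isClosed_cthickening.preimage continuous_subtype_val
      have h2 := ProbabilityMeasure.limsup_measure_closed_le_of_tendsto hy hcl
      have h3 : (μ : Measure (closure Ω)) (Subtype.val ⁻¹' Metric.cthickening η (Q z)) =
          ν (Metric.cthickening η (Q z)) := by
        rw [hν, Measure.map_apply measurable_subtype_coe Metric.isClosed_cthickening.measurableSet]
      exact (eventually_lt_of_limsup_lt (h2.trans_lt (h3 ▸ hη1))).mono fun _ h => h.le
  choose! C hCcl hCΩ hCnear hCμ using hcount
  -- `eventually_le_dualEnergy_cube` needs a value strictly below its limit, hence the factor s < 1,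
  -- removed at the end by s → 1.
  have key : ∀ s : ℝ, 0 < s → s < 1 → ENNReal.ofReal s * S ≤
      A * liminf (fun n => functionalSeq Ω p f α n (y n)) atTop + B := by
    intro s hs0 hs1
    have hA0 : A ≠ 0 := by
      rw [hA]; simp only [ne_eq, ENNReal.ofReal_eq_zero, not_le]
      exact inv_pos.2 (by linarith)
    have hAt : A ≠ ⊤ := ENNReal.ofReal_ne_top
    have hb : ∀ z ∈ J, ∀ᶠ n : ℕ in atTop, ∀ (a : Space d) (T : Finset (Space d)),
        (T.card : ℝ) ≤ (ρ z + 2 * ε) * δ ^ d * n →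
        ENNReal.ofReal s * (ENNReal.ofReal (δ ^ d) * cellDensity d α (ρ z + 2 * ε)) ≤
          ENNReal.ofReal ((n : ℝ) ^ ((2 : ℝ) / d)) *
            dualEnergy (cube a δ \ closedBalls (T : Set (Space d)) (radius d α n))
              (fun _ => 1) := by
      intro z _
      have hpos : 0 < ρ z + 2 * ε := by have := hρ0 z; positivity
      rcases eq_or_ne (ENNReal.ofReal (δ ^ d) * cellDensity d α (ρ z + 2 * ε)) 0 with h0 | h0
      · rw [h0, mul_zero]
        exact Eventually.of_forall fun _ _ _ _ => zero_le
      · refine eventually_le_dualEnergy_cube hd hα hδ hpos ?_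
        have hfin : ENNReal.ofReal (δ ^ d) * cellDensity d α (ρ z + 2 * ε) ≠ ⊤ :=
          ENNReal.mul_ne_top ENNReal.ofReal_ne_top (cellDensity_lt_top hd hα hpos).ne
        calc _ < 1 * (ENNReal.ofReal (δ ^ d) * cellDensity d α (ρ z + 2 * ε)) :=
              (ENNReal.mul_lt_mul_iff_left h0 hfin).2 (by
                rw [← ENNReal.ofReal_one]
                exact (ENNReal.ofReal_lt_ofReal_iff one_pos).2 hs1)
          _ = _ := one_mul _
    have hmain : ∀ᶠ n : ℕ in atTop, (ENNReal.ofReal s * S - B) / A ≤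
        functionalSeq Ω p f α n (y n) := by
      filter_upwards [hwall, eventually_gt_atTop 0, (Filter.eventually_all_finset J).2 hb,
        (Filter.eventually_all_finset J).2 hCnear, (Filter.eventually_all_finset J).2 hCμ]
        with n hW hn hbn hnear hμn
      refine le_iInf fun x => le_iInf fun _ => le_iInf fun hxe => ?_
      rw [ENNReal.div_le_iff hA0 hAt, tsub_le_iff_right, mul_comm _ A,
        scaledCompliance_eq hd hΩb hΩ (hf.mono_measure Measure.restrict_le_self)]
      set r := radius d α n with hr
      set X : Finset (Space d) := Finset.univ.image x with hX
      have hXr : (X : Set (Space d)) = range x := by simp [hX]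
      choose W hWE hWcard hW using fun z : Fin d → ℤ => hW (gridCorner δ z)
        (cube (gridCorner δ z) δ) (fun x hx j => Ioo_subset_Icc_self (hx j))
      -- Only balls meeting the cube matter inside it. The wall balls added for the Poincaré bound
      -- account for the second ε in ρ + 2ε.
      set T : (Fin d → ℤ) → Finset (Space d) := fun z =>
        X.filter (fun a => ∃ b ∈ cube (gridCorner δ z) δ, dist b a ≤ r) ∪ W z with hT
      set U : (Fin d → ℤ) → Set (Space d) := fun z =>
        cube (gridCorner δ z) δ \ closedBalls (T z : Set (Space d)) r with hU
      have hTcard : ∀ z ∈ J, ((T z).card : ℝ) ≤ (ρ z + 2 * ε) * δ ^ d * n := by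
        intro z hz
        have h1 : (X.filter (fun a => ∃ b ∈ cube (gridCorner δ z) δ, dist b a ≤ r)).card ≤
            (Finset.univ.filter fun i => x i ∈ C z).card := by
          refine (Finset.card_le_card (t := (Finset.univ.filter fun i => x i ∈ C z).image x)
            fun a ha => ?_).trans Finset.card_image_le
          obtain ⟨haX, hab⟩ := Finset.mem_filter.1 ha
          obtain ⟨i, -, rfl⟩ := Finset.mem_image.1 haX
          exact Finset.mem_image_of_mem _ (Finset.mem_filter.2
            ⟨Finset.mem_univ _, hnear z hz _ hab⟩)
        have h2 := card_filter_le_mul_empirical p hp x (hCcl z hz).measurableSet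
          ((hCΩ z hz).trans subset_closure)
        rw [← hxe] at h2
        have h3 := h2.trans (mul_le_mul_right (hμn z hz) (n : ℝ≥0∞))
        have h4 : ((Finset.univ.filter fun i => x i ∈ C z).card : ℝ) ≤ n * ((ρ z + ε) * δ ^ d) := by
          rw [← ENNReal.ofReal_natCast, ← ENNReal.ofReal_natCast,
            ← ENNReal.ofReal_mul (by positivity)] at h3
          exact (ENNReal.ofReal_le_ofReal_iff (by have := hρ0 z; positivity)).1 h3
        have h5 : ((T z).card : ℝ) ≤ (Finset.univ.filter fun i => x i ∈ C z).card + (W z).card := by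
          exact_mod_cast (Finset.card_union_le _ _).trans (Nat.add_le_add_right h1 _)
        calc ((T z).card : ℝ) ≤ n * ((ρ z + ε) * δ ^ d) + ε * δ ^ d * n :=
              h5.trans (add_le_add h4 (hWcard z))
          _ = _ := by ring
      -- V omits the cube faces and the wall balls, so its energy is below that of the actual
      -- domain; it also splits over the cubes and satisfies the Poincaré bound.
      set V : Set (Space d) := ⋃ z ∈ J, U z with hV
      have hVΩ : V ⊆ Ω \ closedBalls (range x) r := by
        refine iUnion₂_subset fun z hz => ?_
        rintro b ⟨hb, hbT⟩
        refine ⟨hJmem z hz (cube_subset_closedCube _ _ hb), fun hbX => hbT ?_⟩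
        rw [← hXr] at hbX
        obtain ⟨a, ha, hba⟩ := mem_closedBalls.1 hbX
        exact mem_closedBalls.2 ⟨a, Finset.mem_coe.2 (Finset.mem_union_left _
          (Finset.mem_filter.2 ⟨ha, b, hb, hba⟩)), hba⟩
      have hVwall : ∀ b ∈ V, ∀ k : ℤ, b ⟨0, hd⟩ ≠ k * radius d K n := by
        intro b hb k hk
        obtain ⟨z, hz, hbc, hbT⟩ := mem_iUnion₂.1 hb
        exact hbT (closedBalls_mono (by
          intro a ha
          exact Finset.mem_coe.2 (Finset.mem_union_right _ ha)) le_rfl (hW z b hbc ⟨k, hk⟩))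
      have hVg : dualEnergy V g = ∑ z ∈ J, ENNReal.ofReal (c z ^ 2) *
          dualEnergy (U z) (fun _ => 1) := by
        rw [hV, dualEnergy_biUnion]
        · refine Finset.sum_congr rfl fun z hz => ?_
          rw [← dualEnergy_const_mul]
          refine dualEnergy_congr (ae_of_all _ fun b hb => ?_)
          rw [hg, stepFun_of_mem_cube hδ (hJmem z hz) hb.1, mul_one]
        · exact fun z _ => (isOpen_cube _ _).sdiff (isClosed_closedBalls _ _)
        · intro z _ z' _ hzz
          refine disjoint_left.2 fun b hb hb' => hzz ?_
          rw [← mem_gridCell.1 (cube_subset_gridCell hδ z hb.1),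
            mem_gridCell.1 (cube_subset_gridCell hδ z' hb'.1)]
        · exact hc.mono_measure Measure.restrict_le_self
      have hS1 : ENNReal.ofReal s * S ≤
          ENNReal.ofReal ((n : ℝ) ^ ((2 : ℝ) / d)) * dualEnergy V g := by
        rw [hVg, hS, Finset.mul_sum, Finset.mul_sum]
        refine Finset.sum_le_sum fun z hz => ?_
        rw [mul_left_comm, mul_left_comm (ENNReal.ofReal ((n : ℝ) ^ ((2 : ℝ) / d)))]
        exact mul_le_mul_right (hbn z hz (gridCorner δ z) (T z) (hTcard z hz)) _
      have hS2 := dualEnergy_le_add hε hε1 (U := V) (h := g) (w := f)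
        (hc.mono_measure Measure.restrict_le_self) (hf.mono_measure Measure.restrict_le_self)
      have hS3 := scaled_dualEnergy_le_of_walls ⟨0, hd⟩ hK hn hVwall (hc.sub hf)
      have hS4 : eLpNorm (g - f) 2 volume = eLpNorm (fun x => f x - g x) 2 volume :=
        eLpNorm_sub_comm g f 2 volume
      refine hS1.trans ((mul_le_mul_right hS2 _).trans ?_)
      rw [mul_add, mul_left_comm, mul_left_comm _ (ENNReal.ofReal ε⁻¹)]
      refine add_le_add (mul_le_mul_right (mul_le_mul_right (dualEnergy_mono hVΩ) _) _) ?_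
      rw [hB, ENNReal.ofReal_mul (by positivity), mul_assoc, ← hS4]
      exact mul_le_mul_right hS3 _
    have h1 := le_liminf_of_le (by isBoundedDefault) hmain
    rw [ENNReal.div_le_iff hA0 hAt, tsub_le_iff_right, mul_comm _ A] at h1
    exact h1
  have hlim : Tendsto (fun s : ℝ => ENNReal.ofReal s * S) (𝓝[<] 1) (𝓝 (ENNReal.ofReal 1 * S)) :=
    ENNReal.Tendsto.mul_const
      ((ENNReal.continuous_ofReal.tendsto 1).mono_left nhdsWithin_le_nhds) (Or.inl (by simp))
  rw [ENNReal.ofReal_one, one_mul] at hlim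
  refine le_of_tendsto hlim ?_
  filter_upwards [Ioo_mem_nhdsLT (zero_lt_one' ℝ)] with s hs
  exact key s hs.1 hs.2

end LowerBound

/-! ### Lower bound as the mesh and the regularisation vanish. -/

section LowerLimit
variable {d : ℕ}

/-- The density `a^{-2/d} θ⁻(α a^{1/d})` of the limit functional. -/
def limitDensity (d : ℕ) (α : ℝ) (a : ℝ≥0∞) : ℝ≥0∞ :=
  (a ^ ((2 : ℝ) / d))⁻¹ * thetaMinus d (α * a.toReal ^ ((1 : ℝ) / d))

theorem limitFunctional_eq (Ω : Set (Space d)) (f : Space d → ℝ) (α : ℝ)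
    (μ : ProbabilityMeasure (closure Ω)) : limitFunctional Ω f α μ =
      ∫⁻ x in Ω, ENNReal.ofReal (f x ^ 2) * limitDensity d α (acDensity μ x) := by
  unfold limitFunctional limitDensity
  simp only [div_eq_mul_inv, mul_assoc]

theorem ofReal_inv_sq_rpow {t : ℝ} (ht : 0 < t) :
    ENNReal.ofReal ((t ^ ((1 : ℝ) / d)) ^ 2)⁻¹ = (ENNReal.ofReal t ^ ((2 : ℝ) / d))⁻¹ := by
  rw [ENNReal.ofReal_inv_of_pos (by positivity), ENNReal.ofReal_rpow_of_pos ht,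
    ← Real.rpow_natCast, ← Real.rpow_mul ht.le]
  congr 3
  push_cast
  ring

theorem theta_le_thetaMinus {α β : ℝ} (h : α < β) : theta d β ≤ thetaMinus d α :=
  le_iSup₂_of_le β h le_rfl

/-- Strictness is essential: θ⁻ is a supremum over strictly larger arguments, and θ(α ρ^(1/d)) is
then one of its terms. -/
theorem cellDensity_le_limitDensity (hd : 0 < d) {α ρ : ℝ} (hα : 0 < α) {a : ℝ≥0∞}
    (hρ : 0 < ρ) (ha : a < ENNReal.ofReal ρ) : cellDensity d α ρ ≤ limitDensity d α a := by
  have haT : a ≠ ⊤ := ne_top_of_lt ha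
  have hd' : (0 : ℝ) < d := by exact_mod_cast hd
  have h1 : a.toReal < ρ := by
    rw [← ENNReal.ofReal_lt_ofReal_iff hρ, ENNReal.ofReal_toReal haT]; exact ha
  unfold cellDensity limitDensity
  rw [ofReal_inv_sq_rpow hρ]
  refine mul_le_mul' ?_ (theta_le_thetaMinus ?_)
  · gcongr
  · gcongr

/-- Here θ⁻ enters the lower bound: each β above the limiting argument eventually exceeds the
perturbed one, and θ is nonincreasing. -/
theorem limitDensity_le_liminf (hd : 0 < d) {α : ℝ} (hα : 0 < α) {a : ℝ≥0∞} (ha : a ≠ ⊤)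
    {ε : ℕ → ℝ} (hε : ∀ j, 0 < ε j) (hε0 : Tendsto ε atTop (𝓝 0)) :
    limitDensity d α a ≤ liminf (fun j => cellDensity d α (a.toReal + ε j)) atTop := by
  have hd' : (0 : ℝ) < d := by exact_mod_cast hd
  have hpos : ∀ j, 0 < a.toReal + ε j := fun j => add_pos_of_nonneg_of_pos (by simp) (hε j)
  have hlim : Tendsto (fun j => a.toReal + ε j) atTop (𝓝 a.toReal) := by
    simpa using hε0.const_add a.toReal
  refine le_trans (mul_le_mul' ?_ ?_) ENNReal.le_liminf_mul
  · have h1 : Tendsto (fun j => ENNReal.ofReal (((a.toReal + ε j) ^ ((1 : ℝ) / d)) ^ 2)⁻¹) atTop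
        (𝓝 (a ^ ((2 : ℝ) / d))⁻¹) := by
      simp only [fun j => ofReal_inv_sq_rpow (d := d) (hpos j)]
      have h2 := (ENNReal.continuous_ofReal.tendsto _).comp hlim
      rw [ENNReal.ofReal_toReal ha] at h2
      exact (((ENNReal.continuous_rpow_const (y := (2 : ℝ) / d)).tendsto a).comp h2).inv
    exact h1.liminf_eq.ge
  · refine iSup₂_le fun β hβ => ?_
    have h2 : Tendsto (fun j => α * (a.toReal + ε j) ^ ((1 : ℝ) / d)) atTop
        (𝓝 (α * a.toReal ^ ((1 : ℝ) / d))) :=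
      (hlim.rpow_const (Or.inr (by positivity))).const_mul α
    refine le_liminf_of_le (by isBoundedDefault) ?_
    filter_upwards [h2.eventually (gt_mem_nhds hβ)] with j hj
    have := hpos j
    exact theta_antitone hd (by positivity) hj.le

/-- Young's inequality f² ≤ (1 + ε)g² + (1 + ε⁻¹)(f - g)², under a bounded weight. It passes between
f and its step approximation in both directions. -/
theorem lintegral_sq_mul_le {f g : Space d → ℝ} (hf : Measurable f) (hg : Measurable g)
    {H : Space d → ℝ≥0∞} {C : ℝ≥0∞} (hH : ∀ x, H x ≤ C) {ε : ℝ} (hε : 0 < ε) :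
    ∫⁻ x, ENNReal.ofReal (f x ^ 2) * H x ≤
      ENNReal.ofReal (1 + ε) * (∫⁻ x, ENNReal.ofReal (g x ^ 2) * H x) +
        ENNReal.ofReal (1 + ε⁻¹) * C * eLpNorm (fun x => f x - g x) 2 volume ^ 2 := by
  have hm : Measurable fun x => ENNReal.ofReal ((f x - g x) ^ 2) :=
    ((hf.sub hg).pow_const 2).ennreal_ofReal
  rw [← lintegral_ofReal_sq, mul_assoc, ← lintegral_const_mul' _ _ ENNReal.ofReal_ne_top,
    ← lintegral_const_mul C hm, ← lintegral_const_mul _ (hm.const_mul C),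
    ← lintegral_add_right _ ((hm.const_mul C).const_mul _)]
  refine lintegral_mono fun x => ?_
  have h1 : f x ^ 2 ≤ (1 + ε) * g x ^ 2 + (1 + ε⁻¹) * (f x - g x) ^ 2 := by
    have h2 : (1 + ε) * g x ^ 2 + (1 + ε⁻¹) * (f x - g x) ^ 2 - f x ^ 2 =
        ε⁻¹ * (ε * g x - (f x - g x)) ^ 2 := by
      field_simp; ring
    have : 0 ≤ ε⁻¹ * (ε * g x - (f x - g x)) ^ 2 := by positivity
    linarith
  calc ENNReal.ofReal (f x ^ 2) * H x
      ≤ (ENNReal.ofReal (1 + ε) * ENNReal.ofReal (g x ^ 2) +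
          ENNReal.ofReal (1 + ε⁻¹) * ENNReal.ofReal ((f x - g x) ^ 2)) * H x := by
        rw [← ENNReal.ofReal_mul (by positivity), ← ENNReal.ofReal_mul (by positivity),
          ← ENNReal.ofReal_add (by positivity) (by positivity)]
        exact mul_le_mul_left (ENNReal.ofReal_le_ofReal h1) _
    _ ≤ _ := by
        rw [add_mul, mul_assoc, mul_assoc, mul_comm C]
        exact add_le_add le_rfl (mul_le_mul_right (mul_le_mul_right (hH x) _) _)

theorem exists_grid_sequence : ∃ δ : ℕ → ℝ, (∀ k, 0 < δ k) ∧ Tendsto δ atTop (𝓝 0) :=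
  ⟨fun k => (1 / 2) ^ k, fun k => by positivity,
    tendsto_pow_atTop_nhds_zero_of_lt_one (by norm_num) (by norm_num)⟩

theorem memLp_of_eLpNorm_sub_le {f g : Space d → ℝ} (hf : MemLp f 2 volume) (hg : Measurable g)
    {e : ℝ≥0∞} (he : e ≠ ⊤) (h : eLpNorm (fun x => f x - g x) 2 volume ≤ e) :
    MemLp g 2 volume := by
  have h1 : MemLp (fun x => f x - g x) 2 volume :=
    ⟨hf.1.sub hg.aestronglyMeasurable, h.trans_lt he.lt_top⟩
  have := hf.sub h1
  refine this.ae_eq (ae_of_all _ fun x => ?_)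
  simp

/-- Here j⁻¹ plays the role of the L² error of a step approximation, while D gathers constants fixed
before j. -/
theorem tendsto_affine_sq_zero {D : ℝ≥0∞} (hD : D ≠ ⊤) (M : ℝ≥0∞) :
    Tendsto (fun j : ℕ => M + D * ((j : ℝ≥0∞)⁻¹) ^ 2) atTop (𝓝 M) := by
  have h1 : Tendsto (fun j : ℕ => ((j : ℝ≥0∞)⁻¹) ^ 2) atTop (𝓝 (0 ^ 2)) :=
    ((ENNReal.continuous_pow 2).tendsto 0).comp ENNReal.tendsto_inv_nat_nhds_zero
  have h2 := (ENNReal.Tendsto.const_mul h1 (Or.inr hD)).const_add M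
  simpa using h2

/-- Lower bound with the regularised density `μ_a + 3ε`. -/
theorem lintegral_cellDensity_le_liminf (hd : 0 < d) {Ω : Set (Space d)} (hΩ : IsOpen Ω)
    (hΩb : Bornology.IsBounded Ω) (p : Space d → closure Ω) (hp : ∀ y : closure Ω, p y = y)
    {f : Space d → ℝ} (hfm : Measurable f) (hf : MemLp f 2 volume) (hf0 : ∀ x, x ∉ Ω → f x = 0)
    {α : ℝ} (hα : 0 < α) {μ : ProbabilityMeasure (closure Ω)}
    {y : ℕ → ProbabilityMeasure (closure Ω)}
    (hy : Tendsto y atTop (𝓝 μ)) {ε : ℝ} (hε : 0 < ε) (hε1 : ε < 1) :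
    ∫⁻ x in Ω, ENNReal.ofReal (f x ^ 2) * cellDensity d α ((acDensity μ x).toReal + 3 * ε) ≤
      ENNReal.ofReal (1 + ε) * (ENNReal.ofReal (1 - ε)⁻¹ *
        liminf (fun n => functionalSeq Ω p f α n (y n)) atTop) := by
  set ν : Measure (Space d) := (μ : Measure (closure Ω)).map Subtype.val with hν
  have : IsFiniteMeasure ν := Measure.isFiniteMeasure_map _ _
  obtain ⟨δ, hδ, hδ0⟩ := exists_grid_sequence
  obtain ⟨K, hK, hwall⟩ := exists_walls ⟨0, hd⟩ hα hε
  set L := liminf (fun n => functionalSeq Ω p f α n (y n)) atTop with hL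
  set H : ℕ → Space d → ℝ≥0∞ := fun k => (innerSet (δ k) Ω).indicator (fun x =>
    cellDensity d α ((ν (closedCube (gridCorner (δ k) (cellIndex (δ k) x)) (δ k))).toReal /
      δ k ^ d + 2 * ε)) with hH
  set C := cellDensity d α (2 * ε) with hC
  have hCt : C ≠ ⊤ := (cellDensity_lt_top hd hα (by positivity)).ne
  have hHC : ∀ k x, H k x ≤ C := by
    intro k x
    refine (indicator_le_self' (fun _ _ => zero_le) x).trans
      (cellDensity_antitone hd hα (by positivity) ?_)
    have := hδ k
    have : 0 ≤ (ν (closedCube (gridCorner (δ k) (cellIndex (δ k) x)) (δ k))).toReal / δ k ^ d := by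
      positivity
    linarith
  have hHm : ∀ k, Measurable (H k) := by
    intro k
    refine Measurable.indicator ?_ (measurableSet_innerSet _ _)
    exact (measurable_of_countable fun z : Fin d → ℤ => cellDensity d α
      ((ν (closedCube (gridCorner (δ k) z) (δ k))).toReal / δ k ^ d + 2 * ε)).comp
      (measurable_cellIndex (δ k))
  set D : ℝ≥0∞ := ENNReal.ofReal (1 + ε) * ENNReal.ofReal (ε⁻¹ * (4 * K ^ 2)) +
    ENNReal.ofReal (1 + ε⁻¹) * C with hD
  have hDt : D ≠ ⊤ := by
    refine ENNReal.add_ne_top.2 ⟨ENNReal.mul_ne_top ENNReal.ofReal_ne_top ENNReal.ofReal_ne_top,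
      ENNReal.mul_ne_top ENNReal.ofReal_ne_top hCt⟩
  set M := ENNReal.ofReal (1 + ε) * (ENNReal.ofReal (1 - ε)⁻¹ * L) with hM
  have hstep : liminf (fun k => ∫⁻ x, ENNReal.ofReal (f x ^ 2) * H k x) atTop ≤ M := by
    refine ge_of_tendsto' (tendsto_affine_sq_zero hDt M) fun j => ?_
    have hj : ((j : ℝ≥0∞)⁻¹) ≠ 0 := ENNReal.inv_ne_zero.2 (ENNReal.natCast_ne_top j)
    -- At j = 0 the inverse is ⊤ and the bound is trivial, unless D = 0; then C = 0 and H vanishes.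
    rcases Nat.eq_zero_or_pos j with rfl | hj0
    · by_cases hD0 : D = 0
      · have : ENNReal.ofReal (1 + ε⁻¹) * C = 0 := by
          rw [hD] at hD0; exact (add_eq_zero.1 hD0).2
        have hC0 : C = 0 := by
          rcases mul_eq_zero.1 this with h | h
          · exact absurd (ENNReal.ofReal_eq_zero.1 h) (not_le.2 (by positivity))
          · exact h
        have h0 : ∀ k x, H k x = 0 := fun k x => le_antisymm ((hHC k x).trans hC0.le) zero_le
        simp [h0]
      · simp [ENNReal.mul_top hD0]
    have hjt : ((j : ℝ≥0∞)⁻¹) ≠ ⊤ := ENNReal.inv_ne_top.2 (by exact_mod_cast hj0.ne')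
    refine liminf_le_of_frequently_le' (Eventually.frequently ?_)
    filter_upwards [eventually_exists_stepFun hΩ hΩb hf hf0 hj hδ hδ0] with k hk
    obtain ⟨c, hc⟩ := hk
    have hgm := measurable_stepFun (δ k) Ω c
    have hgL := memLp_of_eLpNorm_sub_le hf hgm hjt hc
    have h1 := lintegral_stepFun_le_liminf hd hΩ hΩb p hp hf hα hy hε hε1 hK (hδ k)
      (hwall (δ k) (hδ k)) c hgL
    refine (lintegral_sq_mul_le hfm hgm (hHC k) hε).trans ?_
    refine (add_le_add (mul_le_mul_right h1 _) le_rfl).trans ?_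
    rw [mul_add, ← hL, ← hM, hD, add_assoc, ← mul_assoc, ← add_mul]
    exact add_le_add le_rfl (mul_le_mul_right (pow_le_pow_left' hc 2) _)
  refine le_trans ?_ hstep
  -- Fatou as the mesh vanishes. Cell averages of the measure tend a.e. to the density μ_a, so they
  -- are eventually at most μ_a + ε, which explains 3ε in place of 2ε.
  refine le_trans ?_ (lintegral_liminf_le' fun k =>
    ((hfm.pow_const 2).ennreal_ofReal.mul (hHm k)).aemeasurable)
  rw [← lintegral_indicator hΩ.measurableSet]
  refine lintegral_mono_ae ?_
  filter_upwards [ae_tendsto_measure_closedCube ν hδ hδ0, Measure.rnDeriv_lt_top ν volume]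
    with x hx hxt
  by_cases hxΩ : x ∈ Ω
  · rw [indicator_of_mem hxΩ]
    refine le_liminf_of_le (by isBoundedDefault) ?_
    have h2 := (ENNReal.tendsto_toReal hxt.ne).comp hx
    have h3 : Tendsto δ atTop (𝓝[>] 0) := tendsto_nhdsWithin_iff.2 ⟨hδ0, Eventually.of_forall hδ⟩
    filter_upwards [h2.eventually (gt_mem_nhds (lt_add_of_pos_right _ hε)),
      h3.eventually (exists_closedCube_subset hΩ hxΩ)] with k hk hkx
    simp only [hH]
    rw [indicator_of_mem hkx]
    refine mul_le_mul_right (cellDensity_antitone hd hα ?_ ?_) _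
    · have := hδ k
      positivity
    · simp only [Function.comp_apply, ENNReal.toReal_div,
        ENNReal.toReal_ofReal (pow_nonneg (hδ k).le d)] at hk
      change _ ≤ (ν.rnDeriv volume x).toReal + 3 * ε
      linarith
  · rw [indicator_of_notMem hxΩ]
    exact zero_le

/-- A second use of Fatou, now in ε, removes the regularisation of the density. -/
theorem limitFunctional_le_liminf (hd : 0 < d) {Ω : Set (Space d)} (hΩ : IsOpen Ω)
    (hΩb : Bornology.IsBounded Ω) (p : Space d → closure Ω) (hp : ∀ y : closure Ω, p y = y)
    {f : Space d → ℝ} (hfm : Measurable f) (hf : MemLp f 2 volume) (hf0 : ∀ x, x ∉ Ω → f x = 0)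
    {α : ℝ} (hα : 0 < α) {μ : ProbabilityMeasure (closure Ω)}
    {y : ℕ → ProbabilityMeasure (closure Ω)} (hy : Tendsto y atTop (𝓝 μ)) :
    limitFunctional Ω f α μ ≤ liminf (fun n => functionalSeq Ω p f α n (y n)) atTop := by
  set L := liminf (fun n => functionalSeq Ω p f α n (y n)) atTop with hL
  rw [limitFunctional_eq]
  have : IsFiniteMeasure ((μ : Measure (closure Ω)).map Subtype.val) :=
    Measure.isFiniteMeasure_map _ _
  set ε : ℕ → ℝ := fun j => 1 / ((j : ℝ) + 2) with hε
  have hε0 : ∀ j, 0 < ε j := fun j => by positivity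
  have hε1 : ∀ j, ε j < 1 := fun j => by
    simp only [hε]; rw [div_lt_one (by positivity)]
    have : (0 : ℝ) ≤ j := by positivity
    linarith
  have hεt : Tendsto ε atTop (𝓝 0) := by
    have := (tendsto_one_div_add_atTop_nhds_zero_nat (𝕜 := ℝ)).comp (tendsto_add_atTop_nat 1)
    refine this.congr fun j => ?_
    simp only [Function.comp_apply, hε]; push_cast; ring_nf
  have hlim : Tendsto (fun j => ENNReal.ofReal (1 + ε j) * (ENNReal.ofReal (1 - ε j)⁻¹ * L)) atTop
      (𝓝 L) := by
    have h1 : Tendsto (fun j => ENNReal.ofReal (1 + ε j) * ENNReal.ofReal (1 - ε j)⁻¹) atTop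
        (𝓝 1) := by
      have h2 : Tendsto (fun j => (1 + ε j) * (1 - ε j)⁻¹) atTop (𝓝 ((1 + 0) * (1 - 0)⁻¹)) :=
        (hεt.const_add 1).mul ((hεt.const_sub 1).inv₀ (by norm_num))
      have h3 := (ENNReal.continuous_ofReal.tendsto _).comp h2
      simp only [add_zero, sub_zero, inv_one, mul_one, ENNReal.ofReal_one] at h3
      refine h3.congr fun j => ?_
      have := hε0 j
      rw [Function.comp_apply, ENNReal.ofReal_mul (by positivity)]
    have h4 := ENNReal.Tendsto.mul_const (b := L) h1 (Or.inl one_ne_zero)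
    simpa only [one_mul, mul_assoc] using h4
  rw [← hlim.liminf_eq]
  have ham : Measurable (acDensity μ) := Measure.measurable_rnDeriv _ _
  have hcm : ∀ e : ℝ, 0 < e → Measurable fun x =>
      cellDensity d α ((acDensity μ x).toReal + 3 * e) := by
    intro e he
    have h1 : Antitone fun ρ : ℝ => cellDensity d α (max ρ 0 + 3 * e) := fun ρ ρ' h =>
      cellDensity_antitone hd hα (by positivity) (by gcongr)
    have h2 := h1.measurable.comp ham.ennreal_toReal
    have h3 : (fun ρ : ℝ => cellDensity d α (max ρ 0 + 3 * e)) ∘ (fun x => (acDensity μ x).toReal) =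
        fun x => cellDensity d α ((acDensity μ x).toReal + 3 * e) := by
      funext x
      simp
    rwa [← h3]
  calc ∫⁻ x in Ω, ENNReal.ofReal (f x ^ 2) * limitDensity d α (acDensity μ x)
      ≤ ∫⁻ x in Ω, liminf (fun j => ENNReal.ofReal (f x ^ 2) *
          cellDensity d α ((acDensity μ x).toReal + 3 * ε j)) atTop := by
        refine lintegral_mono_ae (ae_restrict_of_ae ?_)
        filter_upwards [Measure.rnDeriv_lt_top ((μ : Measure (closure Ω)).map Subtype.val) volume]
          with x hx
        refine (mul_le_mul_right (limitDensity_le_liminf hd hα hx.ne (ε := fun j => 3 * ε j)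
          (fun j => by have := hε0 j; positivity) (by simpa using hεt.const_mul 3)) _).trans ?_
        have := ENNReal.le_liminf_mul (f := atTop) (u := fun _ : ℕ => ENNReal.ofReal (f x ^ 2))
          (v := fun j => cellDensity d α ((acDensity μ x).toReal + 3 * ε j))
        rwa [liminf_const] at this
    _ ≤ liminf (fun j => ∫⁻ x in Ω, ENNReal.ofReal (f x ^ 2) *
          cellDensity d α ((acDensity μ x).toReal + 3 * ε j)) atTop :=
        lintegral_liminf_le fun j => (hfm.pow_const 2).ennreal_ofReal.mul (hcm _ (hε0 j))
    _ ≤ _ := liminf_le_liminf (Eventually.of_forall fun j =>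
        lintegral_cellDensity_le_liminf hd hΩ hΩb p hp hfm hf hf0 hα hy (hε0 j) (hε1 j))

end LowerLimit

/-! ### Assembling centres from configurations in the cells. -/

section Configuration
variable {d : ℕ}

open Classical in
/-- Points covering prescribed finite sets, with a prescribed number of them in each class. -/
theorem exists_configuration {ι X : Type*} [Fintype ι] {D : Set X} (A : ι → Set X)
    (T : ι → Finset X) (N : ι → ℕ) (W : Finset X) {n : ℕ} (hD : D.Nonempty) (hAD : ∀ z, A z ⊆ D)
    (hA : ∀ z, (A z).Nonempty) (hTA : ∀ z, (T z : Set X) ⊆ A z) (hTN : ∀ z, (T z).card ≤ N z)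
    (hW : (W : Set X) ⊆ D) (hn : ∑ z, N z + W.card ≤ n) :
    ∃ x : Fin n → X, (∀ i, x i ∈ D) ∧ (∀ z, (T z : Set X) ⊆ range x) ∧ (W : Set X) ⊆ range x ∧
      ∀ (Z : Finset ι) (B : Set X), (∀ z ∈ Z, A z ⊆ B) →
        ∑ z ∈ Z, N z ≤ (Finset.univ.filter fun i => x i ∈ B).card := by
  choose y hyA hyT using fun z => exists_fin_of_finset (hTA z) (hA z) (hTN z)
  obtain ⟨x₀, hx₀⟩ := hD
  -- The prescribed slots embed into the n indices; the remaining indices receive the filler x₀,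
  -- which can only increase the counts.
  obtain ⟨φ⟩ : Nonempty ((Σ z, Fin (N z)) ⊕ W ↪ Fin n) := by
    refine Function.Embedding.nonempty_of_card_le ?_
    simpa [Fintype.card_sum, Fintype.card_sigma] using hn
  set v : (Σ z, Fin (N z)) ⊕ W → X := Sum.elim (fun s => y s.1 s.2) (fun w => w) with hv
  have hx : ∀ j, Function.extend φ v (fun _ => x₀) (φ j) = v j := fun j =>
    φ.injective.extend_apply _ _ j
  refine ⟨Function.extend φ v fun _ => x₀, fun i => ?_, fun z a ha => ?_, fun a ha => ?_,
    fun Z B hB => ?_⟩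
  · by_cases h : ∃ j, φ j = i
    · obtain ⟨j, rfl⟩ := h
      rw [hx]
      rcases j with s | w
      · exact hAD _ (hyA _ _)
      · exact hW w.2
    · rw [Function.extend_apply' _ _ _ h]
      exact hx₀
  · obtain ⟨k, rfl⟩ := hyT z ha
    exact ⟨φ (Sum.inl ⟨z, k⟩), hx _⟩
  · exact ⟨φ (Sum.inr ⟨a, ha⟩), hx _⟩
  · have h1 : ∑ z ∈ Z, N z = (Z.sigma fun z => (Finset.univ : Finset (Fin (N z)))).card := by
      simp [Finset.card_sigma]
    rw [h1]
    refine Finset.card_le_card_of_injOn (fun s => φ (Sum.inl s)) (fun s hs => ?_)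
      ((φ.injective.comp Sum.inl_injective).injOn)
    have hs' := (Finset.mem_sigma.1 hs).1
    refine Finset.mem_coe.2 (Finset.mem_filter.2 ⟨Finset.mem_univ _, ?_⟩)
    change Function.extend φ v (fun _ => x₀) (φ (Sum.inl s)) ∈ B
    rw [hx]
    exact hB _ hs' (hyA _ _)

theorem eventually_exists_cube_centres (hd : 0 < d) {α δ ρ₀ ρ₁ e : ℝ} (hα : 0 < α)
    (hδ : 0 < δ) (hρ₀ : 0 < ρ₀) (hρ : ρ₀ < ρ₁) (he : 0 < e) {τ : ℝ≥0∞}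
    (hτ : cellDensity d α ρ₀ < τ) :
    ∀ᶠ n : ℕ in atTop, ∀ a : Space d, ∃ T : Finset (Space d), (T.card : ℝ) ≤ ρ₁ * δ ^ d * n ∧
      (∀ y ∈ T, ∃ c ∈ cube a δ, dist y c ≤ e) ∧
      closedCube a δ \ cube a δ ⊆ closedBalls (T : Set (Space d)) (radius d α n) ∧
      ENNReal.ofReal ((n : ℝ) ^ ((2 : ℝ) / d)) *
        dualEnergy (cube a δ \ closedBalls (T : Set (Space d)) (radius d α n)) (fun _ => 1) ≤
        ENNReal.ofReal (δ ^ d) * τ := by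
  set s : ℝ := (ρ₀ ^ ((1 : ℝ) / d)) ^ 2 with hs
  have hs0 : 0 < s := by positivity
  have hinv : ENNReal.ofReal s⁻¹ * ENNReal.ofReal s = 1 := by
    rw [← ENNReal.ofReal_mul (by positivity), inv_mul_cancel₀ hs0.ne', ENNReal.ofReal_one]
  have h1 : theta d (α * ρ₀ ^ ((1 : ℝ) / d)) < τ * ENNReal.ofReal s := by
    have h2 : theta d (α * ρ₀ ^ ((1 : ℝ) / d)) = cellDensity d α ρ₀ * ENNReal.ofReal s := by
      rw [cellDensity, ← hs, mul_right_comm, hinv, one_mul]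
    rw [h2]
    exact (ENNReal.mul_lt_mul_iff_left (by simpa using hs0) ENNReal.ofReal_ne_top).2 hτ
  filter_upwards [eventually_exists_dualEnergy_cube_le hd hα hδ hρ₀ hρ he h1] with n hn a
  obtain ⟨T, hT1, hT2, hT3, hT4⟩ := hn a
  refine ⟨T, hT1, hT2, hT3, hT4.trans (le_of_eq ?_)⟩
  rw [← hs, ENNReal.ofReal_mul (by positivity), mul_assoc, mul_left_comm (ENNReal.ofReal s⁻¹),
    hinv, mul_one]

/-- The energy of a step function when the centres contain good configurations for each cell. -/
theorem scaled_dualEnergy_stepFun_le {Ω : Set (Space d)}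
    (hΩ : IsOpen Ω) (hΩb : Bornology.IsBounded Ω) {δ : ℝ} (hδ : 0 < δ) {c : (Fin d → ℤ) → ℝ}
    (hc : MemLp (stepFun δ Ω c) 2 volume) {r : ℝ} {X : Set (Space d)}
    (T : (Fin d → ℤ) → Finset (Space d))
    (hTX : ∀ z ∈ innerIndices δ Ω, (T z : Set (Space d)) ⊆ X)
    (hT : ∀ z ∈ innerIndices δ Ω, closedCube (gridCorner δ z) δ \ cube (gridCorner δ z) δ ⊆
      closedBalls (T z : Set (Space d)) r)
    {m : ℝ≥0∞} (H : (Fin d → ℤ) → ℝ≥0∞)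
    (hH : ∀ z ∈ innerIndices δ Ω, m * dualEnergy (cube (gridCorner δ z) δ \
      closedBalls (T z : Set (Space d)) r) (fun _ => 1) ≤ ENNReal.ofReal (δ ^ d) * H z) :
    m * dualEnergy (Ω \ closedBalls X r) (stepFun δ Ω c) ≤
      ∫⁻ x, ENNReal.ofReal (stepFun δ Ω c x ^ 2) *
        (innerSet δ Ω).indicator (fun x => H (cellIndex δ x)) x := by
  classical
  set g := stepFun δ Ω c with hg
  set J := (finite_innerIndices hδ hΩb).toFinset with hJ
  have hJmem : ∀ z, z ∈ J ↔ z ∈ innerIndices δ Ω := fun z => Set.Finite.mem_toFinset _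
  have hint : ∫⁻ x, ENNReal.ofReal (g x ^ 2) * (innerSet δ Ω).indicator (fun x =>
      H (cellIndex δ x)) x = ∑ z ∈ J, ENNReal.ofReal (c z ^ 2) * (ENNReal.ofReal (δ ^ d) * H z) := by
    have e1 : ∀ x, ENNReal.ofReal (g x ^ 2) * (innerSet δ Ω).indicator (fun x =>
        H (cellIndex δ x)) x = (innerSet δ Ω).indicator (fun x =>
        ENNReal.ofReal (c (cellIndex δ x) ^ 2) * H (cellIndex δ x)) x := by
      intro x
      by_cases hx : x ∈ innerSet δ Ω
      · rw [indicator_of_mem hx, indicator_of_mem hx, hg, stepFun, indicator_of_mem hx]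
      · rw [indicator_of_notMem hx, indicator_of_notMem hx, mul_zero]
    simp only [e1]
    rw [lintegral_innerSet_indicator hδ hΩb fun z => ENNReal.ofReal (c z ^ 2) * H z]
    exact Finset.sum_congr rfl fun z _ => by ring
  rw [hint]
  set U : (Fin d → ℤ) → Set (Space d) := fun z =>
    cube (gridCorner δ z) δ \ closedBalls (T z : Set (Space d)) r with hU
  set V : Set (Space d) := ⋃ z ∈ J, U z with hV
  set Q : Set (Space d) := ⋃ z ∈ J, closedCube (gridCorner δ z) δ with hQ
  have hUo : ∀ z ∈ J, IsOpen (U z) := fun z _ => (isOpen_cube _ _).sdiff (isClosed_closedBalls _ _)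
  have hQc : IsClosed Q := Set.Finite.isClosed_biUnion J.finite_toSet fun z _ =>
    isClosed_closedCube _ _
  have hVQ : Disjoint V (Ω \ Q) := by
    refine disjoint_left.2 fun x hx hx' => hx'.2 ?_
    obtain ⟨z, hz, hxz⟩ := mem_iUnion₂.1 hx
    exact mem_iUnion₂.2 ⟨z, hz, cube_subset_closedCube _ _ hxz.1⟩
  -- The faces of the inner cells are covered by balls, so nothing connects different cells or the
  -- outer region.
  have hsub : Ω \ closedBalls X r ⊆ V ∪ (Ω \ Q) := by
    rintro x ⟨hxΩ, hxX⟩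
    by_cases hxQ : x ∈ Q
    · left
      obtain ⟨z, hz, hxz⟩ := mem_iUnion₂.1 hxQ
      have hz' := (hJmem z).1 hz
      have hxT : x ∉ closedBalls (T z : Set (Space d)) r := fun h =>
        hxX (closedBalls_mono (hTX z hz') le_rfl h)
      refine mem_iUnion₂.2 ⟨z, hz, ?_, hxT⟩
      by_contra hxc
      exact hxT (hT z hz' ⟨hxz, hxc⟩)
    · exact Or.inr ⟨hxΩ, hxQ⟩
  -- The step function vanishes off the inner cells, so no balls are needed there.
  have h0 : dualEnergy (Ω \ Q) g = 0 := by
    rw [← dualEnergy_zero (U := Ω \ Q)]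
    refine dualEnergy_congr (ae_of_all _ fun x hx => ?_)
    rw [hg, stepFun, indicator_of_notMem]
    intro hxi
    exact hx.2 (mem_iUnion₂.2 ⟨_, (hJmem _).2 hxi, mem_closedCube_cellIndex hδ x⟩)
  have hVg : dualEnergy V g = ∑ z ∈ J, ENNReal.ofReal (c z ^ 2) *
      dualEnergy (U z) (fun _ => 1) := by
    rw [hV, dualEnergy_biUnion _ _ hUo]
    · refine Finset.sum_congr rfl fun z hz => ?_
      rw [← dualEnergy_const_mul]
      refine dualEnergy_congr (ae_of_all _ fun b hb => ?_)
      rw [hg, stepFun_of_mem_cube hδ ((hJmem z).1 hz) hb.1, mul_one]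
    · intro z _ z' _ hzz
      refine disjoint_left.2 fun b hb hb' => hzz ?_
      rw [← mem_gridCell.1 (cube_subset_gridCell hδ z hb.1),
        mem_gridCell.1 (cube_subset_gridCell hδ z' hb'.1)]
    · exact hc.mono_measure Measure.restrict_le_self
  have hle : dualEnergy (Ω \ closedBalls X r) g ≤ dualEnergy V g := by
    refine (dualEnergy_mono hsub).trans (le_of_eq ?_)
    have hVo : IsOpen V := isOpen_biUnion hUo
    rw [dualEnergy_union hVo (hΩ.sdiff hQc) hVQ
      (hc.mono_measure Measure.restrict_le_self), h0, add_zero]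
  refine (mul_le_mul_right hle _).trans ?_
  rw [hVg, Finset.mul_sum]
  refine Finset.sum_le_sum fun z hz => ?_
  rw [mul_left_comm]
  exact mul_le_mul_right (hH z ((hJmem z).1 hz)) _

end Configuration

/-! ### Centres adapted to a grid of fixed mesh. -/

section UpperScale
variable {d : ℕ}

/-- Half-open cells partition the space while closed cubes serve differentiation; they differ by a
Lebesgue null set. -/
theorem measure_gridCell_eq {lam : Measure (Space d)} (hlam : lam ≪ volume) {δ : ℝ} (hδ : 0 < δ)
    (z : Fin d → ℤ) : lam (gridCell δ z) = lam (closedCube (gridCorner δ z) δ) := by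
  refine le_antisymm (measure_mono (gridCell_subset_closedCube hδ z)) ?_
  have h0 := hlam (volume_closedCube_diff_cube (gridCorner (d := d) δ z) hδ)
  calc lam (closedCube (gridCorner δ z) δ)
      ≤ lam (gridCell δ z ∪ (closedCube (gridCorner δ z) δ \ cube (gridCorner δ z) δ)) :=
        measure_mono fun x hx => by
          by_cases hxc : x ∈ cube (gridCorner δ z) δ
          · exact Or.inl (cube_subset_gridCell hδ z hxc)
          · exact Or.inr ⟨hx, hxc⟩
    _ ≤ lam (gridCell δ z) + 0 := h0 ▸ measure_union_le _ _
    _ = _ := add_zero _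

open Classical in
/-- Centres adapted to a grid: the cell `z` receives `⌊n ν(z)⌋` of them, with an energy which is
asymptotically optimal on the inner cells. -/
theorem eventually_exists_centres (hd : 0 < d) {Ω : Set (Space d)} (hΩ : IsOpen Ω)
    (hΩb : Bornology.IsBounded Ω) (hΩne : Ω.Nonempty)
    {f : Space d → ℝ} (hf : MemLp f 2 volume) {α : ℝ} (hα : 0 < α)
    {ν lam : Measure (Space d)} [IsFiniteMeasure ν] (hνc : ν (closure Ω)ᶜ = 0) {w : ℝ}
    (hν : ν.real univ ≤ 1 - w) (hlam : lam ≪ volume)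
    (hlamν : ∀ B ⊆ Ω, MeasurableSet B → lam B ≤ ν B) {s : ℝ} (hs : 0 < s)
    (hslam : ∀ B, MeasurableSet B → ENNReal.ofReal s * volume B ≤ lam B)
    {ε : ℝ} (hε : 0 < ε) (hε1 : ε < 1) {η : ℝ} (hη : 0 < η) {K : ℝ} (hK : 0 < K)
    (hwall : ∀ᶠ n : ℕ in atTop, ∃ W : Finset (Space d), (W : Set (Space d)) ⊆ Ω ∧
      (W.card : ℝ) ≤ w * n ∧ ∀ x ∈ Ω, (∃ k : ℤ, x ⟨0, hd⟩ = k * radius d K n) →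
          x ∈ closedBalls (W : Set (Space d)) (radius d α n))
    {δ e : ℝ} (hδ : 0 < δ) (he : 0 < e) (hδe : δ * d < e / 2)
    (c : (Fin d → ℤ) → ℝ) (hc : MemLp (stepFun δ Ω c) 2 volume) :
    ∀ᶠ n : ℕ in atTop, ∃ x : Fin n → Space d, (∀ i, x i ∈ closure Ω) ∧
      scaledCompliance n (ballUnion α Ω x) f Ω ≤ ENNReal.ofReal (1 - ε)⁻¹ *
        (∫⁻ x, ENNReal.ofReal (stepFun δ Ω c x ^ 2) * (innerSet δ Ω).indicator (fun x =>
          cellDensity d α ((lam (closedCube (gridCorner δ (cellIndex δ x)) δ)).toReal / δ ^ d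
            - s / 2) + ENNReal.ofReal η) x) +
        ENNReal.ofReal (ε⁻¹ * (4 * K ^ 2)) *
          eLpNorm (fun x => f x - stepFun δ Ω c x) 2 volume ^ 2 ∧
      ∀ B : Set (Space d), n * ν B ≤
        (Finset.univ.filter fun i => x i ∈ Metric.thickening e B).card + n * ENNReal.ofReal e := by
  set ρ : (Fin d → ℤ) → ℝ := fun z => (lam (closedCube (gridCorner δ z) δ)).toReal / δ ^ d with hρ
  have hδd : (0 : ℝ) < δ ^ d := by positivity
  have hlamfin : ∀ z ∈ innerIndices δ Ω, lam (closedCube (gridCorner δ z) δ) ≠ ⊤ := fun z hz =>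
    ((hlamν _ hz (isClosed_closedCube _ _).measurableSet).trans_lt (measure_lt_top ν _)).ne
  have hρs : ∀ z ∈ innerIndices δ Ω, s ≤ ρ z := by
    intro z hz
    have h1 := hslam _ (isClosed_closedCube (gridCorner δ z) δ).measurableSet
    rw [volume_closedCube, ← ENNReal.ofReal_pow hδ.le, ← ENNReal.ofReal_mul hs.le,
      ENNReal.ofReal_le_iff_le_toReal (hlamfin z hz)] at h1
    rw [hρ, le_div_iff₀ hδd]
    exact h1
  have hρν : ∀ z ∈ innerIndices δ Ω, ρ z * δ ^ d ≤ ν.real (gridCell δ z) := by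
    intro z hz
    have h1 := hlamν _ ((gridCell_subset_closedCube hδ z).trans hz) (measurableSet_gridCell δ z)
    rw [measure_gridCell_eq hlam hδ] at h1
    simp only [hρ]
    rw [div_mul_cancel₀ _ hδd.ne']
    exact ENNReal.toReal_mono (measure_ne_top _ _) h1
  set J := (finite_innerIndices hδ hΩb).toFinset with hJ
  have hJmem : ∀ z, z ∈ J ↔ z ∈ innerIndices δ Ω := fun z => Set.Finite.mem_toFinset _
  set Z := (finite_setOf_gridCell_inter hδ hΩb.closure).toFinset with hZ
  have hZmem : ∀ z, z ∈ Z ↔ (gridCell δ z ∩ closure Ω).Nonempty := fun z => Set.Finite.mem_toFinset _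
  -- The good configurations may protrude from their cube. The tolerance e' keeps them in Ω, and
  -- near enough to the cell for the control of the measure.
  have hrad : ∀ z ∈ J, ∃ e' > 0, e' ≤ e / 2 ∧
      Metric.cthickening e' (closedCube (gridCorner δ z) δ) ⊆ Ω := by
    intro z hz
    have hQc : IsCompact (closedCube (gridCorner δ z) δ) := Metric.isCompact_of_isClosed_isBounded
      (isClosed_closedCube _ _) (isBounded_closedCube _ _)
    obtain ⟨η₀, hη₀, hη₀Ω⟩ := hQc.exists_cthickening_subset_open hΩ ((hJmem z).1 hz)
    exact ⟨min η₀ (e / 2), by positivity, min_le_right _ _,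
      (Metric.cthickening_mono (min_le_left _ _) _).trans hη₀Ω⟩
  choose! e' he'0 he'e he'Ω using hrad
  have hcube : ∀ z ∈ J, ∀ᶠ n : ℕ in atTop, ∀ a : Space d, ∃ T : Finset (Space d),
      (T.card : ℝ) ≤ (ρ z - s / 4) * δ ^ d * n ∧
      (∀ y ∈ T, ∃ c ∈ cube a δ, dist y c ≤ e' z) ∧
      closedCube a δ \ cube a δ ⊆ closedBalls (T : Set (Space d)) (radius d α n) ∧
      ENNReal.ofReal ((n : ℝ) ^ ((2 : ℝ) / d)) *
        dualEnergy (cube a δ \ closedBalls (T : Set (Space d)) (radius d α n)) (fun _ => 1) ≤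
        ENNReal.ofReal (δ ^ d) * (cellDensity d α (ρ z - s / 2) + ENNReal.ofReal η) := by
    intro z hz
    have h1 := hρs z ((hJmem z).1 hz)
    have h2 : 0 < ρ z - s / 2 := by linarith
    refine eventually_exists_cube_centres hd hα hδ h2 (by linarith) (he'0 z hz) ?_
    exact ENNReal.lt_add_right (cellDensity_lt_top hd hα h2).ne (by simpa using hη)
  -- Compensates the floor in N: the configuration has at most (ρ - s/4)δ^d n points, hence at most
  -- n ν(cell) - 1.
  have hn1 : ∀ᶠ n : ℕ in atTop, 1 ≤ s / 4 * δ ^ d * n := by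
    have : Tendsto (fun n : ℕ => s / 4 * δ ^ d * n) atTop atTop :=
      tendsto_natCast_atTop_atTop.const_mul_atTop (by positivity)
    exact this.eventually_ge_atTop 1
  -- The floors lose at most one centre per cell, in total at most e n.
  have hn2 : ∀ᶠ n : ℕ in atTop, (Z.card : ℝ) ≤ e * n := by
    have : Tendsto (fun n : ℕ => e * (n : ℝ)) atTop atTop :=
      tendsto_natCast_atTop_atTop.const_mul_atTop he
    exact this.eventually_ge_atTop _
  filter_upwards [hwall, eventually_gt_atTop 0, hn1, hn2, (Filter.eventually_all_finset J).2 hcube]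
    with n hW hn hn1 hn2 hcuben
  obtain ⟨W, hWΩ, hWcard, hWwall⟩ := hW
  set r := radius d α n with hr
  choose! T hTcard hTnear hTbdry hTen using fun z hz => hcuben z hz (gridCorner δ z)
  set N : (Fin d → ℤ) → ℕ := fun z => ⌊(n : ℝ) * ν.real (gridCell δ z)⌋₊ with hN
  have hNle : ∀ z, (N z : ℝ) ≤ n * ν.real (gridCell δ z) := fun z => Nat.floor_le (by positivity)
  have hNlt : ∀ z, n * ν.real (gridCell δ z) < N z + 1 := fun z => Nat.lt_floor_add_one _
  -- A point of A lies within e/2 of its cell, whose diameter is below e/2. So centres of a cell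
  -- meeting B lie in the e-thickening of B.
  set A : (Fin d → ℤ) → Set (Space d) := fun z =>
    {y | y ∈ closure Ω ∧ ∃ b ∈ gridCell δ z, dist y b ≤ e / 2} with hA
  set T' : (Fin d → ℤ) → Finset (Space d) := fun z => if z ∈ J then T z else ∅ with hT'
  have hdisj : ∀ z z', z ≠ z' → Disjoint (gridCell (d := d) δ z) (gridCell δ z') := by
    intro z z' h
    refine disjoint_left.2 fun b hb hb' => h ?_
    rw [← mem_gridCell.1 hb, mem_gridCell.1 hb']
  obtain ⟨x, hxΩ, hxT, hxW, hxB⟩ := exists_configuration (ι := Z) (D := closure Ω)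
    (fun z => A z) (fun z => T' z) (fun z => N z) W (n := n) hΩne.closure (fun z y hy => hy.1)
    (fun z => by
      obtain ⟨y, hy, hyΩ⟩ := (hZmem z).1 z.2
      exact ⟨y, hyΩ, y, hy, by simpa using by positivity⟩)
    (fun z y hy => by
      simp only [hT'] at hy
      split_ifs at hy with hz
      · obtain ⟨b, hb, hyb⟩ := hTnear z hz y hy
        refine ⟨subset_closure (he'Ω z hz ?_), b, cube_subset_gridCell hδ _ hb,
          hyb.trans (he'e z hz)⟩
        exact Metric.mem_cthickening_of_dist_le y b _ _ (cube_subset_closedCube _ _ hb) hyb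
      · simp at hy)
    (fun z => by
      simp only [hT']
      split_ifs with hz
      · have h1 := hTcard z hz
        have h2 := hρν z ((hJmem z).1 hz)
        have h3 := hNlt z
        have h4 : (n : ℝ) * (ρ z * δ ^ d) ≤ n * ν.real (gridCell δ z) := by gcongr
        have h5 : ((T z).card : ℝ) < N z := by nlinarith
        exact_mod_cast h5.le
      · simp)
    (hWΩ.trans subset_closure)
    (by
      have h1 : ((∑ z : Z, N z : ℕ) : ℝ) ≤ n * (1 - w) := by
        rw [Finset.sum_coe_sort Z N]
        push_cast
        calc ∑ z ∈ Z, (N z : ℝ) ≤ ∑ z ∈ Z, n * ν.real (gridCell δ z) :=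
              Finset.sum_le_sum fun z _ => hNle z
          _ = n * ν.real (⋃ z ∈ Z, gridCell δ z) := by
              rw [← Finset.mul_sum, measureReal_biUnion_finset
                (fun z _ z' _ h => hdisj z z' h) fun z _ => measurableSet_gridCell δ z]
          _ ≤ n * (1 - w) := by
              gcongr
              exact (measureReal_mono (subset_univ _)).trans hν
      have h2 : ((∑ z : Z, N z + W.card : ℕ) : ℝ) ≤ n := by
        push_cast at h1 ⊢
        linarith
      exact_mod_cast h2)
  have hJZ : ∀ z ∈ J, z ∈ Z := fun z hz => (hZmem z).2 ⟨gridCorner δ z,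
    gridCorner_mem_gridCell hδ z, subset_closure ((hJmem z).1 hz (gridCorner_mem_closedCube hδ z))⟩
  refine ⟨x, hxΩ, ?_, fun B => ?_⟩
  · rw [scaledCompliance_eq hd hΩb hΩ (hf.mono_measure Measure.restrict_le_self), ← hr]
    set Y := Ω \ closedBalls (range x) r with hY
    have h1 := dualEnergy_le_add hε hε1 (U := Y) (h := f) (w := stepFun δ Ω c)
      (hf.mono_measure Measure.restrict_le_self) (hc.mono_measure Measure.restrict_le_self)
    have h2 := scaled_dualEnergy_stepFun_le hΩ hΩb hδ hc (r := r) (X := range x) T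
      (fun z hz => by
        have hz' := (hJmem z).2 hz
        have := hxT ⟨z, hJZ z hz'⟩
        simpa only [hT', if_pos hz'] using this)
      (fun z hz => hTbdry z ((hJmem z).2 hz))
      (fun z => cellDensity d α (ρ z - s / 2) + ENNReal.ofReal η)
      (fun z hz => hTen z ((hJmem z).2 hz))
    have h3 := scaled_dualEnergy_le_of_walls ⟨0, hd⟩ hK hn (U := Y) (fun b hb k hk =>
      hb.2 (closedBalls_mono hxW le_rfl (hWwall b hb.1 ⟨k, hk⟩))) (hf.sub hc)
    refine (mul_le_mul_right h1 _).trans ?_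
    rw [mul_add, mul_left_comm, mul_left_comm _ (ENNReal.ofReal ε⁻¹)]
    refine add_le_add (mul_le_mul_right h2 _) ?_
    rw [ENNReal.ofReal_mul (by positivity), mul_assoc]
    exact mul_le_mul_right h3 _
  · set Z' : Finset Z := Finset.univ.filter fun z : Z => (gridCell δ z.1 ∩ B).Nonempty with hZ'
    have h1 := hxB Z' (Metric.thickening e B) (by
      intro z hz y hy
      obtain ⟨b', hb', hb'B⟩ := (Finset.mem_filter.1 hz).2
      obtain ⟨-, b, hb, hyb⟩ := hy
      refine Metric.mem_thickening_iff.2 ⟨b', hb'B, ?_⟩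
      have := dist_le_of_mem_closedCube hδ.le (gridCell_subset_closedCube hδ _ hb)
        (gridCell_subset_closedCube hδ _ hb')
      linarith [dist_triangle y b b'])
    have h2 : ν B ≤ ∑ z ∈ Z', ν (gridCell δ z.1) := by
      have hsub : B ⊆ (⋃ z ∈ Z', gridCell δ z.1) ∪ (closure Ω)ᶜ := by
        intro b hb
        by_cases hbΩ : b ∈ closure Ω
        · left
          have hbc : b ∈ gridCell δ (cellIndex δ b) := mem_gridCell.2 rfl
          refine mem_iUnion₂.2 ⟨⟨cellIndex δ b, (hZmem _).2 ⟨b, hbc, hbΩ⟩⟩, ?_, hbc⟩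
          exact Finset.mem_filter.2 ⟨Finset.mem_univ _, b, hbc, hb⟩
        · exact Or.inr hbΩ
      calc ν B ≤ ν (⋃ z ∈ Z', gridCell δ z.1) + ν (closure Ω)ᶜ :=
            (measure_mono hsub).trans (measure_union_le _ _)
        _ ≤ _ := by rw [hνc, add_zero]; exact measure_biUnion_finset_le _ _
    have h3 : (n : ℝ≥0∞) * ∑ z ∈ Z', ν (gridCell δ z.1) ≤ ∑ z ∈ Z', ((N z.1 : ℝ≥0∞) + 1) := by
      rw [Finset.mul_sum]
      refine Finset.sum_le_sum fun z _ => ?_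
      have := (hNlt z.1).le
      rw [← ENNReal.ofReal_toReal (measure_ne_top ν (gridCell δ z.1)), ← ENNReal.ofReal_natCast,
        ← ENNReal.ofReal_mul (by positivity), ← ENNReal.ofReal_natCast, ← ENNReal.ofReal_one,
        ← ENNReal.ofReal_add (by positivity) (by positivity)]
      exact ENNReal.ofReal_le_ofReal this
    have h4 : (Z'.card : ℝ≥0∞) ≤ n * ENNReal.ofReal e := by
      have h5 : Z'.card ≤ Z.card := (Finset.card_le_univ _).trans (by simp)
      rw [← ENNReal.ofReal_natCast, ← ENNReal.ofReal_natCast n, ← ENNReal.ofReal_mul (by positivity)]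
      refine ENNReal.ofReal_le_ofReal ?_
      have : (Z'.card : ℝ) ≤ Z.card := by exact_mod_cast h5
      linarith
    calc n * ν B ≤ n * ∑ z ∈ Z', ν (gridCell δ z.1) := mul_le_mul_right h2 _
      _ ≤ ∑ z ∈ Z', ((N z.1 : ℝ≥0∞) + 1) := h3
      _ = ((∑ z ∈ Z', N z.1 : ℕ) : ℝ≥0∞) + Z'.card := by
          rw [Finset.sum_add_distrib]; push_cast; simp
      _ ≤ _ := add_le_add (by exact_mod_cast h1) h4

end UpperScale

/-! ### Choice of the parameters in the upper bound. -/

section UpperLimit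
variable {d : ℕ}

/-- Applies `exists_walls` in an enclosing cube of side 2R, with its volume divided out of the
prescribed fraction. -/
theorem exists_walls_of_isBounded (hd : 0 < d) {Ω : Set (Space d)} (hΩb : Bornology.IsBounded Ω)
    {α w : ℝ} (hα : 0 < α) (hw : 0 < w) : ∃ K : ℝ, 0 < K ∧ ∀ᶠ n : ℕ in atTop,
      ∃ W : Finset (Space d), (W : Set (Space d)) ⊆ Ω ∧ (W.card : ℝ) ≤ w * n ∧
        ∀ x ∈ Ω, (∃ k : ℤ, x ⟨0, hd⟩ = k * radius d K n) →
          x ∈ closedBalls (W : Set (Space d)) (radius d α n) := by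
  obtain ⟨R, hR0, hR⟩ := hΩb.subset_closedBall_lt 0 0
  have hL : (0 : ℝ) < (2 * R) ^ d := by positivity
  obtain ⟨K, hK, h⟩ := exists_walls ⟨0, hd⟩ hα (div_pos hw hL)
  refine ⟨K, hK, (h (2 * R) (by positivity)).mono fun n hn => ?_⟩
  obtain ⟨W, hW, hWc, hWw⟩ := hn (WithLp.toLp 2 fun _ => -R) Ω (fun x hx j => by
    have h1 : ‖x‖ ≤ R := by simpa using hR hx
    have h2 := abs_le.1 ((PiLp.norm_apply_le x j).trans h1)
    constructor
    · exact h2.1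
    · change x j ≤ -R + 2 * R
      linarith [h2.2])
  refine ⟨W, hW, ?_, hWw⟩
  rwa [div_mul_cancel₀ _ hL.ne'] at hWc

open Classical in
-- The order of choices matters: ε from the margin below M and K from the wall fraction w fix the
-- constant D; then come the accuracy 1/j, the mesh `δ k`, and n last.
theorem eventually_exists_centres_le (hd : 0 < d) {Ω : Set (Space d)} (hΩ : IsOpen Ω)
    (hΩb : Bornology.IsBounded Ω) (hΩne : Ω.Nonempty)
    {f : Space d → ℝ} (hfm : Measurable f) (hf : MemLp f 2 volume) (hf0 : ∀ x, x ∉ Ω → f x = 0)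
    {α : ℝ} (hα : 0 < α)
    {ν : Measure (Space d)} [IsFiniteMeasure ν] (hνc : ν (closure Ω)ᶜ = 0) {w : ℝ}
    (hw : 0 < w) (hν : ν.real univ ≤ 1 - w) {h : Space d → ℝ≥0∞} (hm : Measurable h)
    [IsLocallyFiniteMeasure (volume.withDensity h)]
    (hhν : ∀ B ⊆ Ω, MeasurableSet B → ∫⁻ x in B, h x ≤ ν B) {s : ℝ} (hs : 0 < s)
    (hsh : ∀ x, ENNReal.ofReal s ≤ h x) {M : ℝ≥0∞}
    (hM : ∫⁻ x in Ω, ENNReal.ofReal (f x ^ 2) * cellDensity d α ((h x).toReal - 3 * s / 4) < M)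
    {e : ℝ} (he : 0 < e) :
    ∀ᶠ n : ℕ in atTop, ∃ x : Fin n → Space d, (∀ i, x i ∈ closure Ω) ∧
      scaledCompliance n (ballUnion α Ω x) f Ω ≤ M ∧
      ∀ B : Set (Space d), n * ν B ≤
        (Finset.univ.filter fun i => x i ∈ Metric.thickening e B).card + n * ENNReal.ofReal e := by
  set lam := volume.withDensity h with hlam
  have hlamac : lam ≪ volume := withDensity_absolutelyContinuous _ _
  have hlamν : ∀ B ⊆ Ω, MeasurableSet B → lam B ≤ ν B := fun B hB hBm => by
    rw [hlam, withDensity_apply _ hBm]; exact hhν B hB hBm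
  have hslam : ∀ B, MeasurableSet B → ENNReal.ofReal s * volume B ≤ lam B := fun B hBm => by
    rw [hlam, withDensity_apply _ hBm, ← setLIntegral_const]
    exact lintegral_mono hsh
  set I := ∫⁻ x in Ω, ENNReal.ofReal (f x ^ 2) * cellDensity d α ((h x).toReal - 3 * s / 4) with hI
  set F2 := ∫⁻ x, ENNReal.ofReal (f x ^ 2) with hF2
  have hF2t : F2 ≠ ⊤ := by
    rw [hF2, lintegral_ofReal_sq]; exact ENNReal.pow_ne_top hf.2.ne
  have hf2m : Measurable fun x => ENNReal.ofReal (f x ^ 2) := (hfm.pow_const 2).ennreal_ofReal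
  have hlim : Tendsto (fun ε : ℝ => ENNReal.ofReal ((1 - ε)⁻¹ * (1 + ε)) *
      (I + ENNReal.ofReal ε * F2)) (𝓝[>] 0) (𝓝 I) := by
    have h1 : Tendsto (fun ε : ℝ => (1 - ε)⁻¹ * (1 + ε)) (𝓝 0) (𝓝 ((1 - 0)⁻¹ * (1 + 0))) :=
      ((tendsto_id.const_sub 1).inv₀ (by norm_num)).mul (tendsto_id.const_add 1)
    have h2 := (ENNReal.continuous_ofReal.tendsto _).comp h1
    have h3 : Tendsto (fun ε : ℝ => I + ENNReal.ofReal ε * F2) (𝓝 0)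
        (𝓝 (I + ENNReal.ofReal 0 * F2)) :=
      (ENNReal.Tendsto.mul_const (ENNReal.continuous_ofReal.tendsto 0) (Or.inr hF2t)).const_add I
    simp only [ENNReal.ofReal_zero, zero_mul, add_zero] at h3
    simp only [sub_zero, inv_one, add_zero, mul_one, ENNReal.ofReal_one] at h2
    have h4 := ENNReal.Tendsto.mul h2 (Or.inl one_ne_zero) h3 (Or.inr ENNReal.one_ne_top)
    rw [one_mul] at h4
    exact h4.mono_left nhdsWithin_le_nhds
  obtain ⟨ε, hεM, hε, hε1⟩ := ((hlim.eventually (gt_mem_nhds hM)).and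
    (Ioo_mem_nhdsGT (zero_lt_one' ℝ))).exists
  set c₀ := ENNReal.ofReal ((1 - ε)⁻¹ * (1 + ε)) with hc₀
  obtain ⟨K, hK, hwall⟩ := exists_walls_of_isBounded hd hΩb hα hw
  obtain ⟨δ, hδ, hδ0⟩ := exists_grid_sequence
  set H : ℕ → Space d → ℝ≥0∞ := fun k => (innerSet (δ k) Ω).indicator fun x =>
    cellDensity d α ((lam (closedCube (gridCorner (δ k) (cellIndex (δ k) x)) (δ k))).toReal /
      δ k ^ d - s / 2) + ENNReal.ofReal ε with hH
  set C := cellDensity d α (s / 2) + ENNReal.ofReal ε with hC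
  have hCt : C ≠ ⊤ := ENNReal.add_ne_top.2
    ⟨(cellDensity_lt_top hd hα (by positivity)).ne, ENNReal.ofReal_ne_top⟩
  have hρs : ∀ k (z : Fin d → ℤ), s ≤ (lam (closedCube (gridCorner (δ k) z) (δ k))).toReal /
      δ k ^ d := by
    intro k z
    have hδd : 0 < δ k ^ d := pow_pos (hδ k) d
    have h1 := hslam _ (isClosed_closedCube (gridCorner (δ k) z) (δ k)).measurableSet
    have h2 : lam (closedCube (gridCorner (δ k) z) (δ k)) ≠ ⊤ :=
      (isBounded_closedCube _ _).measure_lt_top.ne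
    rw [volume_closedCube, ← ENNReal.ofReal_pow (hδ k).le, ← ENNReal.ofReal_mul hs.le,
      ENNReal.ofReal_le_iff_le_toReal h2] at h1
    rwa [le_div_iff₀ hδd]
  -- The lower bound s on the density makes f² C an integrable majorant, as reverse Fatou requires.
  have hHC : ∀ k x, H k x ≤ C := by
    intro k x
    refine (indicator_le_self' (fun _ _ => zero_le) x).trans (add_le_add
      (cellDensity_antitone hd hα (by positivity) ?_) le_rfl)
    linarith [hρs k (cellIndex (δ k) x)]
  have hHm : ∀ k, Measurable (H k) := by
    intro k
    refine Measurable.indicator ?_ (measurableSet_innerSet _ _)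
    exact (measurable_of_countable fun z : Fin d → ℤ => cellDensity d α
      ((lam (closedCube (gridCorner (δ k) z) (δ k))).toReal / δ k ^ d - s / 2) +
        ENNReal.ofReal ε).comp (measurable_cellIndex (δ k))
  have hδ0' : Tendsto δ atTop (𝓝[>] 0) :=
    tendsto_nhdsWithin_iff.2 ⟨hδ0, Eventually.of_forall hδ⟩
  have hlimsup : limsup (fun k => ∫⁻ x, ENNReal.ofReal (f x ^ 2) * H k x) atTop ≤
      I + ENNReal.ofReal ε * F2 := by
    refine (limsup_lintegral_le (g := fun x => ENNReal.ofReal (f x ^ 2) * C)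
      (fun k => hf2m.mul (hHm k))
      (fun k => ae_of_all _ fun x => mul_le_mul_right (hHC k x) _) ?_).trans ?_
    · rw [lintegral_mul_const' _ _ hCt]
      exact ENNReal.mul_ne_top hF2t hCt
    calc ∫⁻ x, limsup (fun k => ENNReal.ofReal (f x ^ 2) * H k x) atTop
        ≤ ∫⁻ x, Ω.indicator (fun x => ENNReal.ofReal (f x ^ 2) *
            cellDensity d α ((h x).toReal - 3 * s / 4) +
              ENNReal.ofReal (f x ^ 2) * ENNReal.ofReal ε) x := by
          refine lintegral_mono_ae ?_
          filter_upwards [ae_tendsto_measure_closedCube lam hδ hδ0,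
            Measure.rnDeriv_withDensity volume hm, Measure.rnDeriv_lt_top lam volume]
            with x hx hxh hxt
          rw [hxh] at hx
          by_cases hxΩ : x ∈ Ω
          · rw [indicator_of_mem hxΩ]
            have hht : h x ≠ ⊤ := by rw [← hxh]; exact hxt.ne
            have h1 : s ≤ (h x).toReal := (ENNReal.ofReal_le_iff_le_toReal hht).1 (hsh x)
            have h2 := (ENNReal.tendsto_toReal hht).comp hx
            refine limsup_le_of_le (by isBoundedDefault) ?_
            -- Cell averages eventually exceed h - s/4; with the loss s/2 in the construction of
            -- centres this makes 3s/4.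
            filter_upwards [h2.eventually (lt_mem_nhds (sub_lt_self _ (by positivity : 0 < s / 4))),
              hδ0'.eventually (exists_closedCube_subset hΩ hxΩ)] with k hk hkx
            simp only [hH]
            rw [indicator_of_mem hkx, ← mul_add]
            refine mul_le_mul_right (add_le_add (cellDensity_antitone hd hα ?_ ?_) le_rfl) _
            · linarith
            · simp only [Function.comp_apply, ENNReal.toReal_div,
                ENNReal.toReal_ofReal (pow_nonneg (hδ k).le d)] at hk
              linarith
          · rw [indicator_of_notMem hxΩ]
            refine limsup_le_of_le (by isBoundedDefault) (Eventually.of_forall fun k => ?_)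
            simp [hf0 x hxΩ]
      _ = I + ∫⁻ x in Ω, ENNReal.ofReal (f x ^ 2) * ENNReal.ofReal ε := by
          rw [lintegral_indicator hΩ.measurableSet, lintegral_add_right _ (hf2m.mul_const _)]
      _ ≤ _ := by
          refine add_le_add le_rfl ((setLIntegral_le_lintegral _ _).trans ?_)
          rw [lintegral_mul_const' _ _ ENNReal.ofReal_ne_top, mul_comm]
  obtain ⟨M', hM'1, hM'2⟩ := exists_between hεM
  have hev : ∀ᶠ k in atTop, c₀ * ∫⁻ x, ENNReal.ofReal (f x ^ 2) * H k x < M' := by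
    refine eventually_lt_of_limsup_lt ?_
    rw [ENNReal.limsup_const_mul_of_ne_top ENNReal.ofReal_ne_top]
    exact (mul_le_mul_right hlimsup _).trans_lt hM'1
  set D : ℝ≥0∞ := ENNReal.ofReal (1 - ε)⁻¹ * (ENNReal.ofReal (1 + ε⁻¹) * C) +
    ENNReal.ofReal (ε⁻¹ * (4 * K ^ 2)) with hD
  have hDt : D ≠ ⊤ := by
    refine ENNReal.add_ne_top.2 ⟨ENNReal.mul_ne_top ENNReal.ofReal_ne_top
      (ENNReal.mul_ne_top ENNReal.ofReal_ne_top hCt), ENNReal.ofReal_ne_top⟩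
  obtain ⟨j, hjM, hj0⟩ := (((tendsto_affine_sq_zero hDt M').eventually (gt_mem_nhds hM'2)).and
    (eventually_gt_atTop 0)).exists
  have hj : ((j : ℝ≥0∞)⁻¹) ≠ 0 := ENNReal.inv_ne_zero.2 (ENNReal.natCast_ne_top j)
  have hjt : ((j : ℝ≥0∞)⁻¹) ≠ ⊤ := ENNReal.inv_ne_top.2 (by exact_mod_cast hj0.ne')
  have hδd : Tendsto (fun k => δ k * d) atTop (𝓝 0) := by simpa using hδ0.mul_const (d : ℝ)
  obtain ⟨k, ⟨hk1, c, hc⟩, hk3⟩ := ((hev.and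
    (eventually_exists_stepFun hΩ hΩb hf hf0 hj hδ hδ0)).and
    (hδd.eventually (gt_mem_nhds (half_pos he)))).exists
  have hgm := measurable_stepFun (δ k) Ω c
  have hgL := memLp_of_eLpNorm_sub_le hf hgm hjt hc
  filter_upwards [eventually_exists_centres hd hΩ hΩb hΩne hf hα hνc hν hlamac hlamν hs hslam hε hε1
    hε hK hwall (hδ k) he hk3 c hgL] with n hn
  obtain ⟨x, hxΩ, hxE, hxB⟩ := hn
  refine ⟨x, hxΩ, hxE.trans ?_, hxB⟩
  have h1 := lintegral_sq_mul_le hgm hfm (hHC k) hε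
  have h2 : eLpNorm (fun x => stepFun (δ k) Ω c x - f x) 2 volume ≤ (j : ℝ≥0∞)⁻¹ :=
    (eLpNorm_sub_comm (stepFun (δ k) Ω c) f 2 volume).le.trans hc
  have h3 := pow_le_pow_left' h2 2
  have h4 := pow_le_pow_left' hc 2
  set E := ((j : ℝ≥0∞)⁻¹) ^ 2 with hE
  calc _ ≤ ENNReal.ofReal (1 - ε)⁻¹ * (ENNReal.ofReal (1 + ε) *
          (∫⁻ x, ENNReal.ofReal (f x ^ 2) * H k x) + ENNReal.ofReal (1 + ε⁻¹) * C * E) +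
          ENNReal.ofReal (ε⁻¹ * (4 * K ^ 2)) * E :=
        add_le_add (mul_le_mul_right (h1.trans (add_le_add le_rfl (mul_le_mul_right h3 _))) _)
          (mul_le_mul_right h4 _)
    _ = c₀ * (∫⁻ x, ENNReal.ofReal (f x ^ 2) * H k x) + D * E := by
        rw [hc₀, hD, ENNReal.ofReal_mul (q := 1 + ε) (inv_nonneg.2 (by linarith))]
        ring
    _ ≤ M' + D * E := add_le_add hk1.le le_rfl
    _ ≤ M := hjM.le

end UpperLimit

/-! ### Freeing mass at small cost in energy. -/

section Perturbation
variable {d : ℕ}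

/-- Every β in the supremum defining θ⁻ lies above α ρ^(1/d), so monotonicity of θ bounds it. -/
theorem limitDensity_le_cellDensity (hd : 0 < d) {α ρ : ℝ} (hα : 0 < α) (hρ : 0 < ρ) {b : ℝ≥0∞}
    (hb : b ≠ ⊤) (hρb : ENNReal.ofReal ρ ≤ b) : limitDensity d α b ≤ cellDensity d α ρ := by
  have hd' : (0 : ℝ) < d := by exact_mod_cast hd
  have h1 : ρ ≤ b.toReal := (ENNReal.ofReal_le_iff_le_toReal hb).1 hρb
  unfold cellDensity limitDensity
  rw [ofReal_inv_sq_rpow hρ]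
  refine mul_le_mul' (by gcongr) (iSup₂_le fun β hβ => theta_antitone hd (by positivity) ?_)
  refine le_trans ?_ hβ.le
  gcongr

/-- Countably many cells of small volume cover S, so one of them meets S in positive measure. -/
theorem exists_subset_measure_lt (hd : 0 < d) {S : Set (Space d)} (hS : MeasurableSet S)
    (hS0 : volume S ≠ 0) {τ : ℝ≥0∞} (hτ : 0 < τ) :
    ∃ A ⊆ S, MeasurableSet A ∧ volume A ≠ 0 ∧ volume A < τ := by
  obtain ⟨δ, hδ, hδτ⟩ : ∃ δ : ℝ, 0 < δ ∧ ENNReal.ofReal (δ ^ d) < τ := by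
    have h1 : Tendsto (fun δ : ℝ => ENNReal.ofReal (δ ^ d)) (𝓝 0) (𝓝 (ENNReal.ofReal (0 ^ d))) :=
      (ENNReal.continuous_ofReal.comp (continuous_pow d)).tendsto 0
    rw [zero_pow hd.ne', ENNReal.ofReal_zero] at h1
    obtain ⟨δ, h2, h3⟩ := (((h1.mono_left nhdsWithin_le_nhds).eventually (gt_mem_nhds hτ)).and
      (self_mem_nhdsWithin : Ioi (0 : ℝ) ∈ 𝓝[>] 0)).exists
    exact ⟨δ, h3, h2⟩
  obtain ⟨z, hz⟩ : ∃ z : Fin d → ℤ, volume (S ∩ gridCell δ z) ≠ 0 := by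
    by_contra! h
    refine hS0 (measure_mono_null (fun x hx => ?_) (measure_iUnion_null h))
    exact mem_iUnion.2 ⟨cellIndex δ x, hx, mem_gridCell.2 rfl⟩
  refine ⟨S ∩ gridCell δ z, inter_subset_left, hS.inter (measurableSet_gridCell δ z), hz, ?_⟩
  exact (measure_mono inter_subset_right).trans_lt (by rwa [volume_gridCell hδ])

/-- A set charged by `ν` on which halving the density costs little energy. -/
theorem exists_set_lintegral_half_le (hd : 0 < d) {Ω : Set (Space d)} (hΩ : IsOpen Ω)
    {f : Space d → ℝ} (hfm : Measurable f) (hf : MemLp f 2 volume)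
    {α : ℝ} (hα : 0 < α) (ν : Measure (Space d)) [IsProbabilityMeasure ν] {e : ℝ≥0∞} (he : e ≠ 0)
    (hfin : ∫⁻ x in Ω, ENNReal.ofReal (f x ^ 2) * limitDensity d α (ν.rnDeriv volume x) ≠ ⊤) :
    ∃ A, MeasurableSet A ∧ ν A ≠ 0 ∧ ∫⁻ x in Ω ∩ A, ENNReal.ofReal (f x ^ 2) *
      limitDensity d α (ν.rnDeriv volume x / 2) ≤ e := by
  have hd' : (0 : ℝ) < d := by exact_mod_cast hd
  set a := ν.rnDeriv volume with ha
  have ham : Measurable a := Measure.measurable_rnDeriv _ _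
  have hf2m : Measurable fun x => ENNReal.ofReal (f x ^ 2) := (hfm.pow_const 2).ennreal_ofReal
  -- If the density vanishes a.e. on Ω, halving changes nothing. The finite energy is then 0,
  -- because `limitDensity d α 0` is either 0 or ⊤.
  by_cases h0 : volume (Ω ∩ {x | a x ≠ 0}) = 0
  · refine ⟨univ, MeasurableSet.univ, by simp, ?_⟩
    rw [inter_univ]
    have ha0 : ∀ᵐ x ∂(volume.restrict Ω), a x = 0 := by
      rw [ae_restrict_iff' hΩ.measurableSet, ae_iff]
      refine measure_mono_null (fun x hx => ?_) h0
      rw [mem_ofPred_eq, Classical.not_imp] at hx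
      exact hx
    have h1 : ∫⁻ x in Ω, ENNReal.ofReal (f x ^ 2) * limitDensity d α (a x) =
        ∫⁻ x in Ω, ENNReal.ofReal (f x ^ 2) * limitDensity d α 0 :=
      lintegral_congr_ae (by filter_upwards [ha0] with x hx; rw [hx])
    have h2 : ∫⁻ x in Ω, ENNReal.ofReal (f x ^ 2) * limitDensity d α (a x / 2) =
        ∫⁻ x in Ω, ENNReal.ofReal (f x ^ 2) * limitDensity d α 0 :=
      lintegral_congr_ae (by filter_upwards [ha0] with x hx; rw [hx, ENNReal.zero_div])
    rw [h1, lintegral_mul_const _ hf2m] at hfin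
    rw [h2, lintegral_mul_const _ hf2m]
    refine le_of_eq_of_le ?_ zero_le
    by_cases hG : limitDensity d α 0 = 0
    · rw [hG, mul_zero]
    · have hGt : limitDensity d α 0 = ⊤ := by
        unfold limitDensity at hG ⊢
        rw [ENNReal.zero_rpow_of_pos (by positivity), ENNReal.inv_zero] at hG ⊢
        exact ENNReal.top_mul fun h => hG (by rw [h, mul_zero])
      rw [hGt] at hfin ⊢
      by_contra h
      rw [mul_eq_zero, not_or] at h
      exact hfin (ENNReal.mul_top h.1)
  -- Where the density is at least ρ > 0, the halved density costs at most f² `cellDensity d α (ρ /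
  -- 2)`, which is integrable; a subset of small volume makes the cost small.
  · obtain ⟨ρ, hρ, hS⟩ : ∃ ρ : ℝ, 0 < ρ ∧
        volume (Ω ∩ {x | ENNReal.ofReal ρ ≤ a x}) ≠ 0 := by
      by_contra! h
      refine h0 (measure_mono_null (t := ⋃ j : ℕ, Ω ∩ {x | ENNReal.ofReal (1 / ((j : ℝ) + 1)) ≤ a x})
        ?_ (measure_iUnion_null fun j => h _ (by positivity)))
      rintro x ⟨hxΩ, hxa⟩
      obtain ⟨t, ht0, hta⟩ := exists_between (pos_iff_ne_zero.2 hxa)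
      have htt : t ≠ ⊤ := ne_top_of_lt hta
      obtain ⟨j, hj⟩ := exists_nat_one_div_lt (ENNReal.toReal_pos ht0.ne' htt)
      refine mem_iUnion.2 ⟨j, hxΩ, ?_⟩
      exact ((ENNReal.ofReal_le_ofReal hj.le).trans (ENNReal.ofReal_toReal htt).le).trans hta.le
    have hSm : MeasurableSet (Ω ∩ {x | ENNReal.ofReal ρ ≤ a x}) :=
      hΩ.measurableSet.inter (measurableSet_le measurable_const ham)
    set C := cellDensity d α (ρ / 2) with hC
    have hCt : C ≠ ⊤ := (cellDensity_lt_top hd hα (by positivity)).ne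
    have hF2 : ∫⁻ x, ENNReal.ofReal (f x ^ 2) * C ≠ ⊤ := by
      rw [lintegral_mul_const _ hf2m, lintegral_ofReal_sq]
      exact ENNReal.mul_ne_top (ENNReal.pow_ne_top hf.2.ne) hCt
    obtain ⟨τ, hτ, hτe⟩ := exists_pos_setLIntegral_lt_of_measure_lt hF2 he
    obtain ⟨A, hAS, hAm, hA0, hAτ⟩ := exists_subset_measure_lt hd hSm hS hτ
    refine ⟨A, hAm, fun hνA => ?_, ?_⟩
    · have h1 : ENNReal.ofReal ρ * volume A ≤ ν A := by
        rw [← setLIntegral_const]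
        refine (setLIntegral_mono ham fun x hx => (hAS hx).2).trans ?_
        exact Measure.setLIntegral_rnDeriv_le A
      rw [hνA, nonpos_iff_eq_zero, mul_eq_zero] at h1
      rcases h1 with h1 | h1
      · exact absurd (ENNReal.ofReal_eq_zero.1 h1) (not_le.2 hρ)
      · exact hA0 h1
    · rw [inter_eq_self_of_subset_right (hAS.trans inter_subset_left)]
      refine le_trans ?_ (hτe A hAτ).le
      refine setLIntegral_mono_ae' hAm ?_
      filter_upwards [Measure.rnDeriv_lt_top ν volume] with x hx hxA
      refine mul_le_mul_right (limitDensity_le_cellDensity hd hα (by positivity) ?_ ?_) _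
      · exact ENNReal.div_ne_top hx.ne (by simp)
      · rw [ENNReal.ofReal_div_of_pos (by norm_num)]
        simpa using ENNReal.div_le_div_right (hAS hxA).2 2

/-- A measure of mass less than one, with density bounded below, whose energy is close to that
of `ν`. -/
theorem exists_perturbation (hd : 0 < d) {Ω : Set (Space d)} (hΩ : IsOpen Ω)
    (hΩb : Bornology.IsBounded Ω) (hΩne : Ω.Nonempty)
    {f : Space d → ℝ} (hfm : Measurable f) (hf : MemLp f 2 volume)
    {α : ℝ} (hα : 0 < α) (ν : Measure (Space d)) [IsProbabilityMeasure ν]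
    (hνc : ν (closure Ω)ᶜ = 0) {e : ℝ} (he : 0 < e) :
    ∃ (ν' : Measure (Space d)) (w s : ℝ) (h : Space d → ℝ≥0∞), IsFiniteMeasure ν' ∧
      ν' (closure Ω)ᶜ = 0 ∧ 0 < w ∧ ν'.real univ ≤ 1 - w ∧ Measurable h ∧
      IsLocallyFiniteMeasure (volume.withDensity h) ∧
      (∀ B ⊆ Ω, MeasurableSet B → ∫⁻ x in B, h x ≤ ν' B) ∧ 0 < s ∧
      (∀ x, ENNReal.ofReal s ≤ h x) ∧
      (∀ B, MeasurableSet B → ν B ≤ ν' B + ENNReal.ofReal e) ∧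
      ∫⁻ x in Ω, ENNReal.ofReal (f x ^ 2) * cellDensity d α ((h x).toReal - 3 * s / 4) ≤
        (∫⁻ x in Ω, ENNReal.ofReal (f x ^ 2) * limitDensity d α (ν.rnDeriv volume x)) +
          ENNReal.ofReal e := by
  classical
  set a := ν.rnDeriv volume with ha
  have ham : Measurable a := Measure.measurable_rnDeriv _ _
  set L := ∫⁻ x in Ω, ENNReal.ofReal (f x ^ 2) * limitDensity d α (a x) with hL
  obtain ⟨A, hAm, hA0, hAe⟩ : ∃ A, MeasurableSet A ∧ ν A ≠ 0 ∧ (L ≠ ⊤ →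
      ∫⁻ x in Ω ∩ A, ENNReal.ofReal (f x ^ 2) * limitDensity d α (a x / 2) ≤
        ENNReal.ofReal e) := by
    by_cases hLt : L = ⊤
    · exact ⟨univ, MeasurableSet.univ, by simp, fun h => absurd hLt h⟩
    · obtain ⟨A, h1, h2, h3⟩ := exists_set_lintegral_half_le hd hΩ hfm hf hα ν
        (e := ENNReal.ofReal e) (by simpa using he) hLt
      exact ⟨A, h1, h2, fun _ => h3⟩
  set q := ν.real A with hq
  have hq0 : 0 < q := ENNReal.toReal_pos hA0 (measure_ne_top _ _)
  -- A fraction κ of the mass on A is removed: κ ≤ 1/2 keeps at least half the density, and κ ≤ e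
  -- keeps the measures close.
  set κ : ℝ := min (1 / 2) e with hκ
  have hκ0 : 0 < κ := by positivity
  have hκ1 : κ ≤ 1 / 2 := min_le_left _ _
  have hV0 : 0 < volume.real Ω :=
    ENNReal.toReal_pos (hΩ.measure_pos _ hΩne).ne' hΩb.measure_lt_top.ne
  -- Half of the removed mass κ q returns as the uniform density s on Ω; the other half is w.
  set s : ℝ := κ * q / 2 / volume.real Ω with hs
  have hs0 : 0 < s := by positivity
  set m : Space d → ℝ≥0∞ := fun x => if x ∈ A then ENNReal.ofReal (1 - κ) else 1 with hm
  have hmm : Measurable m := Measurable.ite hAm measurable_const measurable_const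
  have hm1 : ∀ x, m x ≤ 1 := fun x => by
    simp only [hm]; split_ifs
    · rw [← ENNReal.ofReal_one]; exact ENNReal.ofReal_le_ofReal (by linarith)
    · exact le_rfl
  have hmκ : ∀ x, m x + ENNReal.ofReal κ * A.indicator (fun _ => 1) x = 1 := fun x => by
    simp only [hm]
    split_ifs with hx
    · rw [indicator_of_mem hx, mul_one, ← ENNReal.ofReal_add (by linarith) hκ0.le]
      simp
    · rw [indicator_of_notMem hx, mul_zero, add_zero]
  have hsplit : ∀ B, MeasurableSet B →
      ν B = ν.withDensity m B + ENNReal.ofReal κ * ν (A ∩ B) := by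
    intro B hB
    calc ν B = ∫⁻ _ in B, 1 ∂ν := by simp
      _ = ∫⁻ x in B, (m x + ENNReal.ofReal κ * A.indicator (fun _ => 1) x) ∂ν := by simp only [hmκ]
      _ = _ := by
        rw [lintegral_add_left hmm, withDensity_apply _ hB, lintegral_const_mul' _ _
          ENNReal.ofReal_ne_top, lintegral_indicator_const hAm, one_mul,
          Measure.restrict_apply hAm]
  have hmle : ν.withDensity m ≤ ν := by
    refine Measure.le_iff.2 fun B hB => ?_
    rw [hsplit B hB]; exact le_self_add
  have : IsFiniteMeasure (ν.withDensity m) := isFiniteMeasure_of_le ν hmle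
  have : IsFiniteMeasure (volume.restrict Ω) := ⟨by
    rw [Measure.restrict_apply_univ]; exact hΩb.measure_lt_top⟩
  set ν' : Measure (Space d) := ν.withDensity m + ENNReal.ofReal s • volume.restrict Ω with hν'
  have hfin : IsFiniteMeasure ν' := by
    have := Measure.smul_finite (volume.restrict Ω) (c := ENNReal.ofReal s) ENNReal.ofReal_ne_top
    rw [hν']; infer_instance
  set h : Space d → ℝ≥0∞ := fun x => m x * a x + ENNReal.ofReal s with hh
  have hhm : Measurable h := (hmm.mul ham).add_const _
  refine ⟨ν', κ * q / 2, s, h, hfin, ?_, by positivity, ?_, hhm, ?_, ?_, hs0,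
    fun x => le_add_self, ?_, ?_⟩
  · rw [hν', Measure.add_apply, Measure.smul_apply,
      Measure.restrict_apply isClosed_closure.isOpen_compl.measurableSet]
    have h1 : (closure Ω)ᶜ ∩ Ω = ∅ := by
      rw [inter_comm, ← sdiff_eq, sdiff_eq_empty]; exact subset_closure
    have h2 : ν.withDensity m (closure Ω)ᶜ = 0 := le_antisymm ((hmle _).trans hνc.le) zero_le
    rw [h1, h2]; simp
  · have h1 := hsplit univ MeasurableSet.univ
    rw [inter_univ, measure_univ] at h1
    have h2 : (ν.withDensity m).real univ + κ * q = 1 := by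
      have h3 := congrArg ENNReal.toReal h1
      rw [ENNReal.toReal_one, ENNReal.toReal_add (measure_ne_top _ _)
        (ENNReal.mul_ne_top ENNReal.ofReal_ne_top (measure_ne_top _ _)), ENNReal.toReal_mul,
        ENNReal.toReal_ofReal hκ0.le] at h3
      exact h3.symm
    have h4 : ν'.real univ = (ν.withDensity m).real univ + s * volume.real Ω := by
      rw [hν', measureReal_def, Measure.add_apply, Measure.smul_apply, Measure.restrict_apply_univ,
        smul_eq_mul, ENNReal.toReal_add (measure_ne_top _ _)
        (ENNReal.mul_ne_top ENNReal.ofReal_ne_top hΩb.measure_lt_top.ne), ENNReal.toReal_mul,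
        ENNReal.toReal_ofReal hs0.le]
      rfl
    have h5 : s * volume.real Ω = κ * q / 2 := by rw [hs]; field_simp
    linarith
  · refine ⟨fun x => ⟨Metric.ball x 1, Metric.ball_mem_nhds x one_pos, ?_⟩⟩
    rw [withDensity_apply _ Metric.isOpen_ball.measurableSet, hh,
      lintegral_add_right _ measurable_const, setLIntegral_const]
    refine ENNReal.add_lt_top.2 ⟨?_, ENNReal.mul_lt_top ENNReal.ofReal_lt_top
      Metric.isBounded_ball.measure_lt_top⟩
    refine lt_of_le_of_lt ?_ (measure_lt_top ν (Metric.ball x 1))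
    refine le_trans (lintegral_mono fun y => ?_) (Measure.setLIntegral_rnDeriv_le _)
    exact mul_le_of_le_one_left zero_le (hm1 y)
  · intro B hBΩ hB
    rw [hh, lintegral_add_right _ measurable_const, setLIntegral_const, hν', Measure.add_apply,
      Measure.smul_apply, Measure.restrict_apply hB, inter_eq_self_of_subset_left hBΩ, smul_eq_mul]
    refine add_le_add ?_ le_rfl
    have h1 := setLIntegral_withDensity_eq_setLIntegral_mul volume ham hmm hB
    have h2 : ∫⁻ x in B, m x * a x = ∫⁻ x in B, m x ∂(volume.withDensity a) := by
      rw [h1]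
      exact lintegral_congr fun x => mul_comm _ _
    rw [h2, withDensity_apply _ hB]
    exact lintegral_mono' (Measure.restrict_mono le_rfl (Measure.withDensity_rnDeriv_le _ _)) le_rfl
  · intro B hB
    rw [hsplit B hB]
    refine add_le_add (by rw [hν', Measure.add_apply]; exact le_self_add) ?_
    calc ENNReal.ofReal κ * ν (A ∩ B) ≤ ENNReal.ofReal e * 1 :=
          mul_le_mul' (ENNReal.ofReal_le_ofReal (min_le_right _ _)) prob_le_one
      _ = _ := mul_one _
  · by_cases hLt : L = ⊤
    · rw [hLt, top_add]; exact le_top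
    have hat : ∀ᵐ x, a x < ⊤ := Measure.rnDeriv_lt_top ν volume
    -- After subtracting 3s/4, h still strictly exceeds a off A and a/2 on A. This strictness allows
    -- comparison with θ⁻.
    rw [← lintegral_inter_add_sdiff _ Ω hAm, add_comm]
    refine add_le_add ?_ (le_trans ?_ (hAe hLt))
    · refine le_trans ?_ (lintegral_mono_set (sdiff_subset (t := A)))
      refine setLIntegral_mono_ae' (hΩ.measurableSet.diff hAm) ?_
      filter_upwards [hat] with x hx hxA
      have h1 : (h x).toReal = (a x).toReal + s := by
        simp only [hh, hm, if_neg hxA.2, one_mul]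
        rw [ENNReal.toReal_add hx.ne ENNReal.ofReal_ne_top, ENNReal.toReal_ofReal hs0.le]
      have h2 : 0 ≤ (a x).toReal := ENNReal.toReal_nonneg
      refine mul_le_mul_right (cellDensity_le_limitDensity hd hα ?_ ?_) _
      · linarith
      · rw [← ENNReal.ofReal_toReal hx.ne]
        exact (ENNReal.ofReal_lt_ofReal_iff (by linarith)).2 (by linarith)
    · refine setLIntegral_mono_ae' (hΩ.measurableSet.inter hAm) ?_
      filter_upwards [hat] with x hx hxA
      have h1 : (h x).toReal = (1 - κ) * (a x).toReal + s := by
        simp only [hh, hm, if_pos hxA.2]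
        rw [ENNReal.toReal_add (ENNReal.mul_ne_top ENNReal.ofReal_ne_top hx.ne)
          ENNReal.ofReal_ne_top, ENNReal.toReal_ofReal hs0.le, ENNReal.toReal_mul,
          ENNReal.toReal_ofReal (by linarith)]
      have h2 : 0 ≤ (a x).toReal := ENNReal.toReal_nonneg
      have h3 : (a x).toReal / 2 ≤ (1 - κ) * (a x).toReal := by nlinarith
      refine mul_le_mul_right (cellDensity_le_limitDensity hd hα ?_ ?_) _
      · linarith
      · have h4 : a x / 2 = ENNReal.ofReal ((a x).toReal / 2) := by
          rw [ENNReal.ofReal_div_of_pos (by norm_num), ENNReal.ofReal_toReal hx.ne]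
          simp
        rw [h4]
        exact (ENNReal.ofReal_lt_ofReal_iff (by linarith)).2 (by linarith)

end Perturbation

/-! ### Recovery sequences and reduction to a measurable load. -/

section Recovery
variable {d : ℕ}

/-- Diagonal argument: at stage n the best precision 1/(k + 1) with k ≤ n that is attainable is
used. -/
theorem exists_recovery_sequence {X : Type*} [PseudoMetricSpace X] (F : ℕ → X → ℝ≥0∞) (x : X)
    (G : ℝ≥0∞) (h : ∀ e : ℝ, 0 < e → ∀ᶠ n in atTop, ∃ y, F n y ≤ G + ENNReal.ofReal e ∧
      dist y x ≤ e) :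
    ∃ y : ℕ → X, Tendsto y atTop (𝓝 x) ∧ limsup (fun n => F n (y n)) atTop ≤ G := by
  classical
  set e : ℕ → ℝ := fun k => 1 / ((k : ℝ) + 1) with he
  have he0 : ∀ k, 0 < e k := fun k => by positivity
  have hemono : ∀ k l, k ≤ l → e l ≤ e k := fun k l h => Nat.one_div_le_one_div h
  have het : Tendsto e atTop (𝓝 0) := tendsto_one_div_add_atTop_nhds_zero_nat
  set Q : ℕ → ℕ → Prop := fun n k => ∃ y, F n y ≤ G + ENNReal.ofReal (e k) ∧ dist y x ≤ e k
    with hQ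
  set κ : ℕ → ℕ := fun n => Nat.findGreatest (Q n) n with hκ
  set y : ℕ → X := fun n => if h : Q n (κ n) then h.choose else x with hy
  have key : ∀ k, ∀ᶠ n in atTop, F n (y n) ≤ G + ENNReal.ofReal (e k) ∧ dist (y n) x ≤ e k := by
    intro k
    filter_upwards [h (e k) (he0 k), eventually_ge_atTop k] with n hn hkn
    have h1 : Q n (κ n) := Nat.findGreatest_spec hkn hn
    have h2 : k ≤ κ n := Nat.le_findGreatest hkn hn
    have h3 : y n = h1.choose := by simp only [hy, dif_pos h1]
    obtain ⟨h4, h5⟩ := h1.choose_spec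
    rw [h3]
    exact ⟨h4.trans (add_le_add le_rfl (ENNReal.ofReal_le_ofReal (hemono _ _ h2))),
      h5.trans (hemono _ _ h2)⟩
  refine ⟨y, ?_, ?_⟩
  · rw [Metric.tendsto_nhds]
    intro r hr
    obtain ⟨k, hk⟩ := (het.eventually (gt_mem_nhds hr)).exists
    exact (key k).mono fun n hn => hn.2.trans_lt hk
  · have h1 : Tendsto (fun k => G + ENNReal.ofReal (e k)) atTop (𝓝 G) := by
      have := ((ENNReal.continuous_ofReal.tendsto 0).comp het).const_add G
      simpa using this
    refine ge_of_tendsto' h1 fun k => ?_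
    exact limsup_le_of_le (by isBoundedDefault) ((key k).mono fun n hn => hn.1)

theorem isProbabilityMeasure_empirical {Ω : Set (Space d)} (p : Space d → closure Ω) {n : ℕ}
    (hn : 0 < n) (x : Fin n → Space d) : IsProbabilityMeasure (empirical p x) := by
  refine ⟨?_⟩
  rw [empirical, Measure.smul_apply, Measure.finsetSum_apply]
  simp only [measure_univ, Finset.sum_const, Finset.card_univ, Fintype.card_fin, smul_eq_mul,
    nsmul_eq_mul, mul_one]
  exact ENNReal.inv_mul_cancel (by exact_mod_cast hn.ne') (by simp)

theorem eventually_exists_functionalSeq_le (hd : 0 < d) {Ω : Set (Space d)} (hΩ : IsOpen Ω)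
    (hΩb : Bornology.IsBounded Ω) (p : Space d → closure Ω) (hp : ∀ y : closure Ω, p y = y)
    {f : Space d → ℝ} (hfm : Measurable f) (hf : MemLp f 2 volume) (hf0 : ∀ x, x ∉ Ω → f x = 0)
    {α : ℝ} (hα : 0 < α) (μ : ProbabilityMeasure (closure Ω)) {e : ℝ} (he : 0 < e) :
    ∀ᶠ n : ℕ in atTop, ∃ y : ProbabilityMeasure (closure Ω),
      functionalSeq Ω p f α n y ≤ limitFunctional Ω f α μ + ENNReal.ofReal e ∧
      levyProkhorovDist (μ : Measure (closure Ω)) (y : Measure (closure Ω)) ≤ e := by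
  classical
  set ν : Measure (Space d) := (μ : Measure (closure Ω)).map Subtype.val with hν
  have : IsProbabilityMeasure ν :=
    Measure.isProbabilityMeasure_map measurable_subtype_coe.aemeasurable
  have hνc : ν (closure Ω)ᶜ = 0 := by
    rw [hν, Measure.map_apply measurable_subtype_coe isClosed_closure.isOpen_compl.measurableSet]
    simp
  have hΩne : Ω.Nonempty := by
    obtain ⟨y⟩ := μ.nonempty
    exact closure_nonempty_iff.1 ⟨y, y.2⟩
  obtain ⟨ν', w, s, h, _, hν'c, hw, hν'w, hhm, _, hhν', hs, hsh, hνν', hE⟩ :=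
    exists_perturbation hd hΩ hΩb hΩne hfm hf hα ν hνc (e := e / 2) (by positivity)
  set L := ∫⁻ x in Ω, ENNReal.ofReal (f x ^ 2) * limitDensity d α (ν.rnDeriv volume x) with hL
  have hLF : limitFunctional Ω f α μ = L := limitFunctional_eq Ω f α μ
  rw [hLF]
  have hM : ∫⁻ x in Ω, ENNReal.ofReal (f x ^ 2) * cellDensity d α ((h x).toReal - 3 * s / 4) <
      L + ENNReal.ofReal e := by
    -- A strict inequality is needed even when L = ⊤; the left side is finite because h ≥ s.
    rcases eq_or_ne L ⊤ with hLt | hLt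
    · rw [hLt, top_add]
      have hC := cellDensity_lt_top hd hα (show 0 < s / 4 by positivity)
      refine lt_of_le_of_lt (b := ∫⁻ x, ENNReal.ofReal (f x ^ 2) * cellDensity d α (s / 4))
        (le_trans (lintegral_mono_ae ?_) (setLIntegral_le_lintegral Ω _)) ?_
      · refine ae_restrict_of_ae ?_
        filter_upwards [Measure.rnDeriv_withDensity volume hhm,
          Measure.rnDeriv_lt_top (volume.withDensity h) volume] with x hx hxt
        rw [hx] at hxt
        have h1 : s ≤ (h x).toReal := (ENNReal.ofReal_le_iff_le_toReal hxt.ne).1 (hsh x)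
        exact mul_le_mul_right (cellDensity_antitone hd hα (by positivity) (by linarith)) _
      · rw [lintegral_mul_const' _ _ hC.ne, lintegral_ofReal_sq]
        exact ENNReal.mul_lt_top (ENNReal.pow_lt_top hf.2) hC
    · refine hE.trans_lt ((ENNReal.add_lt_add_iff_left hLt).2 ?_)
      exact (ENNReal.ofReal_lt_ofReal_iff he).2 (by linarith)
  filter_upwards [eventually_exists_centres_le hd hΩ hΩb hΩne hfm hf hf0 hα hν'c hw hν'w hhm hhν' hs
    hsh hM (e := e / 2) (by positivity), eventually_gt_atTop 0] with n hn hn0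
  obtain ⟨x, hxΩ, hxE, hxB⟩ := hn
  have hprob := isProbabilityMeasure_empirical p hn0 x
  refine ⟨⟨empirical p x, hprob⟩, ?_, ?_⟩
  · have hadm : AdmissibleCentres α Ω x := fun i =>
      Metric.closure_subset_thickening (radius_pos hα hn0) Ω (hxΩ i)
    refine le_trans ?_ hxE
    unfold functionalSeq
    exact iInf_le_of_le x (iInf_le_of_le hadm (iInf_le_of_le rfl le_rfl))
  -- For probability measures one of the two inequalities suffices. One e/2 pays for the
  -- perturbation, the other for the discretisation.
  · refine levyProkhorovDist_le_of_forall_le (μ : Measure (closure Ω)) (empirical p x) he.le fun ε B hεe hB => ?_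
    have hB' : MeasurableSet (Subtype.val '' B) :=
      MeasurableSet.subtype_image isClosed_closure.measurableSet hB
    have h1 : (μ : Measure (closure Ω)) B = ν (Subtype.val '' B) := by
      rw [hν, Measure.map_apply measurable_subtype_coe hB',
        preimage_image_eq _ Subtype.val_injective]
    obtain ⟨C, hC⟩ : ∃ C : Set (Space d),
        C = Metric.thickening (e / 2) (Subtype.val '' B) ∩ closure Ω := ⟨_, rfl⟩
    have hCm : MeasurableSet C := hC ▸
      Metric.isOpen_thickening.measurableSet.inter isClosed_closure.measurableSet
    have h2 : (Subtype.val ⁻¹' C : Set (closure Ω)) ⊆ Metric.thickening ε B := by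
      intro b hbC
      have hb := (hC ▸ hbC : (b : Space d) ∈ _ ∩ closure Ω).1
      obtain ⟨-, ⟨b', hb', rfl⟩, hbb⟩ := Metric.mem_thickening_iff.1 hb
      refine Metric.mem_thickening_iff.2 ⟨b', hb', ?_⟩
      have : dist b b' = dist (b : Space d) b' := rfl
      linarith
    have h3 : ((Finset.univ.filter fun i => x i ∈ Metric.thickening (e / 2)
        (Subtype.val '' B)).card : ℝ≥0∞) ≤ n * empirical p x (Subtype.val ⁻¹' C) := by
      refine le_trans ?_ (card_filter_le_mul_empirical p hp x hCm (hC ▸ inter_subset_right))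
      refine Nat.cast_le.2 (Finset.card_le_card fun i hi => ?_)
      exact Finset.mem_filter.2 ⟨Finset.mem_univ _, hC ▸ ⟨(Finset.mem_filter.1 hi).2, hxΩ i⟩⟩
    have hn' : (n : ℝ≥0∞) ≠ 0 := by exact_mod_cast hn0.ne'
    have h4 : ν' (Subtype.val '' B) ≤
        empirical p x (Subtype.val ⁻¹' C) + ENNReal.ofReal (e / 2) := by
      rw [← ENNReal.mul_le_mul_iff_right hn' (ENNReal.natCast_ne_top n), mul_add]
      exact (hxB _).trans (add_le_add h3 le_rfl)
    rw [h1]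
    calc ν (Subtype.val '' B) ≤ ν' (Subtype.val '' B) + ENNReal.ofReal (e / 2) := hνν' _ hB'
      _ ≤ empirical p x (Subtype.val ⁻¹' C) + ENNReal.ofReal (e / 2) + ENNReal.ofReal (e / 2) :=
        add_le_add h4 le_rfl
      _ ≤ _ := by
        rw [add_assoc, ← ENNReal.ofReal_add (by positivity) (by positivity), add_halves]
        exact add_le_add (measure_mono h2) (ENNReal.ofReal_le_ofReal hεe.le)

theorem exists_limsup_le_limitFunctional (hd : 0 < d) {Ω : Set (Space d)} (hΩ : IsOpen Ω)
    (hΩb : Bornology.IsBounded Ω) (p : Space d → closure Ω) (hp : ∀ y : closure Ω, p y = y)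
    {f : Space d → ℝ} (hfm : Measurable f) (hf : MemLp f 2 volume) (hf0 : ∀ x, x ∉ Ω → f x = 0)
    {α : ℝ} (hα : 0 < α) (μ : ProbabilityMeasure (closure Ω)) :
    ∃ y : ℕ → ProbabilityMeasure (closure Ω), Tendsto y atTop (𝓝 μ) ∧
      limsup (fun n => functionalSeq Ω p f α n (y n)) atTop ≤ limitFunctional Ω f α μ := by
  obtain ⟨y, hy, hyl⟩ := exists_recovery_sequence
    (fun n (y : LevyProkhorov (ProbabilityMeasure (closure Ω))) =>
      functionalSeq Ω p f α n y.toMeasure) (LevyProkhorov.ofMeasure μ) (limitFunctional Ω f α μ)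
    (fun e he => by
      filter_upwards [eventually_exists_functionalSeq_le hd hΩ hΩb p hp hfm hf hf0 hα μ he] with n hn
      obtain ⟨y, h1, h2⟩ := hn
      refine ⟨LevyProkhorov.ofMeasure y, h1, ?_⟩
      rw [dist_comm]
      exact h2)
  refine ⟨fun n => (y n).toMeasure, ?_, hyl⟩
  exact (LevyProkhorov.continuous_toMeasure_probabilityMeasure.tendsto _).comp hy

/-- The dual energy depends only on the a.e. class of the load, whatever the centres. -/
theorem functionalSeq_congr (hd : 0 < d) {Ω : Set (Space d)} (hΩ : IsOpen Ω)
    (hΩb : Bornology.IsBounded Ω) (p : Space d → closure Ω) {f g : Space d → ℝ}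
    (hf : MemLp f 2 (volume.restrict Ω)) (hg : MemLp g 2 (volume.restrict Ω))
    (hfg : f =ᵐ[volume.restrict Ω] g) (α : ℝ) : functionalSeq Ω p f α = functionalSeq Ω p g α := by
  funext n μ
  unfold functionalSeq
  refine iInf_congr fun x => iInf_congr fun _ => iInf_congr fun _ => ?_
  rw [scaledCompliance_eq hd hΩb hΩ hf, scaledCompliance_eq hd hΩb hΩ hg]
  congr 1
  refine dualEnergy_congr ?_
  filter_upwards [(ae_restrict_iff' hΩ.measurableSet).1 hfg] with x hx hxΩ
  exact hx hxΩ.1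

theorem limitFunctional_congr {Ω : Set (Space d)} {f g : Space d → ℝ}
    (hfg : f =ᵐ[volume.restrict Ω] g) (α : ℝ) : limitFunctional Ω f α = limitFunctional Ω g α := by
  funext μ
  unfold limitFunctional
  refine lintegral_congr_ae ?_
  filter_upwards [hfg] with x hx
  rw [hx]

theorem exists_measurable_representative {Ω : Set (Space d)} (hΩ : IsOpen Ω) {f : Space d → ℝ}
    (hf : MemLp f 2 (volume.restrict Ω)) : ∃ g : Space d → ℝ, Measurable g ∧ MemLp g 2 volume ∧
      (∀ x, x ∉ Ω → g x = 0) ∧ f =ᵐ[volume.restrict Ω] g := by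
  have hm := hf.1.stronglyMeasurable_mk.measurable
  refine ⟨Ω.indicator (hf.1.mk f), hm.indicator hΩ.measurableSet, ?_, fun x hx =>
    indicator_of_notMem hx _, ?_⟩
  · exact (memLp_indicator_iff_restrict hΩ.measurableSet).2 (hf.ae_eq hf.1.ae_eq_mk)
  · filter_upwards [hf.1.ae_eq_mk, ae_restrict_mem hΩ.measurableSet] with x hx hxΩ
    rw [indicator_of_mem hxΩ, hx]

end Recovery

end

end ComplianceLocation

theorem theorem2p2 {d : ℕ} (hd : 0 < d) (Ω : Set (ComplianceLocation.Space d))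
    (hΩ : IsOpen Ω) (hΩb : Bornology.IsBounded Ω)
    (p : ComplianceLocation.Space d → closure Ω) (hp : ∀ y : closure Ω, p y = y)
    (f : ComplianceLocation.Space d → ℝ) (hf : MemLp f 2 (volume.restrict Ω))
    (hf0 : ∀ᵐ x ∂(volume.restrict Ω), 0 ≤ f x)
    (α : ℝ) (hα : 0 < α) :
    ComplianceLocation.GammaConverges (ComplianceLocation.functionalSeq Ω p f α)
      (ComplianceLocation.limitFunctional Ω f α) := by
  -- A Borel representative vanishing off Ω: the bounds integrate f² as a measurable function over
  -- the whole space.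
  obtain ⟨g, hgm, hg, hg0, hfg⟩ := ComplianceLocation.exists_measurable_representative hΩ hf
  rw [ComplianceLocation.functionalSeq_congr hd hΩ hΩb p hf
    (hg.mono_measure Measure.restrict_le_self) hfg, ComplianceLocation.limitFunctional_congr hfg]
  exact ⟨fun _ _ hy => ComplianceLocation.limitFunctional_le_liminf hd hΩ hΩb p hp hgm hg hg0 hα hy,
    fun μ => ComplianceLocation.exists_limsup_le_limitFunctional hd hΩ hΩb p hp hgm hg hg0 hα μ⟩
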